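/- All fields have characteristic $0$. A variety over an algebraically closed field $K$ is an integral separated scheme of finite type over $K$; subvarieties are closed and irreducible; for an extension $K\subset L$ of algebraically closed fields, $V_L$ denotes the base change of $V$ to $L$. **Distinguished categories.** Let $\mathfrak C$ be a category with a functor $\mathcal F$ to varieties over $K$. We do not distinguish objects and morphisms of $\mathfrak C$ ("distinguished varieties" and "distinguished morphisms") from their images under $\mathcal F$. The category is *distinguished* if: (A1) for any objects $X,Y$ there are an object $X\times Y$ and morphisms $X\times Y\to X$, $X\times Y\to Y$ in $\mathfrak C$ which induce an isomorphism of $\mathcal F(X\times Y)$ with $\mathcal F(X)\times_K\mathcal F(Y)$, and any two morphisms $W\to X$, $W\to Y$ in $\mathfrak C$ factor through a morphism $W\to X\times Y$ in $\mathfrak C$; (A2) for morphisms $X\to Z$, $Y\to Z$ there are finitely many morphisms $\phi_i:X_i\to X\times Y$ in $\mathfrak C$ with $\bigcup_i\phi_i(X_i)=(X\times_ZY)_{\mathrm{red}}$; (A3) $\mathfrak C$ has a final object that $\mathcal F$ maps to $\operatorname{Spec}K$; (A4) every morphism $\phi:X\to Y$ has closed image, and there are morphisms $\phi_1:W\to X$,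 $\phi_2:W\to Z$, $\phi_3:Z\to Y$ in $\mathfrak C$ with $\phi\circ\phi_1=\phi_3\circ\phi_2$ such that $\phi_1$ is finite and surjective, $\phi_3$ has finite fibers, every non-empty fiber of $\phi_2$ is irreducible, and $\dim_w\phi_2^{-1}(\phi_2(w))$ is constant for $w\in W$. For an extension $K\subset L$ of algebraically closed fields, $\mathfrak C_L$ is the category $\mathfrak C$ with $\mathcal F$ composed with base change to $L$; it is a distinguished category over $L$, and its objects are denoted $X_L$. **Special subvarieties and optimality.** A subvariety of a distinguished variety $X$ is *special* if it is the image of a distinguished morphism, and *weakly special* if it is an irreducible component of $\phi(\psi^{-1}(y))$ for distinguished morphisms $\phi:Z\to X$, $\psi:Z\to Y$ and some $y\in Y(K)$. Let $\langle V\rangle$ and $\langle V\rangle_{\mathrm{ws}}$ be the smallest special and the smallest weakly special subvariety containing the subvariety $V\subset X$, and let $\delta(V)=\dim\langle V\rangle-\dim V$ (the *defect*) and $\delta_{\mathrm{ws}}(V)=\dim\langle V\rangle_{\mathrm{ws}}-\dim V$. A subvariety $W\subset V$ is *optimal* for $V$ in $X$ if $\delta(U)>\delta(W)$ for every subvariety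 $U$ with $W\subsetneq U\subset V$, and *weakly optimal* if the same holds with $\delta_{\mathrm{ws}}$ in place of $\delta$. For integers $m,d$, we say that $\mathrm{ZP}(X,m,d)$ holds if every subvariety $V$ of $X$ of dimension at most $m$ contains at most finitely many subvarieties that are optimal for $V$ in $X$ and have defect at most $d$ (so it holds vacuously if $m<0$ and trivially if $d<0$). **Weak finiteness.** Axiom (A5) says: for every distinguished variety $X$ and every subvariety $V\subset X$ there is a finite set of pairs $(\phi,\psi)$ of distinguished morphisms $\phi:Y_\phi\to X$, $\psi:Y_\phi\to Z_\psi$ such that for every $W$ weakly optimal for $V$ in $X$ there are a pair $(\phi,\psi)$ in this set and $z\in Z_\psi(K)$ such that $\phi$ has finite fibers and $\langle W\rangle_{\mathrm{ws}}$ is an irreducible component of $\phi(\psi^{-1}(z))$. A distinguished category $\mathfrak C$ over $K$ is *very distinguished* if $\mathfrak C_{K'}$ satisfies (A5) for every extension $K\subset K'$ of algebraically closed fields of finite transcendence degree. **Theorem.** Let $m,d\ge 0$ be integers, let $K\subset L$ be an extension of algebraically closed fields, let $\mathfrak C$ be a very distinguished category over $K$, and let $X$ be a distinguished variety. Let $\mathcal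 S$ be a class of distinguished varieties such that $X\in\mathcal S$ and such that for every $X'\in\mathcal S$, every algebraically closed extension $K\subset K'$ of finite transcendence degree and every subvariety $V$ of $X'_{K'}$, the finite set in (A5) for $V\subset X'_{K'}$ in $\mathfrak C_{K'}$ can be chosen with all $Y_\phi,Z_\psi$ equal to base changes of distinguished varieties belonging to $\mathcal S$. Then: (1) If $\mathrm{ZP}(X',m,d)$ holds for all $X'\in\mathcal S$, then $\mathrm{ZP}(X_L,m,d)$ holds. (2) Suppose that $\mathrm{ZP}(X',m-1,d)$ and $\mathrm{ZP}(X',m,d-1)$ hold for all $X'\in\mathcal S$. Let $V$ be a subvariety of $X_L$ of dimension at most $m$ which is not the base change of a subvariety of $X$. Then $V$ contains at most finitely many subvarieties that are optimal for $V$ in $X_L$ and have defect at most $d$. -/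

import Mathlib

open CategoryTheory CategoryTheory.Limits AlgebraicGeometry TopologicalSpace

universe w v u

noncomputable section

namespace UnlikelyIntersections

/-! ### Subsets of topological spaces: components and dimension -/

section Topology

variable {T : Type u} [TopologicalSpace T]

/-- `W` is an irreducible component of the subset `A`: a maximal irreducible subset of `A`. -/
def IsComponentOf (W A : Set T) : Prop :=
  Maximal (fun s : Set T => IsIrreducible s ∧ s ⊆ A) W

/-- The Krull dimension of a subset, as an integer. (It is only used for non-empty subsets of
varieties, and these have finite dimension.) -/
def dim (A : Set T) : ℤ :=
  (((topologicalKrullDim A).unbotD 0).toNat : ℤ)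

/-- The local dimension `dim_x A` of the subset `A` at `x`: the infimum of the dimensions of the
open neighbourhoods of `x` in `A`. -/
def localDim (A : Set T) (x : T) : WithBot ℕ∞ :=
  ⨅ U : {U : Set T // IsOpen U ∧ x ∈ U}, topologicalKrullDim (A ∩ U.1 : Set T)

end Topology

/-! ### Varieties over a field -/

section Varieties

variable (K : Type u) [Field K]

/-- The category of schemes over `K`. -/
abbrev SchemesOver : Type (u + 1) := Over (Spec (CommRingCat.of K))

variable {K}

/-- Varieties over `K`: integral separated schemes of finite type over `K`. -/
structure IsVariety (X : SchemesOver K) : Prop where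
  isIntegral : IsIntegral X.left
  isSeparated : IsSeparated X.hom
  locallyOfFiniteType : LocallyOfFiniteType X.hom
  quasiCompact : QuasiCompact X.hom

/-- The points of the scheme `X` that come from a `K`-rational point `Spec K ⟶ X`. -/
def IsRationalPoint (X : SchemesOver K) (x : X.left) : Prop :=
  ∃ s : Over.mk (𝟙 (Spec (CommRingCat.of K))) ⟶ X, Set.range s.left = {x}

/-- All fibres of the underlying map of schemes are finite sets. -/
def HasFiniteFibers {X Y : SchemesOver K} (f : X ⟶ Y) : Prop :=
  ∀ y : Y.left, (f.left ⁻¹' {y}).Finite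

/-- Base change of schemes along a field extension `K ⊂ L`, `X ↦ X_L = X ×_K L`. -/
abbrev schemeBaseChange (K L : Type u) [Field K] [Field L] [Algebra K L] :
    SchemesOver K ⥤ SchemesOver L :=
  Over.pullback (Spec.map (CommRingCat.ofHom (algebraMap K L)))

/-- The projection `X_L → X`. -/
def schemeBaseChangeProj (L : Type u) [Field L] [Algebra K L] (X : SchemesOver K) :
    ((schemeBaseChange K L).obj X).left ⟶ X.left :=
  pullback.fst X.hom (Spec.map (CommRingCat.ofHom (algebraMap K L)))

end Varieties

/-! ### Distinguished categories

The data are a category `C` and a functor `F` from `C` to schemes over `K`; that `F` takes values in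
varieties and satisfies the axioms is the predicate `IsDistinguished F`. -/

section Category

variable {C : Type v} [Category.{w} C] {K : Type u} [Field K] (F : C ⥤ SchemesOver K)

/-- `P`, with `p : P ⟶ X` and `q : P ⟶ Y`, is a product of `X` and `Y` in the sense of the
axiom on direct products: `F(P)` is the product `F(X) ×_K F(Y)` via `F(p)` and `F(q)`, and any pair
of morphisms `W ⟶ X`, `W ⟶ Y` factors through `P` (not necessarily uniquely). -/
structure IsDistinguishedProduct {X Y P : C} (p : P ⟶ X) (q : P ⟶ Y) : Prop where
  isPullback : IsPullback (F.map p).left (F.map q).left (F.obj X).hom (F.obj Y).hom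
  exists_lift : ∀ (W : C) (φ : W ⟶ X) (ψ : W ⟶ Y), ∃ χ : W ⟶ P, χ ≫ p = φ ∧ χ ≫ q = ψ

variable {F} in
/-- The canonical morphism `F(X) ×_{F(Z)} F(Y) → F(X) ×_K F(Y) = F(P)`. -/
def IsDistinguishedProduct.fiberProductMap {X Y P Z : C} {p : P ⟶ X} {q : P ⟶ Y}
    (h : IsDistinguishedProduct F p q) (φ : X ⟶ Z) (ψ : Y ⟶ Z) :
    pullback (F.map φ).left (F.map ψ).left ⟶ (F.obj P).left :=
  h.isPullback.lift (pullback.fst _ _) (pullback.snd _ _) (by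
    rw [← Over.w (F.map φ), ← Over.w (F.map ψ), ← Category.assoc, ← Category.assoc,
      pullback.condition])

/-- Distinguished categories over `K`: `F` takes values in varieties and satisfies the axioms on
direct products, fibred products, the final object and the fibre dimension. -/
structure IsDistinguished : Prop where
  isVariety : ∀ X : C, IsVariety (F.obj X)
  /-- Direct products. -/
  directProducts : ∀ X Y : C, ∃ (P : C) (p : P ⟶ X) (q : P ⟶ Y), IsDistinguishedProduct F p q
  /-- Fibred products: `(F(X) ×_{F(Z)} F(Y))_red`, as a closed subset of `F(X) ×_K F(Y)`, is a
  finite union of images of morphisms. -/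
  fiberedProducts : ∀ (X Y Z P : C) (φ : X ⟶ Z) (ψ : Y ⟶ Z) (p : P ⟶ X) (q : P ⟶ Y)
    (h : IsDistinguishedProduct F p q),
    ∃ (n : ℕ) (A : Fin n → C) (α : ∀ i, A i ⟶ P),
      ⋃ i, Set.range (F.map (α i)).left = Set.range (h.fiberProductMap φ ψ)
  /-- Final object. -/
  finalObject : ∃ T : C, Nonempty (IsTerminal T) ∧
    Nonempty (F.obj T ≅ Over.mk (𝟙 (Spec (CommRingCat.of K))))
  /-- Fibre dimension, first part: images are closed. -/
  isClosed_range : ∀ (X Y : C) (φ : X ⟶ Y), IsClosed (Set.range (F.map φ).left)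
  /-- Fibre dimension, second part: the factorization. -/
  fiberDimension : ∀ (X Y : C) (φ : X ⟶ Y),
    ∃ (W Z : C) (φ₁ : W ⟶ X) (φ₂ : W ⟶ Z) (φ₃ : Z ⟶ Y),
      φ₁ ≫ φ = φ₂ ≫ φ₃ ∧
      IsFinite (F.map φ₁).left ∧ Surjective (F.map φ₁).left ∧
      HasFiniteFibers (F.map φ₃) ∧
      (∀ z ∈ Set.range (F.map φ₂).left, IsIrreducible ((F.map φ₂).left ⁻¹' {z})) ∧
      ∃ n : WithBot ℕ∞, ∀ w : (F.obj W).left,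
        localDim ((F.map φ₂).left ⁻¹' {(F.map φ₂).left w}) w = n

/-- Subvarieties of the distinguished variety `X`, as irreducible closed subsets of the scheme
`F(X)` (always with the reduced structure). -/
abbrev Subvariety (X : C) : Type u := IrreducibleCloseds (F.obj X).left

/-- Special subvarieties: images of distinguished morphisms. -/
def IsSpecial {X : C} (V : Subvariety F X) : Prop :=
  ∃ (Y : C) (φ : Y ⟶ X), (V : Set (F.obj X).left) = Set.range (F.map φ).left

/-- The subset `φ(ψ⁻¹(y))` of `X`, for `φ : Z ⟶ X` and `ψ : Z ⟶ Y`. -/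
def imageOfFiber {X Y Z : C} (φ : Z ⟶ X) (ψ : Z ⟶ Y) (y : (F.obj Y).left) :
    Set (F.obj X).left :=
  (F.map φ).left '' ((F.map ψ).left ⁻¹' {y})

/-- Weakly special subvarieties: components of the sets `φ(ψ⁻¹(y))` with `y` a `K`-point. -/
def IsWeaklySpecial {X : C} (V : Subvariety F X) : Prop :=
  ∃ (Y Z : C) (φ : Z ⟶ X) (ψ : Z ⟶ Y) (y : (F.obj Y).left),
    IsRationalPoint (F.obj Y) y ∧ IsComponentOf (V : Set (F.obj X).left) (imageOfFiber F φ ψ y)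

/-- `⟨V⟩`, the smallest special subvariety containing `V`, given as the intersection of
all special subvarieties containing `V`. -/
def specialHull {X : C} (V : Subvariety F X) : Set (F.obj X).left :=
  ⋂ S ∈ {S : Subvariety F X | IsSpecial F S ∧ V ≤ S}, (S : Set (F.obj X).left)

/-- `⟨V⟩_ws`, the smallest weakly special subvariety containing `V`, given as the intersection of
all weakly special subvarieties containing `V`. -/
def weaklySpecialHull {X : C} (V : Subvariety F X) : Set (F.obj X).left :=
  ⋂ S ∈ {S : Subvariety F X | IsWeaklySpecial F S ∧ V ≤ S}, (S : Set (F.obj X).left)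

theorem specialHull_eq_of_isLeast {X : C} {V S : Subvariety F X}
    (h : IsLeast {S : Subvariety F X | IsSpecial F S ∧ V ≤ S} S) :
    specialHull F V = S :=
  Set.Subset.antisymm (Set.biInter_subset_of_mem h.1)
    (Set.subset_iInter₂ fun _ hT => SetLike.coe_subset_coe.mpr (h.2 hT))

theorem weaklySpecialHull_eq_of_isLeast {X : C} {V S : Subvariety F X}
    (h : IsLeast {S : Subvariety F X | IsWeaklySpecial F S ∧ V ≤ S} S) :
    weaklySpecialHull F V = S :=
  Set.Subset.antisymm (Set.biInter_subset_of_mem h.1)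
    (Set.subset_iInter₂ fun _ hT => SetLike.coe_subset_coe.mpr (h.2 hT))

/-- The defect `δ(V) = dim ⟨V⟩ - dim V`. -/
def defect {X : C} (V : Subvariety F X) : ℤ :=
  dim (specialHull F V) - dim (V : Set (F.obj X).left)

/-- The weak defect `δ_ws(V) = dim ⟨V⟩_ws - dim V`. -/
def weakDefect {X : C} (V : Subvariety F X) : ℤ :=
  dim (weaklySpecialHull F V) - dim (V : Set (F.obj X).left)

/-- `W` is optimal for `V` in `X`. -/
def IsOptimal {X : C} (V W : Subvariety F X) : Prop :=
  W ≤ V ∧ ∀ U : Subvariety F X, W < U → U ≤ V → defect F W < defect F U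

/-- `W` is weakly optimal for `V` in `X`. -/
def IsWeaklyOptimal {X : C} (V W : Subvariety F X) : Prop :=
  W ≤ V ∧ ∀ U : Subvariety F X, W < U → U ≤ V → weakDefect F W < weakDefect F U

/-- A pair of distinguished morphisms `φ : Y ⟶ X` and `ψ : Y ⟶ Z`. -/
structure MorphismPair (X : C) where
  Y : C
  Z : C
  φ : Y ⟶ X
  ψ : Y ⟶ Z

/-- The assertion of the weak finiteness axiom for a subvariety `V` of `X`, where in addition the
finite set of pairs `(φ, ψ)` can be chosen with all `Y`, `Z` in the class `S`. -/
def WeakFinitenessWithin (S : Set C) {X : C} (V : Subvariety F X) : Prop :=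
  ∃ Φ : Set (MorphismPair X), Φ.Finite ∧ (∀ p ∈ Φ, p.Y ∈ S ∧ p.Z ∈ S) ∧
    ∀ W : Subvariety F X, IsWeaklyOptimal F V W →
      ∃ p ∈ Φ, ∃ z : (F.obj p.Z).left, IsRationalPoint (F.obj p.Z) z ∧
        HasFiniteFibers (F.map p.φ) ∧
        IsComponentOf (weaklySpecialHull F W) (imageOfFiber F p.φ p.ψ z)

/-- The weak finiteness axiom. -/
def WeakFiniteness : Prop :=
  ∀ (X : C) (V : Subvariety F X), WeakFinitenessWithin F Set.univ V

/-- `V` contains at most finitely many optimal subvarieties (i.e. subvarieties optimal for `V` in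
`X`) of defect at most `d`. -/
def FinitelyManyOptimal (d : ℤ) {X : C} (V : Subvariety F X) : Prop :=
  {W : Subvariety F X | IsOptimal F V W ∧ defect F W ≤ d}.Finite

/-- The statement `ZP(X, m, d)`, for arbitrary integers `m` and `d`. -/
def ZP (X : C) (m d : ℤ) : Prop :=
  ∀ V : Subvariety F X, dim (V : Set (F.obj X).left) ≤ m → FinitelyManyOptimal F d V

/-- The base change `C_L`: the same category `C`, with `F` composed with base change to `L`. -/
abbrev baseChange (L : Type u) [Field L] [Algebra K L] : C ⥤ SchemesOver L :=
  F ⋙ schemeBaseChange K L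

variable {F} in
/-- The subvariety `V` of `X_L` is the base change of a subvariety `V'` of `X`: the closed subset
underlying `V'_L = V' ×_K L` is the preimage of `V'` under `X_L → X`. -/
def IsBaseChangeOfSubvariety {L : Type u} [Field L] [Algebra K L] {X : C}
    (V : Subvariety (baseChange F L) X) : Prop :=
  ∃ V' : Subvariety F X,
    (V : Set ((baseChange F L).obj X).left) =
      schemeBaseChangeProj L (F.obj X) ⁻¹' (V' : Set (F.obj X).left)

/-- Very distinguished categories: distinguished categories all of whose base changes to
algebraically closed extensions of finite transcendence degree satisfy weak finiteness. -/
structure IsVeryDistinguished : Prop where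
  isDistinguished : IsDistinguished F
  weakFiniteness : ∀ (L : Type u) [Field L] [IsAlgClosed L] [Algebra K L],
    Algebra.trdeg K L < Cardinal.aleph0 → WeakFiniteness (baseChange F L)

end Category

end UnlikelyIntersections

end

open UnlikelyIntersections

namespace UnlikelyIntersections

/-! ### Transcendence degree and Krull dimension of algebras. -/

section Algebra

/-! Subvarieties are replaced by their generic points, and dimensions by transcendence degrees of
residue fields over the ground field (`pdim`). `IsTame` records what is then needed about a
distinguished category, and `BaseChangeData.isTame` proves it for every base change to an
algebraically closed field. The hard points of this transfer are that irreducible fibres stay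
irreducible (`irreducibleSpace_of_isPullback`) and that fibre dimensions are preserved
(`residueTrdeg_snd_le`, `exists_residueTrdeg_le_residueTrdeg_snd`).

The geometric heart is that distinguished morphisms have constant fibre dimension on special
subvarieties (`IsTame.pdim_add_le`). This yields the defect condition
`IsTame.pdim_sp_add_pdim_ws_le`: the difference of defect and weak defect does not increase on
enlarging a subvariety. Hence optimal subvarieties are weakly optimal, and weak finiteness applies
to them. Their weakly special hulls then come from finitely many pairs of morphisms to `X` and to
some `Z`. Projecting to `Z` loses a dimension when the optimal subvariety has positive dimension, so
finiteness in dimension `m` on the `Z`'s gives finiteness, for positive-dimensional optimal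
subvarieties, in dimension `m + 1` on `X` (`IsTame.finite_of_imageOfFiber`).

Let now `V` over `L` not be defined over `K`. Adjoining elements one at a time gives an
algebraically closed field `E` of finite transcendence degree over `K` such that the closure `V'` of
the image of `V` in `X_E` has dimension `dim V + 1` (`exists_pdim_eq`). An optimal `W` in `V` either
is a base change from `E`, and then lies in the proper closed subset of `V` consisting of whole
fibres of `X_L → X_E`; or its image gains dimension, hence loses defect, and lies in one of the
finitely many optimal subvarieties of `V'` of positive dimension and defect at most `d - 1`. Unless
`W = V`, that subvariety is not `V'`, so `W` again lies in a fixed proper closed subset of `V`.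
There `ZP` in dimension `m - 1` applies (`BaseChangeData.finite_optimalPoints`).

A `V` defined over `K` has only optimal subvarieties defined over `K`, so part (1) follows by
induction on `m + d` (`zp_baseChange`). Part (2) is the step above, with part (1) supplying its
inputs. -/

theorem ringKrullDim_eq_of_isIntegral (R S : Type*) [CommRing R] [CommRing S]
    [Algebra R S] [Algebra.IsIntegral R S] (h : Function.Injective (algebraMap R S)) :
    ringKrullDim S = ringKrullDim R := by
  apply le_antisymm
  · exact Order.krullDim_le_of_strictMono (PrimeSpectrum.comap (algebraMap R S))
      fun p q hpq => Ideal.IsIntegral.comap_lt_comap hpq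
  · rw [ringKrullDim, Order.krullDim]
    refine iSup_le fun l => ?_
    have hle : (⊥ : Ideal S).comap (algebraMap R S) ≤ l.head.asIdeal := by
      rw [← RingHom.ker_eq_comap_bot, (RingHom.injective_iff_ker_eq_bot _).mp h]
      exact bot_le
    obtain ⟨Q, -, hQ, hQl⟩ := Ideal.exists_ideal_over_prime_of_isIntegral l.head.asIdeal ⊥ hle
    have : Q.LiesOver l.head.asIdeal := ⟨hQl.symm⟩
    obtain ⟨M, hM, -⟩ := Ideal.exists_ltSeries_of_hasGoingUp (S := S) l Q
    rw [← hM]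
    exact Order.LTSeries.length_le_krullDim M

/-- By Noether normalization `B` is integral over a polynomial ring, and neither invariant changes
in an integral extension. -/
theorem ringKrullDim_eq_trdeg (k B : Type u) [Field k] [CommRing B] [IsDomain B] [Algebra k B]
    [Algebra.FiniteType k B] :
    ringKrullDim B = (Cardinal.toENat (Algebra.trdeg k B) : WithBot ℕ∞) := by
  obtain ⟨s, g, hg, hg'⟩ := exists_integral_inj_algHom_of_fg k B
  algebraize [g.toRingHom]
  have hinj : Function.Injective (algebraMap (MvPolynomial (Fin s) k) B) := hg
  have : FaithfulSMul (MvPolynomial (Fin s) k) B :=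
    (faithfulSMul_iff_algebraMap_injective _ _).mpr hinj
  have : Algebra.IsIntegral (MvPolynomial (Fin s) k) B := ⟨hg'⟩
  have : IsScalarTower k (MvPolynomial (Fin s) k) B := .of_algebraMap_eq fun x => (g.commutes x).symm
  rw [ringKrullDim_eq_of_isIntegral _ _ hinj, ← trdeg_add_eq k (MvPolynomial (Fin s) k),
    trdeg_eq_zero (R := MvPolynomial (Fin s) k)]
  simp

theorem trdeg_le_of_isAlgebraic_of_adjoin_eq_top {F G : Type u} [Field F] [Field G] [Algebra F G]
    {T s : Set G} (hT : IntermediateField.adjoin F T = ⊤)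
    (hs : ∀ t ∈ T, IsAlgebraic (Algebra.adjoin F s) t) :
    Algebra.trdeg F G ≤ Cardinal.mk s := by
  have : Algebra.IsAlgebraic (Algebra.adjoin F s) G := by
    refine ⟨fun g => ?_⟩
    have hg : g ∈ IntermediateField.adjoin F T := hT ▸ IntermediateField.mem_top
    induction hg using IntermediateField.adjoin_induction with
    | mem x hx => exact hs x hx
    | algebraMap x =>
      exact isAlgebraic_algebraMap (R := Algebra.adjoin F s) (A := G)
        (algebraMap F (Algebra.adjoin F s) x)
    | add x y _ _ hx hy => exact hx.add hy
    | inv x _ hx => exact hx.inv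
    | mul x y _ _ hx hy => exact hx.mul hy
  exact Algebra.IsAlgebraic.trdeg_le_cardinalMk F s

/-- The map `f` need not be injective, so an algebraic equation survives only if its leading
coefficient is not killed. -/
theorem isAlgebraic_adjoin_image {k F E G : Type*} [CommRing k] [CommRing F] [CommRing E]
    [CommRing G] [Algebra k F] [Algebra k E] [Algebra F G] [Algebra k G] [IsScalarTower k F G]
    (f : E →ₐ[k] G) (s : Set E) (x : E)
    (hx : ∃ p : Polynomial (Algebra.adjoin k s), Polynomial.aeval x p = 0 ∧
      f (p.leadingCoeff : E) ≠ 0) :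
    IsAlgebraic (Algebra.adjoin F (f '' s)) (f x) := by
  obtain ⟨p, hp, hp0⟩ := hx
  have hmem : ∀ a : Algebra.adjoin k s, f a ∈ Algebra.adjoin F (f '' s) := fun a => by
    have h1 : f a ∈ (Algebra.adjoin k s).map f := ⟨a, a.2, rfl⟩
    rw [AlgHom.map_adjoin] at h1
    have h2 : Algebra.adjoin k (f '' s) ≤ (Algebra.adjoin F (f '' s)).restrictScalars k :=
      Algebra.adjoin_le Algebra.subset_adjoin
    exact h2 h1
  let φ : Algebra.adjoin k s →+* Algebra.adjoin F (f '' s) :=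
    ((f : E →+* G).comp (algebraMap (Algebra.adjoin k s) E)).codRestrict _ hmem
  refine ⟨p.map φ, fun h0 => hp0 ?_, ?_⟩
  · have := congrArg (fun q => (q.coeff p.natDegree : G)) h0
    have h1 : ((φ p.leadingCoeff : Algebra.adjoin F (f '' s)) : G) = 0 := by simpa using this
    exact h1
  · rw [Polynomial.aeval_def, Polynomial.eval₂_map]
    have : (algebraMap (Algebra.adjoin F (f '' s)) G).comp φ =
        (f : E →+* G).comp (algebraMap (Algebra.adjoin k s) E) := rfl
    rw [this]
    refine (Polynomial.hom_eval₂ p (algebraMap (Algebra.adjoin k s) E) (f : E →+* G) x).symm.trans ?_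
    rw [← Polynomial.aeval_def, hp, map_zero]

theorem exists_aeval_eq_zero_leadingCoeff_ne_zero {R A : Type*} [CommRing R] [CommRing A]
    [Algebra R A] [FaithfulSMul R A] {x : A} (hx : IsAlgebraic R x) :
    ∃ p : Polynomial R, Polynomial.aeval x p = 0 ∧ algebraMap R A p.leadingCoeff ≠ 0 := by
  obtain ⟨p, hp0, hp⟩ := hx
  refine ⟨p, hp, ?_⟩
  rwa [Ne, FaithfulSMul.algebraMap_eq_zero_iff, Polynomial.leadingCoeff_eq_zero]

/-- The transcendence degree does not increase when passing to a compositum. -/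
theorem trdeg_le_of_adjoin_range_eq_top {k E F G : Type u} [Field k] [Field E] [Field F] [Field G]
    [Algebra k E] [Algebra k F] [Algebra k G] [Algebra F G] [IsScalarTower k F G] (f : E →ₐ[k] G)
    (h : IntermediateField.adjoin F (Set.range f) = ⊤) :
    Algebra.trdeg F G ≤ Algebra.trdeg k E := by
  obtain ⟨s, hs⟩ := exists_isTranscendenceBasis k E
  rw [← hs.cardinalMk_eq_trdeg]
  refine (trdeg_le_of_isAlgebraic_of_adjoin_eq_top (s := f '' s) h ?_).trans Cardinal.mk_image_le
  rintro _ ⟨x, rfl⟩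
  refine isAlgebraic_adjoin_image f s x ?_
  have := hs.isAlgebraic
  rw [Subtype.range_coe] at this
  obtain ⟨p, hp, hp'⟩ := exists_aeval_eq_zero_leadingCoeff_ne_zero (this.isAlgebraic x)
  exact ⟨p, hp, fun h0 => hp' ((map_eq_zero f).mp h0)⟩

/-- Generic bound for the transcendence degrees of the residue field extensions of a dominant
morphism of finite type. -/
theorem exists_forall_trdeg_le (A B : Type u) [CommRing A] [CommRing B] [IsDomain B] [Algebra A B]
    [FaithfulSMul A B] [Algebra.FiniteType A B] :
    ∃ c : B, c ≠ 0 ∧ ∀ (F G : Type u) [Field F] [Field G] [Algebra A F] [Algebra F G] [Algebra A G]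
      [IsScalarTower A F G] (f : B →ₐ[A] G), f c ≠ 0 →
      IntermediateField.adjoin F (Set.range f) = ⊤ → Algebra.trdeg F G ≤ Algebra.trdeg A B := by
  have := (FaithfulSMul.algebraMap_injective A B).isDomain
  obtain ⟨s, hs⟩ := exists_isTranscendenceBasis A B
  have halg := hs.isAlgebraic
  rw [Subtype.range_coe] at halg
  obtain ⟨t, ht⟩ := Algebra.FiniteType.out (R := A) (A := B)
  choose p hp hp' using fun b : B =>
    exists_aeval_eq_zero_leadingCoeff_ne_zero (halg.isAlgebraic b)
  -- Where this product of leading coefficients is nonzero, the finitely many generators remain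
  -- algebraic over the image of the transcendence basis.
  refine ⟨∏ b ∈ t, ((p b).leadingCoeff : B), Finset.prod_ne_zero_iff.mpr fun b _ => hp' b, ?_⟩
  intro F G _ _ _ _ _ _ f hf hG
  rw [← hs.cardinalMk_eq_trdeg]
  refine (trdeg_le_of_isAlgebraic_of_adjoin_eq_top (T := f '' t) (s := f '' s) ?_ ?_).trans
    Cardinal.mk_image_le
  · refine le_antisymm le_top (hG ▸ IntermediateField.adjoin_le_iff.mpr ?_)
    rintro _ ⟨b, rfl⟩
    have hb : b ∈ Algebra.adjoin A (t : Set B) := ht ▸ Algebra.mem_top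
    have h1 : f b ∈ (Algebra.adjoin A (t : Set B)).map f := ⟨b, hb, rfl⟩
    rw [AlgHom.map_adjoin] at h1
    have h2 : Algebra.adjoin A (f '' (t : Set B)) ≤
        ((IntermediateField.adjoin F (f '' (t : Set B))).toSubalgebra).restrictScalars A :=
      Algebra.adjoin_le (IntermediateField.subset_adjoin _ _)
    exact h2 h1
  · rintro _ ⟨b, hb, rfl⟩
    refine isAlgebraic_adjoin_image f s b ⟨p b, hp b, ?_⟩
    rw [map_prod, Finset.prod_ne_zero_iff] at hf
    exact hf b hb

/-- `E` is algebraic over `k[s]`, so an embedding of `k[s]` into the algebraically closed `G`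
extends to `E`. Passing through `F[s]` keeps `s` independent over `F`. -/
theorem exists_ringHom_extending {k E F G : Type u} [Field k] [Field E] [Field F]
    [Field G] [IsAlgClosed G] [Algebra k E] [Algebra k F] [Algebra F G]
    {s : Set E} (hs : IsTranscendenceBasis k ((↑) : s → E))
    (i : MvPolynomial s F →ₐ[F] G) (hi : Function.Injective i) :
    ∃ e : E →+* G, e.comp (algebraMap k E) = (algebraMap F G).comp (algebraMap k F) ∧
      AlgebraicIndependent F fun x : s => e x := by
  let j : MvPolynomial s k →+* G := (i : MvPolynomial s F →+* G).comp
    (MvPolynomial.map (algebraMap k F))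
  have hj : Function.Injective j :=
    hi.comp (MvPolynomial.map_injective _ (algebraMap k F).injective)
  let a := hs.1.aevalEquiv
  let J : Algebra.adjoin k (Set.range ((↑) : s → E)) →+* G := j.comp (a.symm : _ →+* _)
  have hJ : Function.Injective J := hj.comp a.symm.injective
  let _ : Algebra (Algebra.adjoin k (Set.range ((↑) : s → E))) G := J.toAlgebra
  have : FaithfulSMul (Algebra.adjoin k (Set.range ((↑) : s → E))) G :=
    (faithfulSMul_iff_algebraMap_injective _ _).mpr hJ
  have := hs.isAlgebraic
  let l : E →ₐ[Algebra.adjoin k (Set.range ((↑) : s → E))] G := IsAlgClosed.lift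
  have hl : ∀ p, l (MvPolynomial.aeval ((↑) : s → E) p) = i (p.map (algebraMap k F)) := fun p => by
    have h1 : l (algebraMap _ E (a p)) = j (a.symm (a p)) := l.commutes (a p)
    rw [AlgEquiv.symm_apply_apply] at h1
    rw [hs.1.algebraMap_aevalEquiv] at h1
    exact h1
  refine ⟨l, ?_, ?_⟩
  · ext x
    have := hl (MvPolynomial.C x)
    rw [MvPolynomial.aeval_C, MvPolynomial.map_C] at this
    exact this.trans (i.commutes _)
  · have : (fun x : s => (l : E →+* G) x) = i ∘ MvPolynomial.X := by
      ext x
      have := hl (MvPolynomial.X x)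
      rwa [MvPolynomial.aeval_X, MvPolynomial.map_X] at this
    rw [this]
    exact (MvPolynomial.algebraicIndependent_X s F).map' hi

/-- Two extensions of a field have a common extension in which a given transcendence basis of the
first one remains algebraically independent over the second one. -/
theorem exists_ringHom_algebraicIndependent {k E F : Type u} [Field k] [Field E] [Field F]
    [Algebra k E] [Algebra k F] {s : Set E} (hs : IsTranscendenceBasis k ((↑) : s → E)) :
    ∃ (G : Type u) (_ : Field G) (_ : Algebra F G) (e : E →+* G),
      e.comp (algebraMap k E) = (algebraMap F G).comp (algebraMap k F) ∧
      AlgebraicIndependent F fun x : s => e x := by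
  obtain ⟨e, he⟩ := exists_ringHom_extending (F := F)
    (G := AlgebraicClosure (FractionRing (MvPolynomial s F))) hs
    (IsScalarTower.toAlgHom F (MvPolynomial s F) _)
    ((algebraMap (FractionRing (MvPolynomial s F)) _).injective.comp
      (IsFractionRing.injective (MvPolynomial s F) _))
  exact ⟨_, inferInstance, inferInstance, e, he⟩

end Algebra


/-! ### Transcendence degree of field homomorphisms and generic bounds. -/

section RingHomTrdeg

/-- The transcendence degree of an extension of fields, given as a ring homomorphism. -/
noncomputable def fieldTrdeg {F G : Type u} [Field F] [Field G] (f : F →+* G) : ℕ∞ :=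
  letI := f.toAlgebra
  Cardinal.toENat (Algebra.trdeg F G)

theorem fieldTrdeg_algebraMap (F G : Type u) [Field F] [Field G] [Algebra F G] :
    fieldTrdeg (algebraMap F G) = Cardinal.toENat (Algebra.trdeg F G) := by
  rw [fieldTrdeg]
  congr 2

theorem fieldTrdeg_comp {E F G : Type u} [Field E] [Field F] [Field G] (f : E →+* F)
    (g : F →+* G) : fieldTrdeg (g.comp f) = fieldTrdeg f + fieldTrdeg g := by
  algebraize [f, g, g.comp f]
  rw [fieldTrdeg, fieldTrdeg, fieldTrdeg, ← map_add]
  congr 1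
  exact (trdeg_add_eq E F (A := G)).symm

theorem fieldTrdeg_eq_zero_of_surjective {F G : Type u} [Field F] [Field G] {f : F →+* G}
    (hf : Function.Surjective f) : fieldTrdeg f = 0 := by
  algebraize [f]
  have : Algebra.IsAlgebraic F G := ⟨fun x => by
    obtain ⟨y, rfl⟩ := hf x
    exact isAlgebraic_algebraMap y⟩
  rw [fieldTrdeg, trdeg_eq_zero, map_zero]

/-- `hF` and `hG` say that `F` and `G` consist of fractions over `A` and `B`. They are thus
algebraic over `A` and `B` and add nothing to the transcendence degree. -/
theorem trdeg_quotient_ker {A B F G : Type u} [CommRing A] [CommRing B] [IsDomain B]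
    [Field F] [Field G] [Algebra A B] [Algebra A F] [Algebra B G] [Algebra F G]
    [Algebra A G] [IsScalarTower A B G] [IsScalarTower A F G] [FaithfulSMul A F]
    [FaithfulSMul B G]
    (hF : ∀ x : F, ∃ a b : A, algebraMap A F b ≠ 0 ∧ x * algebraMap A F b = algebraMap A F a)
    (hG : ∀ x : G, ∃ a b : B, algebraMap B G b ≠ 0 ∧ x * algebraMap B G b = algebraMap B G a) :
    Algebra.trdeg F G = Algebra.trdeg A B := by
  have hAG : FaithfulSMul A G := (faithfulSMul_iff_algebraMap_injective A G).mpr <| by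
    rw [IsScalarTower.algebraMap_eq A F G]
    exact (algebraMap F G).injective.comp (FaithfulSMul.algebraMap_injective A F)
  have : FaithfulSMul A B := (faithfulSMul_iff_algebraMap_injective A B).mpr <| by
    have := FaithfulSMul.algebraMap_injective A G
    rw [IsScalarTower.algebraMap_eq A B G] at this
    exact Function.Injective.of_comp (f := algebraMap B G) (by rwa [RingHom.coe_comp] at this)
  have := (FaithfulSMul.algebraMap_injective A B).isDomain
  have key : ∀ (R : Type u) (H : Type u) [CommRing R] [IsDomain R] [Field H] [Algebra R H]
      [FaithfulSMul R H],
      (∀ x : H, ∃ a b : R, algebraMap R H b ≠ 0 ∧ x * algebraMap R H b = algebraMap R H a) →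
      Algebra.IsAlgebraic R H := fun R H _ _ _ _ _ h => ⟨fun x => by
    obtain ⟨a, b, hb, hab⟩ := h x
    rw [← eq_div_iff hb] at hab
    rw [hab, div_eq_mul_inv]
    exact (isAlgebraic_algebraMap a).mul (isAlgebraic_algebraMap b).inv⟩
  have hF' := key A F hF
  have hG' := key B G hG
  have h1 := trdeg_add_eq A F (A := G)
  have h2 := trdeg_add_eq A B (A := G)
  rw [trdeg_eq_zero, zero_add] at h1
  rw [trdeg_eq_zero (R := B), add_zero] at h2
  rw [h1, h2]

/-- Generic bound for the transcendence degrees of residue field extensions. -/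
theorem exists_forall_fieldTrdeg_le {A B F₀ G₀ : Type u} [CommRing A] [CommRing B]
    [Field F₀] [Field G₀] (φ : A →+* B) (hφ : φ.FiniteType) (α₀ : A →+* F₀) (β₀ : B →+* G₀)
    (ι₀ : F₀ →+* G₀) (h₀ : ι₀.comp α₀ = β₀.comp φ)
    (hF : ∀ x : F₀, ∃ a b : A, α₀ b ≠ 0 ∧ x * α₀ b = α₀ a)
    (hG : ∀ x : G₀, ∃ a b : B, β₀ b ≠ 0 ∧ x * β₀ b = β₀ a) :
    ∃ c : B, β₀ c ≠ 0 ∧ ∀ (F G : Type u) [Field F] [Field G] (α : A →+* F) (β : B →+* G)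
      (ι : F →+* G), ι.comp α = β.comp φ → (∀ b, β₀ b = 0 → β b = 0) → β c ≠ 0 →
      (∀ x : G, ∃ a b : B, β b ≠ 0 ∧ x * β b = β a) → fieldTrdeg ι ≤ fieldTrdeg ι₀ := by
  let A' := A ⧸ RingHom.ker α₀
  let B' := B ⧸ RingHom.ker β₀
  have hcomm : ∀ a, ι₀ (α₀ a) = β₀ (φ a) := fun a => congrArg (fun f => f a) h₀
  have hker : RingHom.ker α₀ ≤ (RingHom.ker β₀).comap φ := fun a ha => by
    rw [Ideal.mem_comap, RingHom.mem_ker, ← hcomm, (RingHom.mem_ker).mp ha, map_zero]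
  let φ' : A' →+* B' := Ideal.quotientMap _ φ hker
  let α' : A' →+* F₀ := RingHom.kerLift α₀
  let β' : B' →+* G₀ := RingHom.kerLift β₀
  have hα' : Function.Injective α' := RingHom.kerLift_injective α₀
  have hβ' : Function.Injective β' := RingHom.kerLift_injective β₀
  have hcomm' : ∀ a, ι₀ (α' a) = β' (φ' a) := fun a => by
    obtain ⟨a, rfl⟩ := Ideal.Quotient.mk_surjective a
    exact hcomm a
  have hdom : IsDomain B' := hβ'.isDomain
  algebraize [φ', α', β', ι₀, ι₀.comp α']
  have i1 : IsScalarTower A' B' G₀ := .of_algebraMap_eq hcomm'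
  have i2 : FaithfulSMul A' F₀ := (faithfulSMul_iff_algebraMap_injective _ _).mpr hα'
  have i3 : FaithfulSMul B' G₀ := (faithfulSMul_iff_algebraMap_injective _ _).mpr hβ'
  have i4 : FaithfulSMul A' B' := (faithfulSMul_iff_algebraMap_injective _ _).mpr
    fun a b hab => hα' (ι₀.injective (by rw [hcomm', hcomm']; exact congrArg β' hab))
  have i5 : Algebra.FiniteType A' B' := by
    refine RingHom.FiniteType.of_comp_finiteType (f := Ideal.Quotient.mk _) (g := φ') ?_
    exact (RingHom.FiniteType.of_surjective (Ideal.Quotient.mk (RingHom.ker β₀))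
      Ideal.Quotient.mk_surjective).comp hφ
  obtain ⟨c, hc, hc'⟩ := exists_forall_trdeg_le A' B'
  obtain ⟨c, rfl⟩ := Ideal.Quotient.mk_surjective c
  refine ⟨c, fun h => hc (Ideal.Quotient.eq_zero_iff_mem.mpr h), ?_⟩
  intro F G _ _ α β ι h hβ hcne hgen
  have hcm : ∀ a, ι (α a) = β (φ a) := fun a => congrArg (fun f => f a) h
  have hα : ∀ a ∈ RingHom.ker α₀, α a = 0 := fun a ha => ι.injective <| by
    rw [hcm, hβ _ (hker ha), map_zero]
  let a' : A' →+* F := Ideal.Quotient.lift _ α hα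
  let b' : B' →+* G := Ideal.Quotient.lift _ β hβ
  algebraize [ι, a', ι.comp a']
  have hb' : ∀ a, b' (algebraMap A' B' a) = algebraMap A' G a := fun a => by
    obtain ⟨a, rfl⟩ := Ideal.Quotient.mk_surjective a
    exact (hcm a).symm
  have key := hc' F G (AlgHom.mk b' hb') (by exact hcne) ?_
  · rw [fieldTrdeg, fieldTrdeg]
    refine OrderHomClass.mono Cardinal.toENat ?_
    rw [trdeg_quotient_ker (A := A') (B := B') (F := F₀) (G := G₀)]
    · exact key
    · intro x
      obtain ⟨a, b, hb, hab⟩ := hF x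
      exact ⟨Ideal.Quotient.mk _ a, Ideal.Quotient.mk _ b, hb, hab⟩
    · intro x
      obtain ⟨a, b, hb, hab⟩ := hG x
      exact ⟨Ideal.Quotient.mk _ a, Ideal.Quotient.mk _ b, hb, hab⟩
  · rw [eq_top_iff]
    intro x _
    obtain ⟨a, b, hb, hab⟩ := hgen x
    rw [← eq_div_iff hb] at hab
    rw [hab]
    exact div_mem (IntermediateField.subset_adjoin _ _ ⟨Ideal.Quotient.mk _ a, rfl⟩)
      (IntermediateField.subset_adjoin _ _ ⟨Ideal.Quotient.mk _ b, rfl⟩)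

theorem fieldTrdeg_ne_top {A B F G : Type u} [CommRing A] [CommRing B]
    [Field F] [Field G] (φ : A →+* B) (hφ : φ.FiniteType) (α : A →+* F) (β : B →+* G)
    (ι : F →+* G) (h : ι.comp α = β.comp φ)
    (hG : ∀ x : G, ∃ a b : B, β b ≠ 0 ∧ x * β b = β a) : fieldTrdeg ι ≠ ⊤ := by
  algebraize [φ, α, β, ι, β.comp φ]
  have i1 : IsScalarTower A F G := .of_algebraMap_eq fun a => congrArg (fun f => f a) h.symm
  obtain ⟨t, ht⟩ := Algebra.FiniteType.out (R := A) (A := B)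
  let f : B →ₐ[A] G := IsScalarTower.toAlgHom A B G
  have key : Algebra.trdeg F G ≤ Cardinal.mk (f '' (t : Set B)) := by
    refine trdeg_le_of_isAlgebraic_of_adjoin_eq_top (T := f '' t) (s := f '' t) ?_
      fun x hx => isAlgebraic_algebraMap (R := Algebra.adjoin F (f '' (t : Set B)))
        ⟨x, Algebra.subset_adjoin hx⟩
    have hmem : ∀ b : B, f b ∈ IntermediateField.adjoin F (f '' (t : Set B)) := fun b => by
      have hb : b ∈ Algebra.adjoin A (t : Set B) := ht ▸ Algebra.mem_top
      have h1 : f b ∈ (Algebra.adjoin A (t : Set B)).map f := ⟨b, hb, rfl⟩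
      rw [AlgHom.map_adjoin] at h1
      have h2 : Algebra.adjoin A (f '' (t : Set B)) ≤
          ((IntermediateField.adjoin F (f '' (t : Set B))).toSubalgebra).restrictScalars A :=
        Algebra.adjoin_le (IntermediateField.subset_adjoin _ _)
      exact h2 h1
    rw [eq_top_iff]
    intro x _
    obtain ⟨a, b, hb, hab⟩ := hG x
    rw [← eq_div_iff hb] at hab
    rw [hab]
    exact div_mem (hmem a) (hmem b)
  rw [fieldTrdeg, Ne, Cardinal.toENat_eq_top, not_le]
  exact key.trans_lt ((t.finite_toSet.image f).lt_aleph0)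

end RingHomTrdeg

/-! ### Residue field extensions along a morphism of schemes. -/

section Residue

variable {X Y Z : Scheme.{u}}

/-- The transcendence degree of the residue field extension `κ(x) / κ(f x)`. -/
noncomputable def residueTrdeg (f : X ⟶ Y) (x : X) : ℕ∞ :=
  fieldTrdeg (f.residueFieldMap x).hom

theorem residueTrdeg_comp (f : X ⟶ Y) (g : Y ⟶ Z) (x : X) :
    residueTrdeg (f ≫ g) x = residueTrdeg f x + residueTrdeg g (f x) := by
  rw [residueTrdeg, residueTrdeg, residueTrdeg, add_comm, ← fieldTrdeg_comp]
  congr 1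
  rw [Scheme.residueFieldMap_comp]
  rfl

theorem residueTrdeg_eq_zero_of_surjectiveOnStalks (f : X ⟶ Y) [SurjectiveOnStalks f] (x : X) :
    residueTrdeg f x = 0 := by
  refine fieldTrdeg_eq_zero_of_surjective fun y => ?_
  obtain ⟨y, rfl⟩ := X.residue_surjective x y
  obtain ⟨y, rfl⟩ := f.stalkMap_surjective x y
  exact ⟨Y.residue _ y, congrArg (fun φ : Y.presheaf.stalk (f x) ⟶ X.residueField x => φ.hom y)
    (Scheme.residue_residueFieldMap f x)⟩

theorem exists_evaluation_eq {U : X.Opens} (hU : IsAffineOpen U) {x : X} (hx : x ∈ U)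
    (z : X.residueField x) : ∃ a b : Γ(X, U), X.evaluation U x hx b ≠ 0 ∧
      z * X.evaluation U x hx b = X.evaluation U x hx a := by
  obtain ⟨z, rfl⟩ := X.residue_surjective x z
  let := X.presheaf.algebra_section_stalk ⟨x, hx⟩
  have := hU.isLocalization_stalk ⟨x, hx⟩
  obtain ⟨⟨a, b⟩, hab⟩ := IsLocalization.surj (hU.primeIdealOf ⟨x, hx⟩).asIdeal.primeCompl z
  refine ⟨a, b, ?_, ?_⟩
  · have h1 := IsLocalization.map_units (X.presheaf.stalk x) b
    exact (h1.map (X.residue x).hom).ne_zero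
  · have := congrArg (X.residue x).hom hab
    rw [map_mul] at this
    exact this

theorem evaluation_comp_appLE (f : X ⟶ Y) {U : Y.Opens} {V : X.Opens} (e : V ≤ f ⁻¹ᵁ U) {x : X}
    (hx : x ∈ V) : (f.residueFieldMap x).hom.comp (Y.evaluation U (f x) (e hx)).hom =
      (X.evaluation V x hx).hom.comp (f.appLE U V e).hom := by
  rw [← CommRingCat.hom_comp, ← CommRingCat.hom_comp]
  congr 1
  refine (Scheme.evaluation_naturality f x (V := U) (e hx)).trans ?_
  rw [Scheme.Hom.appLE, Category.assoc]
  congr 1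
  rw [Scheme.evaluation, Scheme.evaluation, X.presheaf.germ_res_assoc]

theorem residueTrdeg_ne_top (f : X ⟶ Y) [LocallyOfFiniteType f] (x : X) :
    residueTrdeg f x ≠ ⊤ := by
  obtain ⟨U, hU, hxU, -⟩ := exists_isAffineOpen_mem_and_subset (X := Y) (x := f x) (U := ⊤) trivial
  obtain ⟨V, hV, hxV, e⟩ := exists_isAffineOpen_mem_and_subset (X := X) (x := x) (U := f ⁻¹ᵁ U) hxU
  exact fieldTrdeg_ne_top (f.appLE U V e).hom (f.finiteType_appLE hU hV e)
    (Y.evaluation U (f x) hxU).hom (X.evaluation V x hxV).hom (f.residueFieldMap x).hom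
    (evaluation_comp_appLE f e hxV) (exists_evaluation_eq hV hxV)

/-- This is generic boundedness of the fibre dimension on the closure of `x`; the open set is the
locus where the element `c` of the algebraic bound does not vanish. -/
theorem exists_isOpen_forall_residueTrdeg_le (f : X ⟶ Y) [LocallyOfFiniteType f] (x : X) :
    ∃ O : Set X, IsOpen O ∧ x ∈ O ∧
      ∀ y ∈ O, x ⤳ y → residueTrdeg f y ≤ residueTrdeg f x := by
  obtain ⟨U, hU, hxU, -⟩ := exists_isAffineOpen_mem_and_subset (X := Y) (x := f x) (U := ⊤) trivial
  obtain ⟨V, hV, hxV, e⟩ := exists_isAffineOpen_mem_and_subset (X := X) (x := x) (U := f ⁻¹ᵁ U) hxU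
  obtain ⟨c, hc, H⟩ := exists_forall_fieldTrdeg_le (f.appLE U V e).hom (f.finiteType_appLE hU hV e)
    (Y.evaluation U (f x) hxU).hom (X.evaluation V x hxV).hom (f.residueFieldMap x).hom
    (evaluation_comp_appLE f e hxV) (exists_evaluation_eq hU hxU) (exists_evaluation_eq hV hxV)
  have hcx : x ∈ X.basicOpen c := (X.evaluation_ne_zero_iff_mem_basicOpen x hxV c).mp hc
  refine ⟨X.basicOpen c, (X.basicOpen c).2, hcx, fun y hy hxy => ?_⟩
  have hyV : y ∈ V := X.basicOpen_le c hy
  refine H _ _ (Y.evaluation U (f y) (e hyV)).hom (X.evaluation V y hyV).hom _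
    (evaluation_comp_appLE f e hyV) (fun b hb => ?_)
    ((X.evaluation_ne_zero_iff_mem_basicOpen y hyV c).mpr hy) (exists_evaluation_eq hV hyV)
  by_contra hb'
  have h1 := (X.evaluation_ne_zero_iff_mem_basicOpen y hyV b).mp hb'
  have h2 := hxy.mem_open (X.basicOpen b).2 h1
  exact (X.evaluation_ne_zero_iff_mem_basicOpen x hxV b).mpr h2 hb

end Residue


/-! ### Dimension of the closure of a point as a transcendence degree. -/

section Dimension

theorem topologicalKrullDim_closure_inter {X : Scheme.{u}} {V : X.Opens} (hV : IsAffineOpen V)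
    {x : X} (hx : x ∈ V) :
    topologicalKrullDim (closure {x} ∩ V : Set X) =
      ringKrullDim (Γ(X, V) ⧸ RingHom.ker (X.evaluation V x hx).hom) := by
  obtain ⟨p₀, rfl⟩ : x ∈ Set.range hV.fromSpec := by rwa [hV.range_fromSpec]
  have hker : RingHom.ker (X.evaluation V _ hx).hom = PrimeSpectrum.asIdeal p₀ := by
    ext b
    have h1 : p₀ ∈ hV.fromSpec ⁻¹ᵁ X.basicOpen b ↔ ¬ b ∈ PrimeSpectrum.asIdeal p₀ := by
      rw [hV.fromSpec_preimage_basicOpen]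
      exact Iff.rfl
    exact (X.evaluation_eq_zero_iff_notMem_basicOpen _ hx b).trans (not_iff_comm.mp h1.symm)
  let mk := Ideal.Quotient.mk (RingHom.ker (X.evaluation V _ hx).hom)
  have hmk : Function.Surjective mk := Ideal.Quotient.mk_surjective
  let f : PrimeSpectrum (Γ(X, V) ⧸ RingHom.ker (X.evaluation V _ hx).hom) → X :=
    fun p => hV.fromSpec (PrimeSpectrum.comap mk p)
  have hf : Topology.IsEmbedding f :=
    hV.fromSpec.isOpenEmbedding.isEmbedding.comp
      (PrimeSpectrum.isClosedEmbedding_comap_of_surjective _ mk hmk).isEmbedding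
  have hrange : Set.range f = closure {hV.fromSpec p₀} ∩ V := by
    have h1 : Set.range f = hV.fromSpec '' (Set.range (PrimeSpectrum.comap mk)) :=
      Set.range_comp _ _
    have h2 : Set.range (PrimeSpectrum.comap mk) = closure {p₀} := by
      rw [range_comap_of_surjective _ mk hmk, Ideal.mk_ker, hker]
      exact (PrimeSpectrum.closure_singleton _).symm
    refine h1.trans ((congrArg (hV.fromSpec '' ·) h2).trans ?_)
    dsimp only
    rw [hV.fromSpec.isOpenEmbedding.isInducing.closure_eq_preimage_closure_image,
      Set.image_preimage_eq_inter_range, Set.image_singleton, hV.range_fromSpec]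
  rw [← PrimeSpectrum.topologicalKrullDim_eq_ringKrullDim, ← hrange]
  exact (IsHomeomorph.topologicalKrullDim_eq _ hf.toHomeomorph.isHomeomorph).symm

variable {k : Type u} [Field k] {X : Scheme.{u}} (f : X ⟶ Spec (.of k)) [LocallyOfFiniteType f]

theorem ringKrullDim_quotient_ker_evaluation {V : X.Opens} (hV : IsAffineOpen V) {x : X}
    (hx : x ∈ V) :
    ringKrullDim (Γ(X, V) ⧸ RingHom.ker (X.evaluation V x hx).hom) = (residueTrdeg f x : ℕ∞) := by
  have hU : IsAffineOpen (⊤ : (Spec (.of k)).Opens) := isAffineOpen_top _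
  have e : V ≤ f ⁻¹ᵁ ⊤ := le_top
  let φ := (Scheme.ΓSpecIso (.of k)).inv ≫ f.appLE ⊤ V e
  let α := (Scheme.ΓSpecIso (.of k)).inv ≫ (Spec (.of k)).evaluation ⊤ (f x) trivial
  have hφ : φ.hom.FiniteType := by
    have h1 := f.finiteType_appLE hU hV e
    rw [CommRingCat.hom_comp]
    exact h1.comp (.of_surjective _
      ((ConcreteCategory.bijective_of_isIso (Scheme.ΓSpecIso (.of k)).inv).2))
  let β := (X.evaluation V x hx).hom
  have hcomm : (f.residueFieldMap x).hom.comp α.hom = β.comp φ.hom := by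
    have := evaluation_comp_appLE f e hx
    rw [CommRingCat.hom_comp, CommRingCat.hom_comp, ← RingHom.comp_assoc, ← RingHom.comp_assoc]
    exact congrArg (fun g => RingHom.comp g (Scheme.ΓSpecIso (.of k)).inv.hom) this
  let B := Γ(X, V) ⧸ RingHom.ker β
  let φ' : k →+* B := (Ideal.Quotient.mk _).comp φ.hom
  let β' : B →+* X.residueField x := RingHom.kerLift β
  let ι : (Spec (.of k)).residueField (f x) →+* X.residueField x := (f.residueFieldMap x).hom
  let α' : k →+* (Spec (.of k)).residueField (f x) := α.hom
  have hβ' : Function.Injective β' := RingHom.kerLift_injective β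
  have : IsDomain B := hβ'.isDomain
  algebraize [φ', α', β', ι, ι.comp α']
  have i1 : IsScalarTower k B (X.residueField x) :=
    .of_algebraMap_eq fun a => congrArg (fun g => g a) hcomm
  have i2 : FaithfulSMul B (X.residueField x) := (faithfulSMul_iff_algebraMap_injective _ _).mpr hβ'
  have i5 : Algebra.FiniteType k B := (RingHom.FiniteType.of_surjective (Ideal.Quotient.mk _)
      Ideal.Quotient.mk_surjective).comp hφ
  rw [show ringKrullDim (Γ(X, V) ⧸ RingHom.ker (X.evaluation V x hx).hom) =
    (Cardinal.toENat (Algebra.trdeg k B) : WithBot ℕ∞) from ringKrullDim_eq_trdeg k B]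
  have key : Algebra.trdeg ((Spec (.of k)).residueField (f x)) (X.residueField x) =
      Algebra.trdeg k B := trdeg_quotient_ker ?_ ?_
  · rw [← key]
    rfl
  · intro z
    obtain ⟨a, b, hb, hab⟩ := exists_evaluation_eq hU (x := f x) trivial z
    refine ⟨(Scheme.ΓSpecIso (.of k)).hom a, (Scheme.ΓSpecIso (.of k)).hom b, ?_, ?_⟩
    · change (Spec (.of k)).evaluation ⊤ (f x) trivial ((Scheme.ΓSpecIso (.of k)).inv _) ≠ 0
      rwa [Iso.hom_inv_id_apply]
    · change z * (Spec (.of k)).evaluation ⊤ (f x) trivial ((Scheme.ΓSpecIso (.of k)).inv _) =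
        (Spec (.of k)).evaluation ⊤ (f x) trivial ((Scheme.ΓSpecIso (.of k)).inv _)
      rwa [Iso.hom_inv_id_apply, Iso.hom_inv_id_apply]
  · intro z
    obtain ⟨a, b, hb, hab⟩ := exists_evaluation_eq hV hx z
    exact ⟨Ideal.Quotient.mk _ a, Ideal.Quotient.mk _ b, hb, hab⟩

theorem topologicalKrullDim_closure_inter_eq {V : X.Opens} (hV : IsAffineOpen V)
    {x : X} (hx : x ∈ V) :
    topologicalKrullDim (closure {x} ∩ V : Set X) = (residueTrdeg f x : ℕ∞) := by
  rw [topologicalKrullDim_closure_inter hV hx, ringKrullDim_quotient_ker_evaluation f hV hx]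

theorem residueTrdeg_lt_of_specializes {x y : X} (h : x ⤳ y) (hne : x ≠ y) :
    residueTrdeg f y < residueTrdeg f x := by
  obtain ⟨V, hV, hy, -⟩ := exists_isAffineOpen_mem_and_subset (X := X) (x := y) (U := ⊤) trivial
  have hx : x ∈ V := h.mem_open V.2 hy
  have hle : RingHom.ker (X.evaluation V x hx).hom ≤ RingHom.ker (X.evaluation V y hy).hom := by
    intro b hb
    have := (X.evaluation_eq_zero_iff_notMem_basicOpen x hx b).mp hb
    exact (X.evaluation_eq_zero_iff_notMem_basicOpen y hy b).mpr
      fun hb' => this (h.mem_open (X.basicOpen b).2 hb')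
  obtain ⟨b, hb, hb'⟩ : ∃ b, b ∈ RingHom.ker (X.evaluation V y hy).hom ∧
      b ∉ RingHom.ker (X.evaluation V x hx).hom := by
    by_contra! hcon
    refine hne ((h.antisymm ?_).eq)
    rw [specializes_iff_forall_open]
    intro O hO hxO
    obtain ⟨b, hb, hyb⟩ := hV.exists_basicOpen_le ⟨x, hxO⟩ hx (V := ⟨O, hO⟩)
    by_contra hyO
    have h1 : y ∉ X.basicOpen b := fun h => hyO (hb h)
    have h2 := hcon b ((X.evaluation_eq_zero_iff_notMem_basicOpen y hy b).mpr h1)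
    exact (X.evaluation_eq_zero_iff_notMem_basicOpen x hx b).mp h2 hyb
  have : IsDomain (Γ(X, V) ⧸ RingHom.ker (X.evaluation V x hx).hom) :=
    (RingHom.kerLift_injective (X.evaluation V x hx).hom).isDomain
  have key := ringKrullDim_succ_le_of_surjective (Ideal.Quotient.factor hle)
    (Ideal.Quotient.factor_surjective hle) (r := Ideal.Quotient.mk _ b)
    (mem_nonZeroDivisors_of_ne_zero fun h => hb' (Ideal.Quotient.eq_zero_iff_mem.mp h))
    (Ideal.Quotient.eq_zero_iff_mem.mpr hb)
  rw [ringKrullDim_quotient_ker_evaluation f hV hx,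
    ringKrullDim_quotient_ker_evaluation f hV hy] at key
  have h2 : residueTrdeg f y + 1 ≤ residueTrdeg f x := by exact_mod_cast key
  exact (ENat.add_one_le_iff (residueTrdeg_ne_top f y)).mp h2

/-- The transcendence degree at the generic point is strictly monotone on irreducible closed
subsets, so it bounds the length of chains. -/
theorem topologicalKrullDim_le_of_forall_residueTrdeg_le {A : Set X} (hA : IsClosed A) {n : ℕ}
    (h : ∀ x ∈ A, residueTrdeg f x ≤ n) : topologicalKrullDim A ≤ (n : ℕ∞) := by
  choose g hg using fun Z : IrreducibleCloseds A =>
    QuasiSober.sober (Z.isIrreducible.image Subtype.val continuous_subtype_val.continuousOn)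
      ((hA.isClosedEmbedding_subtypeVal.isClosedMap) _ Z.isClosed)
  have hgA : ∀ Z, g Z ∈ A := fun Z => by
    obtain ⟨z, -, hz⟩ := (hg Z).mem
    exact hz ▸ z.2
  have hmono : StrictMono fun Z => (residueTrdeg f (g Z)).toNat := fun Z Z' hZ => by
    have h1 : g Z' ⤳ g Z := (hg Z').specializes (Set.image_mono hZ.le (hg Z).mem)
    have h2 := residueTrdeg_lt_of_specializes f h1 fun h => by
      refine hZ.ne (SetLike.coe_injective (Subtype.val_injective.image_injective ?_))
      exact ((hg Z).def.symm.trans (h ▸ (hg Z').def))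
    lift residueTrdeg f (g Z) to ℕ using residueTrdeg_ne_top f _ with a ha
    lift residueTrdeg f (g Z') to ℕ using residueTrdeg_ne_top f _ with b hb
    simpa [← ha, ← hb] using h2
  refine iSup_le fun l => ?_
  have h1 := (l.map _ hmono).head_add_length_le_nat
  have h2 : (residueTrdeg f (g l.last)).toNat ≤ n :=
    ENat.toNat_le_of_le_natCast (h _ (hgA _))
  have h3 : l.length ≤ n := (Nat.le_add_left _ _).trans (h1.trans h2)
  exact_mod_cast h3

theorem residueTrdeg_le_of_specializes {x y : X} (h : x ⤳ y) :
    residueTrdeg f y ≤ residueTrdeg f x := by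
  rcases eq_or_ne x y with rfl | hne
  · exact le_rfl
  · exact (residueTrdeg_lt_of_specializes f h hne).le

theorem topologicalKrullDim_closure_singleton (x : X) :
    topologicalKrullDim (closure {x} : Set X) = (residueTrdeg f x : ℕ∞) := by
  apply le_antisymm
  · have h1 := topologicalKrullDim_le_of_forall_residueTrdeg_le f
      (A := closure {x}) isClosed_closure (n := (residueTrdeg f x).toNat) fun y hy => by
        rw [ENat.natCast_toNat (residueTrdeg_ne_top f x)]
        exact residueTrdeg_le_of_specializes f (specializes_iff_mem_closure.mpr hy)
    rwa [ENat.natCast_toNat (residueTrdeg_ne_top f x)] at h1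
  · obtain ⟨V, hV, hx, -⟩ := exists_isAffineOpen_mem_and_subset (X := X) (x := x) (U := ⊤) trivial
    rw [← topologicalKrullDim_closure_inter_eq f hV hx]
    exact (Topology.IsEmbedding.inclusion Set.inter_subset_left).isInducing.topologicalKrullDim_le

end Dimension

/-! ### Local dimension of fibres and residue field extensions. -/

section Fiber

variable {W Z : Scheme.{u}} (f : W ⟶ Z)

theorem residueTrdeg_fiberToSpecResidueField (z : Z) (w : f.fiber z) :
    residueTrdeg (f.fiberToSpecResidueField z) w = residueTrdeg f (f.fiberι z w) := by
  have h1 := residueTrdeg_comp (f.fiberι z) f w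
  have h2 := residueTrdeg_comp (f.fiberToSpecResidueField z) (Z.fromSpecResidueField z) w
  rw [residueTrdeg_eq_zero_of_surjectiveOnStalks (f.fiberι z), zero_add] at h1
  rw [residueTrdeg_eq_zero_of_surjectiveOnStalks (Z.fromSpecResidueField z), add_zero] at h2
  rw [← h1, ← h2, f.fiber_fac]

variable [LocallyOfFiniteType f]

instance (z : Z) : LocallyOfFiniteType (f.fiberToSpecResidueField z) :=
  inferInstanceAs (LocallyOfFiniteType (pullback.snd _ _))

/-- The closure of `w` in its fibre has this dimension, already after intersection with a small
affine neighbourhood of `w`. -/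
theorem residueTrdeg_le_localDim (w : W) :
    (residueTrdeg f w : WithBot ℕ∞) ≤ localDim (f ⁻¹' {f w}) w := by
  refine le_iInf fun ⟨U, hU, hw⟩ => ?_
  let w' := f.asFiber w
  have hw' : f.fiberι _ w' = w := f.fiberι_asFiber w
  obtain ⟨V, hV, hwV, hVU⟩ := exists_isAffineOpen_mem_and_subset (X := f.fiber (f w)) (x := w')
    (U := f.fiberι _ ⁻¹ᵁ ⟨U, hU⟩) (by change f.fiberι _ w' ∈ U; rwa [hw'])
  rw [show residueTrdeg f w = residueTrdeg (f.fiberToSpecResidueField (f w)) w' by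
    rw [residueTrdeg_fiberToSpecResidueField, hw']]
  refine (topologicalKrullDim_closure_inter_eq (k := Z.residueField (f w))
    (f.fiberToSpecResidueField (f w)) hV hwV).symm.le.trans ?_
  have hmem : ∀ v : f.fiber (f w), v ∈ closure {w'} ∩ (V : Set (f.fiber (f w))) →
      f.fiberι _ v ∈ f ⁻¹' {f w} ∩ U := fun v hv =>
    ⟨by rw [← f.range_fiberι]; exact ⟨v, rfl⟩, hVU hv.2⟩
  exact Topology.IsInducing.topologicalKrullDim_le (f := Set.MapsTo.restrict _ _ _ hmem)
    (((f.fiberι (f w)).isEmbedding.isInducing.comp .subtypeVal).codRestrict _)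

/-- The point is the generic point of the fibre: its residue transcendence degree is the dimension
of the whole fibre, which bounds every local dimension. -/
theorem exists_forall_localDim_le {z : Z} (h : IsIrreducible (f ⁻¹' {z})) :
    ∃ w, f w = z ∧ ∀ v, localDim (f ⁻¹' {z}) v ≤ (residueTrdeg f w : WithBot ℕ∞) := by
  have : IrreducibleSpace (f.fiber z) := by
    rw [(f.fiberHomeo z).irreducibleSpace_iff]
    exact Subtype.irreducibleSpace h
  obtain ⟨η, hη⟩ := QuasiSober.sober (IrreducibleSpace.isIrreducible_univ (f.fiber z)) isClosed_univ
  have hfib : f (f.fiberι z η) = z := by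
    have : f.fiberι z η ∈ f ⁻¹' {z} := by rw [← f.range_fiberι]; exact ⟨η, rfl⟩
    exact this
  refine ⟨_, hfib, fun v => (iInf_le _ ⟨Set.univ, isOpen_univ, trivial⟩).trans ?_⟩
  have h1 := topologicalKrullDim_closure_singleton (k := Z.residueField z)
    (f.fiberToSpecResidueField z) η
  rw [residueTrdeg_fiberToSpecResidueField] at h1
  rw [← h1, hη.def]
  have h2 : Topology.IsInducing fun v : (f ⁻¹' {z} ∩ Set.univ : Set W) =>
      (f.fiberHomeo z).symm ⟨v, v.2.1⟩ :=
    (f.fiberHomeo z).symm.isInducing.comp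
      (Topology.IsEmbedding.inclusion Set.inter_subset_left).isInducing
  exact (h2.codRestrict (s := Set.univ) fun _ => trivial).topologicalKrullDim_le

end Fiber


/-! ### Finite fibres. -/

section QuasiFinite

variable {W Z : Scheme.{u}} (f : W ⟶ Z) [LocallyOfFiniteType f]

theorem residueTrdeg_eq_zero_of_finite_preimage [QuasiCompact f] (h : ∀ z, (f ⁻¹' {z}).Finite)
    (w : W) : residueTrdeg f w = 0 := by
  have : LocallyQuasiFinite f := locallyQuasiFinite_iff_finite_preimage_singleton.mpr h
  have h1 := f.isDiscrete_preimage_singleton (f w)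
  have : DiscreteTopology (f ⁻¹' {f w}) := h1.to_subtype
  have h2 : topologicalKrullDim (f ⁻¹' {f w} ∩ Set.univ : Set W) ≤ 0 := by
    rw [Set.inter_univ]
    exact topologicalKrullDim_zero_of_discreteTopology _
  have h3 := (residueTrdeg_le_localDim f w).trans
    ((iInf_le _ ⟨Set.univ, isOpen_univ, trivial⟩).trans h2)
  have h4 : residueTrdeg f w ≤ 0 := by exact_mod_cast h3
  exact le_antisymm h4 bot_le

end QuasiFinite

/-! ### Residue fields of fibre products. -/

section BaseChange

theorem exists_SpecMap_comp_fromSpecResidueField {K : Type u} [Field K] {X : Scheme.{u}}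
    (g : Spec (.of K) ⟶ X) {x : X} (hx : x ∈ Set.range g) :
    ∃ h : X.residueField x ⟶ .of K, Spec.map h ≫ X.fromSpecResidueField x = g := by
  obtain ⟨y, rfl⟩ := hx
  obtain rfl : y = IsLocalRing.closedPoint K := Subsingleton.elim _ _
  exact ⟨_, X.descResidueField_stalkClosedPointTo_fromSpecResidueField K g⟩

theorem residueFieldMap_comp_eq {X P : Scheme.{u}} {K : Type u} [Field K] (f : P ⟶ X) {p : P}
    (h : P.residueField p ⟶ .of K) {g : X.residueField (f p) ⟶ .of K}
    (hg : Spec.map h ≫ P.fromSpecResidueField p ≫ f = Spec.map g ≫ X.fromSpecResidueField _) :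
    f.residueFieldMap p ≫ h = g := by
  rw [← Spec.map_inj, ← cancel_mono (X.fromSpecResidueField (f p)), ← hg, Spec.map_comp,
    Category.assoc, Scheme.Hom.SpecMap_residueFieldMap_fromSpecResidueField]

variable {P X Y S : Scheme.{u}} {fst : P ⟶ X} {snd : P ⟶ Y} {f : X ⟶ S} {g : Y ⟶ S}

theorem flat_SpecMap_ofHom {E G : Type u} [Field E] [Field G] (f : E →+* G) :
    Flat (Spec.map (CommRingCat.ofHom f)) := by
  rw [Flat.SpecMap_iff]
  algebraize [f]
  change Module.Flat E G
  infer_instance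

/-- The residue field at a point of a fibre product is generated by the residue fields of the
projections. -/
theorem adjoin_range_residueFieldMap_eq_top (h : IsPullback fst snd f g) (p : P) :
    letI := (snd.residueFieldMap p).hom.toAlgebra
    IntermediateField.adjoin (Y.residueField (snd p))
      (Set.range (fst.residueFieldMap p).hom) = ⊤ := by
  let := (snd.residueFieldMap p).hom.toAlgebra
  let E := IntermediateField.adjoin (Y.residueField (snd p))
      (Set.range (fst.residueFieldMap p).hom)
  let ι : CommRingCat.of E ⟶ P.residueField p := CommRingCat.ofHom (algebraMap E (P.residueField p))
  let a : X.residueField (fst p) ⟶ .of E := CommRingCat.ofHom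
    ((fst.residueFieldMap p).hom.codRestrict E.toSubring fun x =>
      IntermediateField.subset_adjoin _ _ ⟨x, rfl⟩)
  let b : Y.residueField (snd p) ⟶ .of E := CommRingCat.ofHom (algebraMap (Y.residueField (snd p)) E)
  have ha : a ≫ ι = fst.residueFieldMap p := rfl
  have hb : b ≫ ι = snd.residueFieldMap p := rfl
  have hepi : Epi (Spec.map ι) := by
    have : Flat (Spec.map ι) := flat_SpecMap_ofHom (algebraMap E (P.residueField p))
    have : Surjective (Spec.map ι) := ⟨Function.surjective_to_subsingleton _⟩
    exact Flat.epi_of_flat_of_surjective _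
  have hcomm : (Spec.map a ≫ X.fromSpecResidueField _) ≫ f =
      (Spec.map b ≫ Y.fromSpecResidueField _) ≫ g := by
    rw [← cancel_epi (Spec.map ι), ← Category.assoc, ← Category.assoc, ← Category.assoc,
      ← Category.assoc, ← Spec.map_comp, ← Spec.map_comp, ha, hb,
      Scheme.Hom.SpecMap_residueFieldMap_fromSpecResidueField,
      Scheme.Hom.SpecMap_residueFieldMap_fromSpecResidueField, Category.assoc, Category.assoc, h.w]
  -- The projections of `p` factor through `Spec E`, so `Spec E` maps to `P` with image `p`. This
  -- splits the inclusion of `E` into the residue field of `p`, which is therefore onto.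
  let l := h.lift _ _ hcomm
  have hl : Spec.map ι ≫ l = P.fromSpecResidueField p := by
    apply h.hom_ext
    · rw [Category.assoc, h.lift_fst, ← Category.assoc, ← Spec.map_comp, ha,
        Scheme.Hom.SpecMap_residueFieldMap_fromSpecResidueField]
    · rw [Category.assoc, h.lift_snd, ← Category.assoc, ← Spec.map_comp, hb,
        Scheme.Hom.SpecMap_residueFieldMap_fromSpecResidueField]
  obtain ⟨c, hc⟩ := exists_SpecMap_comp_fromSpecResidueField l (x := p) (by
    refine ⟨Spec.map ι default, ?_⟩
    rw [← Scheme.Hom.comp_apply, hl, Scheme.fromSpecResidueField_apply])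
  have hcι : c ≫ ι = 𝟙 _ := by
    rw [← Spec.map_inj, ← cancel_mono (P.fromSpecResidueField p), Spec.map_comp, Category.assoc,
      hc, hl, Spec.map_id, Category.id_comp]
  rw [eq_top_iff]
  intro x _
  have : (c ≫ ι) x = x := by rw [hcι]; rfl
  rw [← this]
  exact (c x).2

/-- The residue field of `p` is a compositum of those of its projections, and transcendence degree
does not grow in a compositum. -/
theorem residueTrdeg_snd_le (h : IsPullback fst snd f g) (p : P) :
    residueTrdeg snd p ≤ residueTrdeg f (fst p) := by
  have htop := adjoin_range_residueFieldMap_eq_top h p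
  have hw : f (fst p) = g (snd p) := by rw [← Scheme.Hom.comp_apply, h.w, Scheme.Hom.comp_apply]
  let a := f.residueFieldMap (fst p)
  let b := (S.residueFieldCongr hw).hom ≫ g.residueFieldMap (snd p)
  let c := fst.residueFieldMap p
  let d := snd.residueFieldMap p
  have hcomm : a ≫ c = b ≫ d := by
    rw [← Spec.map_inj, ← cancel_mono (S.fromSpecResidueField _)]
    simp only [a, b, c, d, Spec.map_comp, Category.assoc,
      Scheme.Hom.SpecMap_residueFieldMap_fromSpecResidueField,
      Scheme.residueFieldCongr_fromSpecResidueField,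
      Scheme.Hom.SpecMap_residueFieldMap_fromSpecResidueField_assoc, h.w]
  let := a.hom.toAlgebra
  let := b.hom.toAlgebra
  let := d.hom.toAlgebra
  let := (d.hom.comp b.hom).toAlgebra
  have : IsScalarTower (S.residueField (f (fst p))) (Y.residueField (snd p)) (P.residueField p) :=
    .of_algebraMap_eq fun _ => rfl
  exact OrderHomClass.mono Cardinal.toENat (trdeg_le_of_adjoin_range_eq_top
    (AlgHom.mk c.hom fun x => congrArg (fun φ : S.residueField (f (fst p)) ⟶ P.residueField p =>
      φ.hom x) hcomm) htop)

theorem mk_le_residueTrdeg {p : P} {x : X} {y : Y} (hx : fst p = x) (hy : snd p = y)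
    {G : Type u} [Field G] (c : P.residueField p ⟶ .of G) (e : X.residueField x ⟶ .of G)
    (j : Y.residueField y ⟶ .of G)
    (h₁ : Spec.map c ≫ P.fromSpecResidueField p ≫ fst = Spec.map e ≫ X.fromSpecResidueField _)
    (h₂ : Spec.map c ≫ P.fromSpecResidueField p ≫ snd = Spec.map j ≫ Y.fromSpecResidueField _)
    {s : Set (X.residueField x)}
    (hs : letI := j.hom.toAlgebra
      AlgebraicIndependent (Y.residueField y) fun z : s => e.hom z) :
    Cardinal.toENat (Cardinal.mk s) ≤ residueTrdeg snd p := by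
  subst hx hy
  have he := residueFieldMap_comp_eq fst c h₁
  have hj := residueFieldMap_comp_eq snd c h₂
  let := j.hom.toAlgebra
  let := (snd.residueFieldMap p).hom.toAlgebra
  let F : P.residueField p →ₐ[Y.residueField (snd p)] G :=
    AlgHom.mk c.hom fun x => congrArg (fun φ : Y.residueField (snd p) ⟶ .of G => φ.hom x) hj
  have h1 : AlgebraicIndependent (Y.residueField (snd p))
      (F ∘ fun z : s => (fst.residueFieldMap p).hom z) := by
    convert hs using 2 with z
    exact congrArg (fun φ : X.residueField (fst p) ⟶ .of G => φ.hom z) he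
  exact OrderHomClass.mono Cardinal.toENat (AlgebraicIndependent.of_comp F h1).cardinalMk_le_trdeg

/-- The required point is the image of `Spec G`, where `G` contains both residue fields and keeps a
transcendence basis of the first independent over the second. -/
theorem exists_residueTrdeg_le_residueTrdeg_snd (h : IsPullback fst snd f g) {x : X} {y : Y}
    (hxy : f x = g y) :
    ∃ p : P, fst p = x ∧ snd p = y ∧ residueTrdeg f x ≤ residueTrdeg snd p := by
  let a := f.residueFieldMap x
  let b := (S.residueFieldCongr hxy).hom ≫ g.residueFieldMap y
  let := a.hom.toAlgebra
  let := b.hom.toAlgebra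
  obtain ⟨s, hs⟩ := exists_isTranscendenceBasis (S.residueField (f x)) (X.residueField x)
  obtain ⟨G, _, _, e, he, hind⟩ := exists_ringHom_algebraicIndependent
    (F := Y.residueField y) hs
  let e' : X.residueField x ⟶ .of G := CommRingCat.ofHom e
  let j : Y.residueField y ⟶ .of G := CommRingCat.ofHom (algebraMap (Y.residueField y) G)
  have hej : a ≫ e' = b ≫ j := by
    ext z
    exact congrArg (fun φ => φ z) he
  have hcomm : (Spec.map e' ≫ X.fromSpecResidueField _) ≫ f =
      (Spec.map j ≫ Y.fromSpecResidueField _) ≫ g := by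
    have := congrArg (fun φ => Spec.map φ ≫ S.fromSpecResidueField _) hej
    simpa only [a, b, Spec.map_comp, Category.assoc,
      Scheme.Hom.SpecMap_residueFieldMap_fromSpecResidueField,
      Scheme.residueFieldCongr_fromSpecResidueField] using this
  let l := h.lift _ _ hcomm
  obtain ⟨c, hc⟩ := exists_SpecMap_comp_fromSpecResidueField l (x := l default) ⟨_, rfl⟩
  have hx : fst (l default) = x := by
    rw [← Scheme.Hom.comp_apply, h.lift_fst, Scheme.Hom.comp_apply,
      Scheme.fromSpecResidueField_apply]
  have hy : snd (l default) = y := by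
    rw [← Scheme.Hom.comp_apply, h.lift_snd, Scheme.Hom.comp_apply,
      Scheme.fromSpecResidueField_apply]
  refine ⟨l default, hx, hy, ?_⟩
  have key := mk_le_residueTrdeg hx hy c e' j
    (by rw [← Category.assoc, hc, h.lift_fst]) (by rw [← Category.assoc, hc, h.lift_snd]) hind
  refine le_trans ?_ key
  rw [hs.cardinalMk_eq_trdeg]
  exact le_rfl

end BaseChange


/-! ### Spreading out over finitely generated subalgebras. -/

section Spreading

/-- The symmetric alternative makes the induction pass through complements. -/
theorem exists_isLocallyClosed_of_isConstructible {T : Type*} [TopologicalSpace T] {s : Set T}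
    (hs : Topology.IsConstructible s) (x : T) :
    ∃ C : Set T, IsLocallyClosed C ∧ x ∈ C ∧ (C ⊆ s ∨ C ⊆ sᶜ) := by
  induction hs using Topology.IsConstructible.empty_union_induction generalizing x with
  | open_retrocompact U hU _ =>
    by_cases hx : x ∈ U
    · exact ⟨U, hU.isLocallyClosed, hx, .inl subset_rfl⟩
    · exact ⟨Uᶜ, hU.isClosed_compl.isLocallyClosed, hx, .inr subset_rfl⟩
  | union s _ t _ hs ht =>
    obtain ⟨C, hC, hxC, h⟩ := hs x
    obtain ⟨D, hD, hxD, h'⟩ := ht x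
    refine ⟨C ∩ D, hC.inter hD, ⟨hxC, hxD⟩, ?_⟩
    rcases h with h | h
    · exact .inl (Set.inter_subset_left.trans (h.trans Set.subset_union_left))
    · rcases h' with h' | h'
      · exact .inl (Set.inter_subset_right.trans (h'.trans Set.subset_union_right))
      · rw [Set.compl_union]
        exact .inr (Set.inter_subset_inter h h')
  | compl s _ hs =>
    obtain ⟨C, hC, hxC, h⟩ := hs x
    exact ⟨C, hC, hxC, by rwa [compl_compl, or_comm]⟩

theorem exists_isClosed_singleton_of_isConstructible {T : Type*} [TopologicalSpace T]
    [JacobsonSpace T] {s : Set T} (hs : Topology.IsConstructible s) (h : s.Nonempty) :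
    ∃ x ∈ s, IsClosed {x} := by
  obtain ⟨y, hy⟩ := h
  obtain ⟨C, hC, hyC, h⟩ := exists_isLocallyClosed_of_isConstructible hs y
  have hCs : C ⊆ s := h.resolve_right fun h => h hyC hy
  obtain ⟨x, hx, hx'⟩ := nonempty_inter_closedPoints (Z := C) ⟨y, hyC⟩ hC
  exact ⟨x, hCs hx, hx'⟩

/-- The universal property maps the pushout into the generated subring, and this map splits the
inclusion. -/
theorem closure_range_union_range_eq_top {A B R E : CommRingCat.{u}} {a : A ⟶ B} {b : A ⟶ R}
    {f : B ⟶ E} {g : R ⟶ E} (h : IsPushout a b f g) :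
    Subring.closure (Set.range f.hom ∪ Set.range g.hom) = ⊤ := by
  let S := Subring.closure (Set.range f.hom ∪ Set.range g.hom)
  let f' : B ⟶ .of S := CommRingCat.ofHom (f.hom.codRestrict S fun x =>
    Subring.subset_closure (.inl ⟨x, rfl⟩))
  let g' : R ⟶ .of S := CommRingCat.ofHom (g.hom.codRestrict S fun x =>
    Subring.subset_closure (.inr ⟨x, rfl⟩))
  let i : CommRingCat.of S ⟶ E := CommRingCat.ofHom S.subtype
  have hf : f' ≫ i = f := rfl
  have hg : g' ≫ i = g := rfl
  have hw : a ≫ f' = b ≫ g' := by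
    refine CommRingCat.hom_ext (RingHom.ext fun x => Subtype.ext ?_)
    exact congrArg (fun φ : A ⟶ E => φ.hom x) h.w
  have hid : h.desc f' g' hw ≫ i = 𝟙 E := by
    apply h.hom_ext
    · rw [← Category.assoc, h.inl_desc, hf, Category.comp_id]
    · rw [← Category.assoc, h.inr_desc, hg, Category.comp_id]
  rw [eq_top_iff]
  intro x _
  have : (h.desc f' g' hw ≫ i).hom x = x := by rw [hid]; rfl
  rw [← this]
  exact (h.desc f' g' hw x).2

variable {W Z : Scheme.{u}} (φ : W ⟶ Z) {V : Z.Opens} (hV : IsAffineOpen V)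
  {L : Type u} [Field L] [Algebra Γ(Z, V) L]

/-- The morphism to `Z` given by a subalgebra of `L` over the ring of an affine open. -/
noncomputable def subalgebraPoint (R : Subalgebra Γ(Z, V) L) : Spec (.of R) ⟶ Z :=
  Spec.map (CommRingCat.ofHom (algebraMap Γ(Z, V) R)) ≫ hV.fromSpec

variable {Q : Scheme.{u}} {g : Q ⟶ W} {p : Q ⟶ Spec (.of L)}

theorem subalgebraPoint_condition
    (hQ : IsPullback g p φ (Spec.map (CommRingCat.ofHom (algebraMap Γ(Z, V) L)) ≫ hV.fromSpec))
    (R : Subalgebra Γ(Z, V) L) :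
    g ≫ φ = (p ≫ Spec.map (CommRingCat.ofHom (algebraMap R L))) ≫ subalgebraPoint hV R := by
  rw [hQ.w, subalgebraPoint, Category.assoc, ← Spec.map_comp_assoc, ← CommRingCat.ofHom_comp,
    ← IsScalarTower.algebraMap_eq]

/-- The comparison of the fibre products over `L` and over a subalgebra `R` of `L`. -/
noncomputable def subalgebraComparison
    (hQ : IsPullback g p φ (Spec.map (CommRingCat.ofHom (algebraMap Γ(Z, V) L)) ≫ hV.fromSpec))
    (R : Subalgebra Γ(Z, V) L) : Q ⟶ pullback φ (subalgebraPoint hV R) :=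
  pullback.lift g (p ≫ Spec.map (CommRingCat.ofHom (algebraMap R L)))
    (subalgebraPoint_condition φ hV hQ R)

variable (hQ : IsPullback g p φ (Spec.map (CommRingCat.ofHom (algebraMap Γ(Z, V) L)) ≫ hV.fromSpec))

theorem isPullback_subalgebraComparison (R : Subalgebra Γ(Z, V) L) :
    IsPullback (subalgebraComparison φ hV hQ R) p (pullback.snd φ (subalgebraPoint hV R))
      (Spec.map (CommRingCat.ofHom (algebraMap R L))) := by
  refine IsPullback.of_right (t := IsPullback.of_hasPullback φ (subalgebraPoint hV R)) ?_ ?_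
  · rw [subalgebraComparison, pullback.lift_fst, subalgebraPoint, ← Spec.map_comp_assoc,
      ← CommRingCat.ofHom_comp, ← IsScalarTower.algebraMap_eq]
    exact hQ
  · rw [subalgebraComparison, pullback.lift_snd]

theorem appLE_congr_hom {X Y : Scheme.{u}} {f f' : X ⟶ Y} (h : f = f') {U : Y.Opens} {V : X.Opens}
    (e : V ≤ f ⁻¹ᵁ U) (e' : V ≤ f' ⁻¹ᵁ U) : f.appLE U V e = f'.appLE U V e' := by
  subst h
  rfl

/-- Sections over the affine open `g ⁻¹ᵁ W₀` are polynomial expressions in sections on `W₀` and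
elements of `L`; only finitely many elements of `L` occur in a given one. -/
theorem exists_subalgebra_forall_mem_range {W₀ : W.Opens} (hW₀ : IsAffineOpen W₀)
    (hWV : W₀ ≤ φ ⁻¹ᵁ V) (x : Γ(Q, g ⁻¹ᵁ W₀)) :
    ∃ R : Subalgebra Γ(Z, V) L, R.FG ∧ ∀ R' : Subalgebra Γ(Z, V) L, R ≤ R' →
      ∀ e, ∃ y : Γ(pullback φ (subalgebraPoint hV R'),
        (pullback.fst φ (subalgebraPoint hV R')) ⁻¹ᵁ W₀),
        (subalgebraComparison φ hV hQ R').appLE _ (g ⁻¹ᵁ W₀) e y = x := by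
  have hT : (⊤ : (Spec (.of L)).Opens) ≤
      (Spec.map (CommRingCat.ofHom (algebraMap Γ(Z, V) L)) ≫ hV.fromSpec) ⁻¹ᵁ V := by
    intro t _
    change hV.fromSpec _ ∈ V
    rw [← SetLike.mem_coe, ← hV.range_fromSpec]
    exact ⟨_, rfl⟩
  have hiso := (isIso_pushoutSection_iff hQ hT hWV (UY := g ⁻¹ᵁ W₀) (by simp)).mp
    (isIso_pushoutSection_of_isAffineOpen hQ hT hWV (by simp) hV (isAffineOpen_top _) hW₀)
  have hx : x ∈ Subring.closure _ := (closure_range_union_range_eq_top hiso).ge trivial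
  induction hx using Subring.closure_induction with
  | mem x hx =>
    rcases hx with ⟨β, rfl⟩ | ⟨l, rfl⟩
    · refine ⟨⊥, Subalgebra.fg_bot, fun R' _ e =>
        ⟨(pullback.fst φ (subalgebraPoint hV R')).appLE W₀ _ le_rfl β, ?_⟩⟩
      rw [← CommRingCat.comp_apply, Scheme.Hom.appLE_comp_appLE]
      exact congrArg (fun f : Γ(W, W₀) ⟶ Γ(Q, g ⁻¹ᵁ W₀) => f.hom β)
        (appLE_congr_hom (pullback.lift_fst _ _ _) _ _)
    · refine ⟨Algebra.adjoin _ {(Scheme.ΓSpecIso (.of L)).hom l},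
        ⟨{_}, by rw [Finset.coe_singleton]⟩, fun R' hR' e => ?_⟩
      have hl : (Scheme.ΓSpecIso (.of L)).hom l ∈ R' := hR' (Algebra.subset_adjoin rfl)
      let i : CommRingCat.of R' ⟶ .of L := CommRingCat.ofHom (algebraMap R' L)
      have e₁ : (pullback.fst φ (subalgebraPoint hV R')) ⁻¹ᵁ W₀ ≤
        (pullback.snd φ (subalgebraPoint hV R')) ⁻¹ᵁ ⊤ := le_top
      have e₂ : (⊤ : (Spec (.of L)).Opens) ≤ (Spec.map i) ⁻¹ᵁ ⊤ := le_top
      have e₃ : g ⁻¹ᵁ W₀ ≤ p ⁻¹ᵁ ⊤ := le_top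
      obtain ⟨l', hl'⟩ : ∃ l' : Γ(Spec (.of R'), ⊤), (Spec.map i).appLE ⊤ ⊤ e₂ l' = l := by
        refine ⟨(Scheme.ΓSpecIso (.of R')).inv ⟨(Scheme.ΓSpecIso (.of L)).hom l, hl⟩, ?_⟩
        have h1 := congrArg (fun f : CommRingCat.of R' ⟶ Γ(Spec (.of L), ⊤) =>
          f.hom ⟨(Scheme.ΓSpecIso (.of L)).hom l, hl⟩) (Scheme.ΓSpecIso_inv_naturality i)
        have h2 : (Scheme.ΓSpecIso (.of L)).inv ((Scheme.ΓSpecIso (.of L)).hom l) = l :=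
          Iso.hom_inv_id_apply _ _
        have h3 : (Spec.map i).appTop = (Spec.map i).appLE ⊤ ⊤ e₂ := Scheme.Hom.app_eq_appLE _
        rw [← h3]
        exact h1.symm.trans h2
      have key : (pullback.snd φ (subalgebraPoint hV R')).appLE ⊤ _ e₁ ≫
          (subalgebraComparison φ hV hQ R').appLE _ (g ⁻¹ᵁ W₀) e =
          (Spec.map i).appLE ⊤ ⊤ e₂ ≫ p.appLE ⊤ _ e₃ := by
        rw [Scheme.Hom.appLE_comp_appLE, Scheme.Hom.appLE_comp_appLE]
        exact appLE_congr_hom (pullback.lift_snd _ _ _) _ _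
      refine ⟨(pullback.snd φ (subalgebraPoint hV R')).appLE ⊤ _ e₁ l', ?_⟩
      rw [← hl']
      exact congrArg (fun f : Γ(Spec (.of R'), ⊤) ⟶ Γ(Q, g ⁻¹ᵁ W₀) => f.hom l') key
  | zero => exact ⟨⊥, Subalgebra.fg_bot, fun R' _ e => ⟨0, map_zero _⟩⟩
  | one => exact ⟨⊥, Subalgebra.fg_bot, fun R' _ e => ⟨1, map_one _⟩⟩
  | add x y _ _ hx hy =>
    obtain ⟨R₁, h₁, H₁⟩ := hx
    obtain ⟨R₂, h₂, H₂⟩ := hy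
    refine ⟨R₁ ⊔ R₂, h₁.sup h₂, fun R' hR' e => ?_⟩
    obtain ⟨y₁, rfl⟩ := H₁ R' (le_sup_left.trans hR') e
    obtain ⟨y₂, rfl⟩ := H₂ R' (le_sup_right.trans hR') e
    exact ⟨y₁ + y₂, map_add _ _ _⟩
  | neg x _ hx =>
    obtain ⟨R₁, h₁, H₁⟩ := hx
    refine ⟨R₁, h₁, fun R' hR' e => ?_⟩
    obtain ⟨y₁, rfl⟩ := H₁ R' hR' e
    exact ⟨-y₁, map_neg _ _⟩
  | mul x y _ _ hx hy =>
    obtain ⟨R₁, h₁, H₁⟩ := hx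
    obtain ⟨R₂, h₂, H₂⟩ := hy
    refine ⟨R₁ ⊔ R₂, h₁.sup h₂, fun R' hR' e => ?_⟩
    obtain ⟨y₁, rfl⟩ := H₁ R' (le_sup_left.trans hR') e
    obtain ⟨y₂, rfl⟩ := H₂ R' (le_sup_right.trans hR') e
    exact ⟨y₁ * y₂, map_mul _ _ _⟩

/-- Open subsets of a fibre product over `L` come from a finitely generated subalgebra. -/
theorem exists_subalgebra_forall_exists_opens {q : Q} {O : Set Q} (hO : IsOpen O) (hq : q ∈ O) :
    ∃ R : Subalgebra Γ(Z, V) L, R.FG ∧ ∀ R' : Subalgebra Γ(Z, V) L, R ≤ R' →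
      ∃ D : Set ↥(pullback φ (subalgebraPoint hV R')), IsOpen D ∧
        subalgebraComparison φ hV hQ R' ⁻¹' D ⊆ O ∧ subalgebraComparison φ hV hQ R' q ∈ D := by
  have hgV : φ (g q) ∈ V := by
    rw [← Scheme.Hom.comp_apply, hQ.w, Scheme.Hom.comp_apply, Scheme.Hom.comp_apply,
      ← SetLike.mem_coe, ← hV.range_fromSpec]
    exact ⟨_, rfl⟩
  obtain ⟨W₀, hW₀, hqW, hWV⟩ := exists_isAffineOpen_mem_and_subset (X := W) (x := g q)
    (U := φ ⁻¹ᵁ V) hgV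
  have hT : (⊤ : (Spec (.of L)).Opens) ≤
      (Spec.map (CommRingCat.ofHom (algebraMap Γ(Z, V) L)) ≫ hV.fromSpec) ⁻¹ᵁ V := by
    intro t _
    change hV.fromSpec _ ∈ V
    rw [← SetLike.mem_coe, ← hV.range_fromSpec]
    exact ⟨_, rfl⟩
  have haff : IsAffineOpen (g ⁻¹ᵁ W₀) := by
    have : IsAffine V := hV
    have : IsAffine W₀ := hW₀
    have : IsAffine (⊤ : (Spec (.of L)).Opens) := isAffineOpen_top _
    exact .of_isIso (Scheme.Hom.isPullback_resLE hQ hT hWV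
      (UY := g ⁻¹ᵁ W₀) (by simp)).isoPullback.hom
  obtain ⟨b, hb, hqb⟩ := haff.exists_basicOpen_le (V := ⟨O, hO⟩) ⟨q, hq⟩ hqW
  obtain ⟨R, hR, H⟩ := exists_subalgebra_forall_mem_range φ hV hQ hW₀ hWV b
  refine ⟨R, hR, fun R' hR' => ?_⟩
  have e : g ⁻¹ᵁ W₀ ≤ subalgebraComparison φ hV hQ R' ⁻¹ᵁ
      (pullback.fst φ (subalgebraPoint hV R')) ⁻¹ᵁ W₀ := by
    rw [← Scheme.Hom.comp_preimage, subalgebraComparison, pullback.lift_fst]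
  obtain ⟨y, hy⟩ := H R' hR' e
  have h1 := Scheme.basicOpen_appLE (subalgebraComparison φ hV hQ R') (g ⁻¹ᵁ W₀) _ e y
  rw [hy] at h1
  have h2 : subalgebraComparison φ hV hQ R' ⁻¹ᵁ Scheme.basicOpen _ y ≤ g ⁻¹ᵁ W₀ := by
    refine ((Scheme.Hom.preimage_mono _ (Scheme.basicOpen_le _ y))).trans ?_
    rw [← Scheme.Hom.comp_preimage, subalgebraComparison, pullback.lift_fst]
  rw [inf_eq_right.mpr h2] at h1
  refine ⟨_, (Scheme.basicOpen _ y).2, ?_, ?_⟩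
  · intro t ht
    exact hb (h1.ge ht)
  · exact h1.le hqb

end Spreading


/-! ### Irreducibility of fibres over extension fields. -/

section GeometricIrreducibility

theorem isConstructible_of_isOpen {T : Type*} [TopologicalSpace T] [NoetherianSpace T] {U : Set T}
    (hU : IsOpen U) : Topology.IsConstructible U :=
  IsRetrocompact.isConstructible hU (fun _ _ _ => NoetherianSpace.isCompact _)

/-- As a section of a separated morphism, `τ` is a closed immersion; hence `Q` is homeomorphic to
the fibre over a closed point. -/
theorem isIrreducible_range_of_section_fiber {K : Type u} [Field K] {W Z Q : Scheme.{u}} {φ : W ⟶ Z}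
    (s : Z ⟶ Spec (.of K)) [IsSeparated s] {g : Q ⟶ W} {p : Q ⟶ Spec (.of K)}
    {τ : Spec (.of K) ⟶ Z} (hQ : IsPullback g p φ τ) (hτ : τ ≫ s = 𝟙 _) [Nonempty Q]
    (h : ∀ z ∈ Set.range φ, IsClosed {z} → IsIrreducible (φ ⁻¹' {z})) : IrreducibleSpace Q := by
  have hτ' : IsClosedImmersion τ := isClosedImmersion_of_comp_eq_id s τ hτ
  have hg : IsClosedImmersion g := MorphismProperty.of_isPullback hQ.flip hτ'
  have hr : Set.range τ = {τ default} := by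
    ext x
    constructor
    · rintro ⟨y, rfl⟩
      rw [Subsingleton.elim y default]
      rfl
    · rintro rfl
      exact ⟨_, rfl⟩
  have hrange : Set.range g = φ ⁻¹' {τ default} := by
    rw [← hr]
    ext x
    constructor
    · rintro ⟨q, rfl⟩
      exact ⟨p q, by rw [← Scheme.Hom.comp_apply, ← hQ.w, Scheme.Hom.comp_apply]⟩
    · rintro ⟨y, hy⟩
      obtain ⟨q, hq, -⟩ := Scheme.exists_preimage_of_isPullback hQ x y hy.symm
      exact ⟨q, hq⟩
  have hirr : IsIrreducible (Set.range g) := by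
    rw [hrange]
    refine h _ ?_ ?_
    · obtain ⟨q⟩ := ‹Nonempty Q›
      have : g q ∈ φ ⁻¹' {τ default} := hrange ▸ ⟨q, rfl⟩
      exact ⟨_, this⟩
    · rw [← hr]
      exact τ.isClosedEmbedding.isClosed_range
  have := Subtype.irreducibleSpace hirr
  exact (g.isClosedEmbedding.isEmbedding.toHomeomorph.irreducibleSpace_iff).mpr this

/-- If the fibres over the closed points are irreducible, then so are the fibres over all points
with values in an extension field. -/
theorem irreducibleSpace_of_isPullback {K L : Type u} [Field K] [IsAlgClosed K] [Field L]
    {W Z Q : Scheme.{u}} (φ : W ⟶ Z) [LocallyOfFiniteType φ] [QuasiCompact φ]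
    (s : Z ⟶ Spec (.of K)) [LocallyOfFiniteType s] [IsSeparated s]
    (h : ∀ z ∈ Set.range φ, IsClosed {z} → IsIrreducible (φ ⁻¹' {z}))
    {g : Q ⟶ W} {p : Q ⟶ Spec (.of L)} {τ : Spec (.of L) ⟶ Z} (hQ : IsPullback g p φ τ)
    [Nonempty Q] : IrreducibleSpace Q := by
  obtain ⟨V, hV, hτV, -⟩ := exists_isAffineOpen_mem_and_subset (X := Z)
    (x := τ (IsLocalRing.closedPoint L)) (U := ⊤) trivial
  have hτr : Set.range τ ⊆ Set.range hV.fromSpec := by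
    rintro _ ⟨y, rfl⟩
    rw [hV.range_fromSpec, Subsingleton.elim y (IsLocalRing.closedPoint L)]
    exact hτV
  let a : Γ(Z, V) ⟶ .of L := Spec.preimage (IsOpenImmersion.lift hV.fromSpec τ hτr)
  let := a.hom.toAlgebra
  have hτ : τ = Spec.map (CommRingCat.ofHom (algebraMap Γ(Z, V) L)) ≫ hV.fromSpec := by
    change τ = Spec.map a ≫ hV.fromSpec
    rw [Spec.map_preimage, IsOpenImmersion.lift_fac]
  rw [hτ] at hQ
  have hpre : IsPreirreducible (Set.univ : Set Q) := by
    rintro O₁ O₂ hO₁ hO₂ ⟨q₁, -, hq₁⟩ ⟨q₂, -, hq₂⟩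
    by_contra hcon
    obtain ⟨R₁, hR₁, H₁⟩ := exists_subalgebra_forall_exists_opens φ hV hQ hO₁ hq₁
    obtain ⟨R₂, hR₂, H₂⟩ := exists_subalgebra_forall_exists_opens φ hV hQ hO₂ hq₂
    -- Two disjoint non-empty opens of `Q` both contain preimages of opens over one finitely
    -- generated `R`; the aim is to specialize `R` to `K`.
    let R := R₁ ⊔ R₂
    have hR : R.FG := hR₁.sup hR₂
    obtain ⟨D₁, hD₁, hDO₁, hqD₁⟩ := H₁ R le_sup_left
    obtain ⟨D₂, hD₂, hDO₂, hqD₂⟩ := H₂ R le_sup_right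
    let t := subalgebraPoint hV R
    let P := pullback φ t
    let pr : P ⟶ Spec (.of R) := pullback.snd φ t
    let u : Q ⟶ P := subalgebraComparison φ hV hQ R
    have hu : IsPullback u p pr (Spec.map (CommRingCat.ofHom (algebraMap R L))) :=
      isPullback_subalgebraComparison φ hV hQ R
    have : LocallyOfFiniteType t := by
      have : LocallyOfFiniteType (Spec.map (CommRingCat.ofHom (algebraMap Γ(Z, V) R))) := by
        rw [HasRingHomProperty.Spec_iff (P := @LocallyOfFiniteType), CommRingCat.hom_ofHom,
          RingHom.finiteType_algebraMap]
        exact (Subalgebra.fg_iff_finiteType R).mp hR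
      exact inferInstanceAs (LocallyOfFiniteType (_ ≫ _))
    have : IsLocallyNoetherian (Spec (.of R)) := LocallyOfFiniteType.isLocallyNoetherian (t ≫ s)
    have : JacobsonSpace (Spec (.of R)) := LocallyOfFiniteType.jacobsonSpace (t ≫ s)
    have : QuasiCompact pr := inferInstanceAs (QuasiCompact (pullback.snd _ _))
    have : LocallyOfFiniteType pr := inferInstanceAs (LocallyOfFiniteType (pullback.snd _ _))
    have : LocallyOfFinitePresentation pr :=
      LocallyOfFinitePresentation.iff_locallyOfFiniteType.mpr inferInstance
    have : IsNoetherian P :=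
      { toIsLocallyNoetherian := LocallyOfFiniteType.isLocallyNoetherian pr
        toCompactSpace := QuasiCompact.compactSpace_of_compactSpace pr }
    -- Over points of this set both opens meet the fibre but their intersection does not. By
    -- Chevalley it is constructible, and it contains the image of `Spec L`, hence also a closed
    -- point of `Spec R`.
    have hcons : Topology.IsConstructible ((pr '' D₁ ∩ pr '' D₂) \ pr '' (D₁ ∩ D₂)) :=
      ((pr.isConstructible_image (isConstructible_of_isOpen hD₁)).inter
        (pr.isConstructible_image (isConstructible_of_isOpen hD₂))).sdiff
        (pr.isConstructible_image (isConstructible_of_isOpen (hD₁.inter hD₂)))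
    let η : Spec (.of R) := Spec.map (CommRingCat.ofHom (algebraMap R L)) (IsLocalRing.closedPoint L)
    have hη : ∀ q : Q, pr (u q) = η := fun q => by
      rw [← Scheme.Hom.comp_apply, hu.w, Scheme.Hom.comp_apply]
      exact congrArg _ (Subsingleton.elim _ _)
    obtain ⟨r, ⟨⟨⟨x₁, hx₁, hr₁⟩, ⟨x₂, hx₂, hr₂⟩⟩, hr⟩, hrc⟩ :=
      exists_isClosed_singleton_of_isConstructible hcons
        ⟨η, ⟨⟨u q₁, hqD₁, hη q₁⟩, ⟨u q₂, hqD₂, hη q₂⟩⟩, by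
          rintro ⟨x, ⟨hx₁, hx₂⟩, hx⟩
          obtain ⟨q, rfl, -⟩ := Scheme.exists_preimage_of_isPullback hu x
            (IsLocalRing.closedPoint L) hx
          exact hcon ⟨q, trivial, hDO₁ hx₁, hDO₂ hx₂⟩⟩
    -- As `K` is algebraically closed the closed point is `K`-rational, and its fibre is irreducible
    -- by hypothesis, which is the contradiction.
    let ρ : Spec (.of K) ⟶ Spec (.of R) := pointOfClosedPoint (t ≫ s) r hrc
    have hρ : ρ ≫ t ≫ s = 𝟙 _ := pointOfClosedPoint_comp (t ≫ s) r hrc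
    have hρr : ∀ y, ρ y = r := fun y => pointOfClosedPoint_apply (t ≫ s) r hrc y
    have hfib : IsPullback (pullback.fst pr ρ ≫ pullback.fst φ t) (pullback.snd pr ρ) φ (ρ ≫ t) :=
      ((IsPullback.of_hasPullback pr ρ).flip.paste_vert (IsPullback.of_hasPullback φ t).flip).flip
    have hex : ∀ x, pr x = r → ∃ y, pullback.fst pr ρ y = x := fun x hx => by
      obtain ⟨y, hy, -⟩ := Scheme.exists_preimage_of_isPullback
        (IsPullback.of_hasPullback pr ρ) x (IsLocalRing.closedPoint K) (hx.trans (hρr _).symm)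
      exact ⟨y, hy⟩
    obtain ⟨y₁, rfl⟩ := hex x₁ hr₁
    obtain ⟨y₂, rfl⟩ := hex x₂ hr₂
    have : Nonempty ↥(pullback pr ρ) := ⟨y₁⟩
    have := isIrreducible_range_of_section_fiber s hfib (by rw [Category.assoc, hρ]) h
    obtain ⟨y, -, hy₁, hy₂⟩ := (IrreducibleSpace.isIrreducible_univ ↥(pullback pr ρ)).2 _ _
      (hD₁.preimage (pullback.fst pr ρ).continuous) (hD₂.preimage (pullback.fst pr ρ).continuous)
      ⟨y₁, trivial, hx₁⟩ ⟨y₂, trivial, hx₂⟩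
    refine hr ⟨_, ⟨hy₁, hy₂⟩, ?_⟩
    have : pr (pullback.fst pr ρ y) = ρ (pullback.snd pr ρ y) := by
      rw [← Scheme.Hom.comp_apply, pullback.condition, Scheme.Hom.comp_apply]
    rw [this, hρr]
  exact { toPreirreducibleSpace := ⟨hpre⟩, toNonempty := inferInstance }

end GeometricIrreducibility


/-! ### Base change of distinguished categories. -/

section BaseChangeData

variable {C : Type v} [Category.{w} C] {K L : Type u} [Field K] [Field L] [Algebra K L]

/-- A functor `F'` to schemes over `L` that is the base change of `F` along `K ⊂ L`. -/
structure BaseChangeData (F : C ⥤ SchemesOver K) (F' : C ⥤ SchemesOver L) where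
  π (X : C) : (F'.obj X).left ⟶ (F.obj X).left
  isPullback (X : C) : IsPullback (π X) (F'.obj X).hom (F.obj X).hom
    (Spec.map (CommRingCat.ofHom (algebraMap K L)))
  naturality {X Y : C} (f : X ⟶ Y) : (F'.map f).left ≫ π Y = π X ≫ (F.map f).left

/-- The identity base change. -/
noncomputable def BaseChangeData.refl (F : C ⥤ SchemesOver K) : BaseChangeData (L := K) F F where
  π _ := 𝟙 _
  isPullback _ := by
    have : Spec.map (CommRingCat.ofHom (algebraMap K K)) = 𝟙 _ := Spec.map_id _
    rw [this]
    exact IsPullback.id_horiz _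
  naturality _ := by rw [Category.comp_id, Category.id_comp]

/-- The base change of distinguished varieties to an extension field. -/
noncomputable def BaseChangeData.baseChange (F : C ⥤ SchemesOver K) (L : Type u) [Field L] [Algebra K L] :
    BaseChangeData F (baseChange F L) where
  π X := schemeBaseChangeProj L (F.obj X)
  isPullback _ := IsPullback.of_hasPullback _ _
  naturality _ := pullback.lift_fst _ _ _

variable {F : C ⥤ SchemesOver K} {F' : C ⥤ SchemesOver L} (β : BaseChangeData F F')

namespace BaseChangeData

theorem morphismProperties (β : BaseChangeData F F') {X : C} (h : IsVariety (F.obj X)) :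
    LocallyOfFiniteType (F'.obj X).hom ∧ IsSeparated (F'.obj X).hom ∧
      QuasiCompact (F'.obj X).hom :=
  have := h.isSeparated
  have := h.locallyOfFiniteType
  have := h.quasiCompact
  ⟨MorphismProperty.of_isPullback (β.isPullback X) inferInstance,
    MorphismProperty.of_isPullback (β.isPullback X) inferInstance,
    MorphismProperty.of_isPullback (β.isPullback X) inferInstance⟩

theorem isPullback_map {X Y : C} (f : X ⟶ Y) :
    IsPullback (β.π X) (F'.map f).left (F.map f).left (β.π Y) := by
  have h := β.isPullback X
  rw [← Over.w (F.map f), ← Over.w (F'.map f)] at h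
  exact IsPullback.of_bot h (β.naturality f).symm (β.isPullback Y)

theorem map_left_eq (β : BaseChangeData F F') {X Y : C} {f g : X ⟶ Y} (h : (F.map f).left = (F.map g).left) :
    (F'.map f).left = (F'.map g).left := by
  refine (β.isPullback Y).hom_ext ?_ ?_
  · rw [β.naturality, β.naturality, h]
  · rw [Over.w, Over.w]

theorem isDistinguishedProduct (β : BaseChangeData F F') {X Y P : C} {p : P ⟶ X} {q : P ⟶ Y}
    (h : IsDistinguishedProduct F p q) : IsDistinguishedProduct F' p q where
  isPullback := by
    have h₁ := (β.isPullback_map p).paste_horiz h.isPullback.flip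
    rw [← β.naturality, (β.isPullback X).w] at h₁
    exact (h₁.of_right (by rw [Over.w, Over.w]) (β.isPullback Y)).flip
  exists_lift := h.exists_lift

end BaseChangeData

end BaseChangeData

/-- The transcendence degree over the ground field of the residue field at a point. -/
noncomputable def pdim {C : Type v} [Category.{w} C] {K : Type u} [Field K] (F : C ⥤ SchemesOver K)
    {X : C} (x : (F.obj X).left) : ℕ :=
  (residueTrdeg (F.obj X).hom x).toNat

/-- The properties of a distinguished category that matter for unlikely intersections, in terms of
the points of the distinguished varieties and their dimensions only. -/
structure IsTame {C : Type v} [Category.{w} C] {K : Type u} [Field K] (F : C ⥤ SchemesOver K) :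
    Prop where
  noetherianSpace (X : C) : NoetherianSpace (F.obj X).left
  irreducibleSpace (X : C) : IrreducibleSpace (F.obj X).left
  pdim_lt {X : C} {x y : (F.obj X).left} (h : x ⤳ y) (hne : x ≠ y) : pdim F y < pdim F x
  dim_closure {X : C} (x : (F.obj X).left) : dim (closure {x}) = pdim F x
  isRationalPoint_iff {X : C} (x : (F.obj X).left) :
    IsRationalPoint (F.obj X) x ↔ pdim F x = 0
  isClosed_range {X Y : C} (f : X ⟶ Y) : IsClosed (Set.range (F.map f).left)
  exists_product (X Y : C) : ∃ (P : C) (p : P ⟶ X) (q : P ⟶ Y),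
    (∀ (W : C) (φ : W ⟶ X) (ψ : W ⟶ Y), ∃ χ : W ⟶ P, χ ≫ p = φ ∧ χ ≫ q = ψ) ∧
    ∀ z : (F.obj Y).left, pdim F z = 0 → ∃ s : (F.obj X).left → (F.obj P).left,
      Continuous s ∧ (∀ x, (F.map p).left (s x) = x) ∧ (∀ x, (F.map q).left (s x) = z) ∧
      (∀ c, (F.map q).left c = z → c = s ((F.map p).left c)) ∧ ∀ x, pdim F (s x) = pdim F x
  exists_fiberProduct {X Y Z : C} (φ : X ⟶ Z) (ψ : Y ⟶ Z) :
    ∃ (n : ℕ) (A : Fin n → C) (a : ∀ i, A i ⟶ X) (b : ∀ i, A i ⟶ Y),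
      (∀ i c, (F.map φ).left ((F.map (a i)).left c) = (F.map ψ).left ((F.map (b i)).left c)) ∧
      ∀ x y, (F.map φ).left x = (F.map ψ).left y →
        ∃ i c, (F.map (a i)).left c = x ∧ (F.map (b i)).left c = y
  exists_factorization {X Y : C} (φ : X ⟶ Y) : ∃ (W Z : C) (φ₁ : W ⟶ X) (φ₂ : W ⟶ Z) (φ₃ : Z ⟶ Y),
    φ₁ ≫ φ = φ₂ ≫ φ₃ ∧ Function.Surjective (F.map φ₁).left ∧
    (∀ w, pdim F ((F.map φ₁).left w) = pdim F w) ∧ HasFiniteFibers (F.map φ₃) ∧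
    (∀ z, pdim F ((F.map φ₃).left z) = pdim F z) ∧
    (∀ z ∈ Set.range (F.map φ₂).left, pdim F z = 0 → IsIrreducible ((F.map φ₂).left ⁻¹' {z})) ∧
    ∃ e : ℕ, (∀ w, pdim F w ≤ pdim F ((F.map φ₂).left w) + e) ∧
      ∀ z ∈ Set.range (F.map φ₂).left, ∃ w, (F.map φ₂).left w = z ∧ pdim F w = pdim F z + e
  pdim_map_eq {X Y : C} (φ : X ⟶ Y) (h : HasFiniteFibers (F.map φ)) (x : (F.obj X).left) :
    pdim F ((F.map φ).left x) = pdim F x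
  exists_isOpen {X Y : C} (φ : X ⟶ Y) (x : (F.obj X).left) : ∃ O : Set (F.obj X).left,
    IsOpen O ∧ x ∈ O ∧ ∀ y ∈ O, x ⤳ y →
      pdim F y + pdim F ((F.map φ).left x) ≤ pdim F x + pdim F ((F.map φ).left y)
  exists_point : ∃ (T : C) (t : (F.obj T).left), pdim F t = 0 ∧ (∀ t', t' = t) ∧
    ∀ X : C, Nonempty (X ⟶ T)

/-! ### Rational points and dimensions. -/

section Basic

variable {C : Type v} [Category.{w} C] {K : Type u} [Field K] {F : C ⥤ SchemesOver K}

theorem map_comp_apply {X Y Z : C} (f : X ⟶ Y) (g : Y ⟶ Z) (x : (F.obj X).left) :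
    (F.map (f ≫ g)).left x = (F.map g).left ((F.map f).left x) := by
  simp

theorem map_id_apply {X : C} (x : (F.obj X).left) : (F.map (𝟙 X)).left x = x := by
  simp

theorem coe_pdim {X : C} [LocallyOfFiniteType (F.obj X).hom] (x : (F.obj X).left) :
    (pdim F x : ℕ∞) = residueTrdeg (F.obj X).hom x :=
  ENat.natCast_toNat (residueTrdeg_ne_top _ _)

theorem residueTrdeg_map_add_pdim {X Y : C} [LocallyOfFiniteType (F.obj X).hom]
    [LocallyOfFiniteType (F.obj Y).hom] (f : X ⟶ Y) (x : (F.obj X).left) :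
    residueTrdeg (F.map f).left x + pdim F ((F.map f).left x) = pdim F x := by
  rw [coe_pdim, coe_pdim, ← residueTrdeg_comp, Over.w]

/-- A proper specialization would have negative dimension, so a point of dimension zero is closed
and the Nullstellensatz makes it rational. -/
theorem isRationalPoint_iff_pdim_eq_zero [IsAlgClosed K] {X : C}
    [LocallyOfFiniteType (F.obj X).hom] (x : (F.obj X).left) :
    IsRationalPoint (F.obj X) x ↔ pdim F x = 0 := by
  constructor
  · rintro ⟨s, hs⟩
    obtain ⟨t, ht⟩ : x ∈ Set.range s.left := hs ▸ rfl
    have h := residueTrdeg_comp s.left (F.obj X).hom t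
    have e : s.left ≫ (F.obj X).hom = 𝟙 _ := Over.w s
    rw [e, residueTrdeg_eq_zero_of_surjectiveOnStalks] at h
    have h' := (add_eq_zero.mp h.symm).2
    rw [ht] at h'
    rw [pdim, h']
    rfl
  · intro h
    have hx : IsClosed {x} := by
      refine closure_subset_iff_isClosed.mp fun y hy => ?_
      by_contra hne
      have h' := residueTrdeg_lt_of_specializes (F.obj X).hom (specializes_iff_mem_closure.mpr hy)
        (fun e => hne e.symm)
      rw [← coe_pdim, ← coe_pdim, h] at h'
      exact absurd h' (by simp)
    refine ⟨Over.homMk (pointOfClosedPoint (F.obj X).hom x hx) (pointOfClosedPoint_comp _ _ _), ?_⟩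
    ext y
    constructor
    · rintro ⟨t, rfl⟩
      exact pointOfClosedPoint_apply _ _ hx t
    · rintro rfl
      exact ⟨IsLocalRing.closedPoint K, pointOfClosedPoint_apply _ _ hx _⟩

end Basic


/-! ### Transfer of the axioms to the base change. -/

section Tame

variable {C : Type v} [Category.{w} C] {K L : Type u} [Field K] [Field L] [Algebra K L]
  {F : C ⥤ SchemesOver K} {F' : C ⥤ SchemesOver L}

theorem quasiCompact_map {X Y : C} (f : X ⟶ Y) [QuasiCompact (F.obj X).hom]
    [IsSeparated (F.obj Y).hom] : QuasiCompact (F.map f).left := by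
  have : QuasiCompact ((F.map f).left ≫ (F.obj Y).hom) := by rwa [Over.w]
  exact QuasiCompact.of_comp _ (F.obj Y).hom

theorem locallyOfFiniteType_map {X Y : C} (f : X ⟶ Y) [LocallyOfFiniteType (F.obj X).hom] :
    LocallyOfFiniteType (F.map f).left := by
  have : LocallyOfFiniteType ((F.map f).left ≫ (F.obj Y).hom) := by rwa [Over.w]
  exact locallyOfFiniteType_of_comp _ (F.obj Y).hom

theorem noetherianSpace_obj (X : C) [LocallyOfFiniteType (F.obj X).hom]
    [QuasiCompact (F.obj X).hom] : NoetherianSpace (F.obj X).left := by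
  have : IsLocallyNoetherian (F.obj X).left := LocallyOfFiniteType.isLocallyNoetherian (F.obj X).hom
  have : CompactSpace (F.obj X).left := (quasiCompact_iff_compactSpace (F.obj X).hom).mp ‹_›
  have : IsNoetherian (F.obj X).left := {}
  infer_instance

theorem pdim_map_eq_of_finite {X Y : C} (f : X ⟶ Y) [LocallyOfFiniteType (F.obj X).hom]
    [QuasiCompact (F.obj X).hom] [IsSeparated (F.obj Y).hom] [LocallyOfFiniteType (F.obj Y).hom]
    (h : HasFiniteFibers (F.map f)) (x : (F.obj X).left) :
    pdim F ((F.map f).left x) = pdim F x := by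
  have := quasiCompact_map (F := F) f
  have := locallyOfFiniteType_map (F := F) f
  have h' := residueTrdeg_map_add_pdim (F := F) f x
  rw [residueTrdeg_eq_zero_of_finite_preimage _ h, zero_add] at h'
  exact_mod_cast h'

/-- The base change of a product by a point of one factor is a section. -/
theorem exists_section {X Y P : C} [IsAlgClosed K] [LocallyOfFiniteType (F.obj Y).hom]
    [LocallyOfFiniteType (F.obj X).hom] [LocallyOfFiniteType (F.obj P).hom]
    {p : P ⟶ X} {q : P ⟶ Y} (h : IsDistinguishedProduct F p q) {z : (F.obj Y).left}
    (hz : pdim F z = 0) : ∃ s : (F.obj X).left → (F.obj P).left,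
      Continuous s ∧ (∀ x, (F.map p).left (s x) = x) ∧ (∀ x, (F.map q).left (s x) = z) ∧
      (∀ c, (F.map q).left c = z → c = s ((F.map p).left c)) ∧ ∀ x, pdim F (s x) = pdim F x := by
  obtain ⟨σ, hσ', hσ⟩ : ∃ σ : Spec (.of K) ⟶ (F.obj Y).left, σ ≫ (F.obj Y).hom = 𝟙 _ ∧
      Set.range σ = {z} := by
    obtain ⟨σ, hσ⟩ := (isRationalPoint_iff_pdim_eq_zero z).mpr hz
    exact ⟨σ.left, Over.w σ, hσ⟩
  let s := h.isPullback.lift (𝟙 _) ((F.obj X).hom ≫ σ) (by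
    rw [Category.assoc, hσ', Category.id_comp, Category.comp_id])
  have hp : s ≫ (F.map p).left = 𝟙 _ := h.isPullback.lift_fst _ _ _
  have hq : s ≫ (F.map q).left = (F.obj X).hom ≫ σ := h.isPullback.lift_snd _ _ _
  have hpx (x) : (F.map p).left (s x) = x := by
    rw [← Scheme.Hom.comp_apply, hp]; rfl
  have hs : IsPullback s (F.obj X).hom (F.map q).left σ := by
    refine IsPullback.of_right (h₁₂ := (F.map p).left) (v₁₃ := (F.obj X).hom)
      (h₂₂ := (F.obj Y).hom) ?_ hq h.isPullback
    rw [hp, hσ']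
    exact IsPullback.of_horiz_isIso ⟨by rw [Category.id_comp, Category.comp_id]⟩
  refine ⟨s, s.continuous, hpx, fun x => ?_, fun c hc => ?_, fun x => ?_⟩
  · have h' : σ ((F.obj X).hom x) ∈ Set.range σ := ⟨_, rfl⟩
    rw [← Scheme.Hom.comp_apply, hq, Scheme.Hom.comp_apply]
    rwa [hσ] at h'
  · obtain ⟨t, ht⟩ : z ∈ Set.range σ := hσ ▸ rfl
    obtain ⟨x, rfl, -⟩ := Scheme.exists_preimage_of_isPullback hs c t (hc.trans ht.symm)
    rw [hpx]
  · have h₁ := residueTrdeg_comp s (F.map p).left x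
    rw [hp, residueTrdeg_eq_zero_of_surjectiveOnStalks] at h₁
    have h₂ := residueTrdeg_comp s (F.obj P).hom x
    rw [(add_eq_zero.mp h₁.symm).1, zero_add, ← Over.w (F.map p), ← Category.assoc, hp,
      Category.id_comp] at h₂
    rw [pdim, pdim, h₂, ← Over.w (F.map p)]

/-- The constant local dimension bounds all residue transcendence degrees and is attained at the
generic point of each fibre; in particular it is finite. -/
theorem exists_finite_residueTrdeg_le {W Z : Scheme.{u}} [Nonempty W] (φ : W ⟶ Z) [LocallyOfFiniteType φ]
    (h : ∀ z ∈ Set.range φ, IsIrreducible (φ ⁻¹' {z})) {n : WithBot ℕ∞}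
    (hn : ∀ w, localDim (φ ⁻¹' {φ w}) w = n) : ∃ e : ℕ, (∀ w, residueTrdeg φ w ≤ e) ∧
      ∀ z ∈ Set.range φ, ∃ w, φ w = z ∧ residueTrdeg φ w = e := by
  have h₁ (w) : (residueTrdeg φ w : WithBot ℕ∞) ≤ n := hn w ▸ residueTrdeg_le_localDim φ w
  have h₂ (z) (hz : z ∈ Set.range φ) : ∃ w, φ w = z ∧ (residueTrdeg φ w : WithBot ℕ∞) = n := by
    obtain ⟨w, rfl, hw⟩ := exists_forall_localDim_le φ (h z hz)
    exact ⟨w, rfl, (h₁ w).antisymm (hn w ▸ hw w)⟩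
  obtain ⟨w, -, hw⟩ := h₂ _ ⟨Classical.arbitrary W, rfl⟩
  have hw' := ENat.natCast_toNat (residueTrdeg_ne_top φ w)
  rw [← hw] at h₁ h₂
  refine ⟨(residueTrdeg φ w).toNat, ?_, ?_⟩
  · rw [hw']
    exact fun v => WithBot.coe_le_coe.mp (h₁ v)
  · rw [hw']
    exact fun z hz => (h₂ z hz).imp fun v hv => ⟨hv.1, WithBot.coe_injective hv.2⟩

variable [IsAlgClosed K]

namespace BaseChangeData

theorem irreducibleSpace (β : BaseChangeData F F') (hF : IsDistinguished F) (X : C) :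
    IrreducibleSpace (F'.obj X).left := by
  have := (hF.isVariety X).isIntegral
  have := (hF.isVariety X).locallyOfFiniteType
  have := (hF.isVariety X).quasiCompact
  have h := β.isPullback X
  obtain ⟨p, -⟩ := Scheme.exists_preimage_of_isPullback h (genericPoint (F.obj X).left)
    (IsLocalRing.closedPoint L) (Subsingleton.elim _ _)
  have : Nonempty (F'.obj X).left := ⟨p⟩
  refine irreducibleSpace_of_isPullback _ (𝟙 _) (fun z _ _ => ?_) h
  have : (F.obj X).hom ⁻¹' {z} = Set.univ := Set.eq_univ_of_forall fun _ => Subsingleton.elim _ _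
  rw [this]
  exact IrreducibleSpace.isIrreducible_univ _

/-- The canonical map from the fibre product is compatible with base change, and so are images of
morphisms, so the covering of points over `K` pulls back to `L`. -/
theorem exists_fiberProduct (β : BaseChangeData F F') (hF : IsDistinguished F) {X Y Z : C}
    (φ : X ⟶ Z) (ψ : Y ⟶ Z) :
    ∃ (n : ℕ) (A : Fin n → C) (a : ∀ i, A i ⟶ X) (b : ∀ i, A i ⟶ Y),
      (∀ i c, (F'.map φ).left ((F'.map (a i)).left c) =
        (F'.map ψ).left ((F'.map (b i)).left c)) ∧
      ∀ x y, (F'.map φ).left x = (F'.map ψ).left y →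
        ∃ i c, (F'.map (a i)).left c = x ∧ (F'.map (b i)).left c = y := by
  obtain ⟨P, p, q, h⟩ := hF.directProducts X Y
  obtain ⟨n, A, α, hα⟩ := hF.fiberedProducts X Y Z P φ ψ p q h
  have hp : h.fiberProductMap φ ψ ≫ (F.map p).left = pullback.fst _ _ :=
    h.isPullback.lift_fst _ _ _
  have hq : h.fiberProductMap φ ψ ≫ (F.map q).left = pullback.snd _ _ :=
    h.isPullback.lift_snd _ _ _
  refine ⟨n, A, fun i => α i ≫ p, fun i => α i ≫ q, fun i c => ?_, fun x y hxy => ?_⟩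
  · rw [← map_comp_apply, ← map_comp_apply]
    refine congrArg (fun f : (F'.obj (A i)).left ⟶ (F'.obj Z).left => f c) (β.map_left_eq ?_)
    have := (hF.isVariety (A i)).isIntegral
    have := (hF.isVariety (A i)).locallyOfFiniteType
    have := (hF.isVariety Z).isSeparated
    have := (hF.isVariety Z).locallyOfFiniteType
    have : LocallyOfFiniteType ((F.map ((α i ≫ p) ≫ φ)).left ≫ (F.obj Z).hom) := by
      rwa [Over.w]
    -- The axiom is only about underlying sets, but over an algebraically closed field morphisms of
    -- varieties that agree on closed points are equal, and this equality base changes.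
    refine ext_of_apply_eq (F.obj Z).hom Set.univ isOpen_univ.isLocallyClosed dense_univ ?_ ?_
    · intro x _ _
      obtain ⟨t, ht⟩ : (F.map (α i)).left x ∈ Set.range (h.fiberProductMap φ ψ) :=
        hα ▸ Set.mem_iUnion.mpr ⟨i, x, rfl⟩
      have hpt : (F.map p).left (h.fiberProductMap φ ψ t) =
          pullback.fst (F.map φ).left (F.map ψ).left t := by
        rw [← Scheme.Hom.comp_apply, hp]
      have hqt : (F.map q).left (h.fiberProductMap φ ψ t) =
          pullback.snd (F.map φ).left (F.map ψ).left t := by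
        rw [← Scheme.Hom.comp_apply, hq]
      simp only [map_comp_apply]
      rw [← ht, hpt, hqt, ← Scheme.Hom.comp_apply, ← Scheme.Hom.comp_apply, pullback.condition]
    · rw [Over.w, Over.w]
  · obtain ⟨t, ht₁, ht₂⟩ := Scheme.Pullback.exists_preimage_pullback x y hxy
    have h' := (β.isDistinguishedProduct h)
    have hp' : h'.fiberProductMap φ ψ ≫ (F'.map p).left = pullback.fst _ _ :=
      h'.isPullback.lift_fst _ _ _
    have hq' : h'.fiberProductMap φ ψ ≫ (F'.map q).left = pullback.snd _ _ :=
      h'.isPullback.lift_snd _ _ _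
    let g : pullback (F'.map φ).left (F'.map ψ).left ⟶ pullback (F.map φ).left (F.map ψ).left :=
      pullback.map _ _ _ _ (β.π X) (β.π Y) (β.π Z) (β.naturality φ) (β.naturality ψ)
    have hg : h'.fiberProductMap φ ψ ≫ β.π P = g ≫ h.fiberProductMap φ ψ := by
      refine h.isPullback.hom_ext ?_ ?_
      · rw [Category.assoc, Category.assoc, ← β.naturality, ← Category.assoc, hp, hp',
          pullback.lift_fst]
      · rw [Category.assoc, Category.assoc, ← β.naturality, ← Category.assoc, hq, hq',
          pullback.lift_snd]
    have ht : β.π P (h'.fiberProductMap φ ψ t) ∈ ⋃ i, Set.range (F.map (α i)).left := by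
      rw [hα, ← Scheme.Hom.comp_apply, hg]
      exact ⟨g t, rfl⟩
    obtain ⟨i, a, ha⟩ := Set.mem_iUnion.mp ht
    obtain ⟨c, -, hc⟩ := Scheme.exists_preimage_of_isPullback (β.isPullback_map (α i)) a _ ha
    replace hc : (F'.map (α i)).left c = h'.fiberProductMap φ ψ t := hc
    refine ⟨i, c, ?_, ?_⟩
    · rw [map_comp_apply, hc, ← Scheme.Hom.comp_apply, hp', ht₁]
    · rw [map_comp_apply, hc, ← Scheme.Hom.comp_apply, hq', ht₂]

theorem exists_factorization [IsAlgClosed L] (β : BaseChangeData F F') (hF : IsDistinguished F)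
    {X Y : C} (φ : X ⟶ Y) :
    ∃ (W Z : C) (φ₁ : W ⟶ X) (φ₂ : W ⟶ Z) (φ₃ : Z ⟶ Y),
    φ₁ ≫ φ = φ₂ ≫ φ₃ ∧ Function.Surjective (F'.map φ₁).left ∧
    (∀ w, pdim F' ((F'.map φ₁).left w) = pdim F' w) ∧ HasFiniteFibers (F'.map φ₃) ∧
    (∀ z, pdim F' ((F'.map φ₃).left z) = pdim F' z) ∧
    (∀ z ∈ Set.range (F'.map φ₂).left, pdim F' z = 0 →
      IsIrreducible ((F'.map φ₂).left ⁻¹' {z})) ∧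
    ∃ e : ℕ, (∀ w, pdim F' w ≤ pdim F' ((F'.map φ₂).left w) + e) ∧
      ∀ z ∈ Set.range (F'.map φ₂).left, ∃ w, (F'.map φ₂).left w = z ∧
        pdim F' w = pdim F' z + e := by
  obtain ⟨W, Z, φ₁, φ₂, φ₃, hφ, h₁, h₁', h₃, h₂, n, hn⟩ := hF.fiberDimension X Y φ
  have hl (X) : LocallyOfFiniteType (F.obj X).hom := (hF.isVariety X).locallyOfFiniteType
  have hs (X) : IsSeparated (F.obj X).hom := (hF.isVariety X).isSeparated
  have hc (X) : QuasiCompact (F.obj X).hom := (hF.isVariety X).quasiCompact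
  have hl' (X) : LocallyOfFiniteType (F'.obj X).hom := (β.morphismProperties (hF.isVariety X)).1
  have hs' (X) : IsSeparated (F'.obj X).hom := (β.morphismProperties (hF.isVariety X)).2.1
  have hc' (X) : QuasiCompact (F'.obj X).hom := (β.morphismProperties (hF.isVariety X)).2.2
  have hml {X Y : C} (f : X ⟶ Y) := locallyOfFiniteType_map (F := F) f
  have hmc {X Y : C} (f : X ⟶ Y) := quasiCompact_map (F := F) f
  have hml' {X Y : C} (f : X ⟶ Y) := locallyOfFiniteType_map (F := F') f
  have hmc' {X Y : C} (f : X ⟶ Y) := quasiCompact_map (F := F') f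
  have hfin : IsFinite (F'.map φ₁).left :=
    MorphismProperty.of_isPullback (β.isPullback_map φ₁).flip.flip h₁
  have hsurj : Surjective (F'.map φ₁).left :=
    MorphismProperty.of_isPullback (β.isPullback_map φ₁).flip.flip h₁'
  have hqf : LocallyQuasiFinite (F.map φ₃).left :=
    LocallyQuasiFinite.of_finite_preimage_singleton _ h₃
  have hqf' : LocallyQuasiFinite (F'.map φ₃).left :=
    MorphismProperty.of_isPullback (β.isPullback_map φ₃).flip.flip hqf
  have h₃' : HasFiniteFibers (F'.map φ₃) := fun y =>
    Scheme.Hom.finite_preimage_singleton _ y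
  have hW := (hF.isVariety W).isIntegral
  obtain ⟨e, he, he'⟩ := exists_finite_residueTrdeg_le (F.map φ₂).left h₂ hn
  refine ⟨W, Z, φ₁, φ₂, φ₃, hφ, hsurj.surj, fun w => pdim_map_eq_of_finite φ₁ (fun y =>
    Scheme.Hom.finite_preimage_singleton _ y) w, h₃', pdim_map_eq_of_finite φ₃ h₃', ?_, e, ?_, ?_⟩
  · rintro z ⟨w, hw⟩ hz
    obtain ⟨σ, hσ⟩ := (isRationalPoint_iff_pdim_eq_zero z).mpr hz
    have hQ := (IsPullback.of_hasPullback (F'.map φ₂).left σ.left)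
    have hne : Nonempty ↥(pullback (F'.map φ₂).left σ.left) := by
      obtain ⟨t, ht⟩ : z ∈ Set.range σ.left := hσ ▸ rfl
      obtain ⟨q, -⟩ := Scheme.Pullback.exists_preimage_pullback w t (hw.trans ht.symm)
      exact ⟨q⟩
    -- A rational point over `L` need not come from `K`; its fibre is a fibre of the morphism over
    -- `K` at an `L`-valued point.
    have := irreducibleSpace_of_isPullback (F.map φ₂).left (F.obj Z).hom
      (fun z hz _ => h₂ z hz) (hQ.paste_horiz (β.isPullback_map φ₂))
    rw [← hσ, ← Scheme.Pullback.range_fst]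
    rw [← Set.image_univ]
    exact (IrreducibleSpace.isIrreducible_univ _).image _
      (pullback.fst (F'.map φ₂).left σ.left).continuous.continuousOn
  · intro w
    have h := residueTrdeg_map_add_pdim (F := F') φ₂ w
    have h' : residueTrdeg (F'.map φ₂).left w ≤ e :=
      (residueTrdeg_snd_le (β.isPullback_map φ₂) w).trans (he _)
    have : (pdim F' w : ℕ∞) ≤ e + pdim F' ((F'.map φ₂).left w) := h ▸ by gcongr
    rw [add_comm]
    exact_mod_cast this
  · rintro z ⟨w, rfl⟩
    obtain ⟨v, hv, hv'⟩ := he' (β.π Z ((F'.map φ₂).left w)) ⟨β.π W w, by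
      rw [← Scheme.Hom.comp_apply, ← β.naturality, Scheme.Hom.comp_apply]⟩
    -- The maximal fibre dimension is attained over `K` and can be kept under base change over the
    -- prescribed point.
    obtain ⟨p, rfl, hp, hp'⟩ := exists_residueTrdeg_le_residueTrdeg_snd (β.isPullback_map φ₂) hv
    refine ⟨p, hp, ?_⟩
    have h' : residueTrdeg (F'.map φ₂).left p = e :=
      ((residueTrdeg_snd_le (β.isPullback_map φ₂) p).trans (he _)).antisymm (hv' ▸ hp')
    have h := residueTrdeg_map_add_pdim (F := F') φ₂ p
    rw [h', hp, add_comm] at h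
    exact_mod_cast h.symm

theorem isTame [IsAlgClosed L] (β : BaseChangeData F F') (hF : IsDistinguished F) : IsTame F' := by
  have hl (X) : LocallyOfFiniteType (F'.obj X).hom := (β.morphismProperties (hF.isVariety X)).1
  have hs (X) : IsSeparated (F'.obj X).hom := (β.morphismProperties (hF.isVariety X)).2.1
  have hc (X) : QuasiCompact (F'.obj X).hom := (β.morphismProperties (hF.isVariety X)).2.2
  refine
  { noetherianSpace X := noetherianSpace_obj X
    irreducibleSpace := β.irreducibleSpace hF
    pdim_lt {X x y} h hne := ?_
    dim_closure {X} x := ?_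
    isRationalPoint_iff := isRationalPoint_iff_pdim_eq_zero
    isClosed_range {X Y} f := ?_
    exists_product X Y := ?_
    exists_fiberProduct := β.exists_fiberProduct hF
    exists_factorization := β.exists_factorization hF
    pdim_map_eq φ h x := pdim_map_eq_of_finite φ h x
    exists_isOpen {X Y} φ x := ?_
    exists_point := ?_ }
  · have h' := residueTrdeg_lt_of_specializes (F'.obj X).hom h hne
    rw [← coe_pdim, ← coe_pdim] at h'
    exact_mod_cast h'
  · rw [dim, topologicalKrullDim_closure_singleton (F'.obj X).hom]
    rfl
  · have h := Scheme.image_preimage_eq_of_isPullback (β.isPullback_map f) Set.univ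
    have h' : Set.range (F'.map f).left = β.π Y ⁻¹' Set.range (F.map f).left := by
      rw [← Set.image_univ, ← Set.image_univ]
      exact h
    rw [h']
    exact (hF.isClosed_range _ _ f).preimage (β.π Y).continuous
  · obtain ⟨P, p, q, h⟩ := hF.directProducts X Y
    exact ⟨P, p, q, h.exists_lift, fun z => exists_section (β.isDistinguishedProduct h)⟩
  · have := locallyOfFiniteType_map (F := F') φ
    obtain ⟨O, hO, hx, h⟩ := exists_isOpen_forall_residueTrdeg_le (F'.map φ).left x
    refine ⟨O, hO, hx, fun y hy hxy => ?_⟩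
    have h' := h y hy hxy
    have h₁ := residueTrdeg_map_add_pdim (F := F') φ x
    have h₂ := residueTrdeg_map_add_pdim (F := F') φ y
    have h₃ : (pdim F' y + pdim F' ((F'.map φ).left x) : ℕ∞) ≤
        pdim F' x + pdim F' ((F'.map φ).left y) := by
      rw [← h₁, ← h₂, add_right_comm, add_assoc, add_assoc, add_comm (pdim F' _ : ℕ∞)]
      gcongr
    exact_mod_cast h₃
  · obtain ⟨T, ⟨hT⟩, ⟨i⟩⟩ := hF.finalObject
    have : IsIso (F.obj T).hom := by
      have h : i.hom.left = (F.obj T).hom := (Category.comp_id _).symm.trans (Over.w i.hom)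
      have h' : IsIso i.hom.left := inferInstanceAs (IsIso ((Over.forget _).map i.hom))
      exact h ▸ h'
    have := (β.isPullback T).isIso_snd_of_isIso
    have e (x y : (F'.obj T).left) : x = y :=
      (F'.obj T).hom.homeomorph.injective (Subsingleton.elim _ _)
    obtain ⟨t, -⟩ := (F'.obj T).hom.homeomorph.surjective (IsLocalRing.closedPoint L)
    refine ⟨T, t, ?_, fun t' => e _ _, fun X => ⟨hT.from X⟩⟩
    rw [pdim, residueTrdeg_eq_zero_of_surjectiveOnStalks]
    rfl

end BaseChangeData

end Tame


/-! ### Special and weakly special hulls, and the defect condition. -/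

section Hulls

variable {C : Type v} [Category.{w} C] {K : Type u} [Field K] {F : C ⥤ SchemesOver K}

/-- The generic point of a special subvariety. -/
def IsSpecialPoint (F : C ⥤ SchemesOver K) {X : C} (a : (F.obj X).left) : Prop :=
  ∃ (Y : C) (φ : Y ⟶ X), ∀ x, x ∈ Set.range (F.map φ).left ↔ a ⤳ x

/-- The generic point of a weakly special subvariety `φ(ψ⁻¹(z))` with `ψ⁻¹(z)` irreducible. -/
def IsWeaklySpecialPoint (F : C ⥤ SchemesOver K) {X : C} (a : (F.obj X).left) : Prop :=
  ∃ (Y Z : C) (φ : Z ⟶ X) (ψ : Z ⟶ Y) (z : (F.obj Y).left), pdim F z = 0 ∧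
    ∀ x, x ∈ imageOfFiber F φ ψ z ↔ a ⤳ x

namespace IsTame

theorem pdim_le (hF : IsTame F) {X : C} {x y : (F.obj X).left} (h : x ⤳ y) :
    pdim F y ≤ pdim F x := by
  rcases eq_or_ne x y with rfl | hne
  · exact le_rfl
  · exact (hF.pdim_lt h hne).le

theorem eq_of_specializes (hF : IsTame F) {X : C} {x y : (F.obj X).left} (h : x ⤳ y)
    (hle : pdim F x ≤ pdim F y) : x = y :=
  by_contra fun hne => (hF.pdim_lt h hne).not_ge hle

theorem exists_generic (hF : IsTame F) (X : C) : ∃ g : (F.obj X).left, ∀ x, g ⤳ x := by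
  have := hF.irreducibleSpace X
  exact ⟨genericPoint _, fun x => (genericPoint_spec _).specializes trivial⟩

theorem isSpecialPoint_map (hF : IsTame F) {X Y : C} (φ : X ⟶ Y) {a : (F.obj X).left}
    (ha : IsSpecialPoint F a) : IsSpecialPoint F ((F.map φ).left a) := by
  obtain ⟨Z, χ, hχ⟩ := ha
  refine ⟨Z, χ ≫ φ, fun y => ⟨?_, fun h => ?_⟩⟩
  · rintro ⟨c, rfl⟩
    rw [map_comp_apply]
    exact ((hχ _).mp ⟨c, rfl⟩).map (F.map φ).left.continuous
  · obtain ⟨c, hc⟩ := (hχ a).mpr specializes_rfl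
    refine h.mem_closed (hF.isClosed_range _) ⟨c, ?_⟩
    rw [map_comp_apply, hc]

theorem isSpecialPoint_generic {X : C} {g : (F.obj X).left} (hg : ∀ x, g ⤳ x) :
    IsSpecialPoint F g :=
  ⟨X, 𝟙 X, fun x => ⟨fun _ => hg x, fun _ => ⟨x, map_id_apply x⟩⟩⟩

/-- A point of minimal dimension is least, since by `h₂` it has a common specialization with any
competitor and by minimality equals it. -/
theorem exists_isLeast (hF : IsTame F) {X : C} (Q : (F.obj X).left → Prop) (x : (F.obj X).left)
    (h₁ : ∃ a, Q a ∧ a ⤳ x)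
    (h₂ : ∀ a b, Q a → Q b → a ⤳ x → b ⤳ x → ∃ c, Q c ∧ c ⤳ x ∧ a ⤳ c ∧ b ⤳ c) :
    ∃ a, (Q a ∧ a ⤳ x) ∧ ∀ b, Q b → b ⤳ x → b ⤳ a := by
  obtain ⟨a, ⟨ha, hax⟩, hmin⟩ := exists_minimalFor_of_wellFoundedLT
    (fun a => Q a ∧ a ⤳ x) (fun a => pdim F a) h₁
  refine ⟨a, ⟨ha, hax⟩, fun b hb hbx => ?_⟩
  obtain ⟨c, hc, hcx, hac, hbc⟩ := h₂ a b ha hb hax hbx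
  rwa [hF.eq_of_specializes hac (hmin ⟨hc, hcx⟩ (hF.pdim_le hac))]

/-- The intersection of two special subvarieties is covered by images from their fibre product; the
piece through `x` is again special. -/
theorem exists_specialHull (hF : IsTame F) {X : C} (x : (F.obj X).left) :
    ∃ a, (IsSpecialPoint F a ∧ a ⤳ x) ∧ ∀ b, IsSpecialPoint F b → b ⤳ x → b ⤳ a := by
  refine hF.exists_isLeast _ x ?_ ?_
  · obtain ⟨g, hg⟩ := hF.exists_generic X
    exact ⟨g, isSpecialPoint_generic hg, hg x⟩
  · rintro a b ⟨A, φ, hφ⟩ ⟨B, ψ, hψ⟩ hax hbx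
    obtain ⟨u, hu⟩ := (hφ x).mpr hax
    obtain ⟨v, hv⟩ := (hψ x).mpr hbx
    obtain ⟨n, E, p, q, hpq, hcov⟩ := hF.exists_fiberProduct φ ψ
    obtain ⟨i, c, hc, -⟩ := hcov u v (hu.trans hv.symm)
    obtain ⟨g, hg⟩ := hF.exists_generic (E i)
    refine ⟨(F.map (p i ≫ φ)).left g, hF.isSpecialPoint_map _ (isSpecialPoint_generic hg),
      ?_, ?_, ?_⟩
    · rw [← hu, ← hc, ← map_comp_apply]
      exact (hg c).map (F.map (p i ≫ φ)).left.continuous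
    · exact (hφ _).mp ⟨_, (map_comp_apply _ _ _).symm⟩
    · exact (hψ _).mp ⟨_, (hpq _ _).symm.trans (map_comp_apply _ _ _).symm⟩

/-- The generic point of the smallest special subvariety containing a point. -/
noncomputable def sp (hF : IsTame F) {X : C} (x : (F.obj X).left) : (F.obj X).left :=
  (hF.exists_specialHull x).choose

theorem isSpecialPoint_sp (hF : IsTame F) {X : C} (x : (F.obj X).left) :
    IsSpecialPoint F (hF.sp x) :=
  (hF.exists_specialHull x).choose_spec.1.1

theorem sp_specializes (hF : IsTame F) {X : C} (x : (F.obj X).left) : hF.sp x ⤳ x :=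
  (hF.exists_specialHull x).choose_spec.1.2

theorem specializes_sp (hF : IsTame F) {X : C} {x b : (F.obj X).left} (hb : IsSpecialPoint F b)
    (h : b ⤳ x) : b ⤳ hF.sp x :=
  (hF.exists_specialHull x).choose_spec.2 b hb h

theorem sp_specializes_sp (hF : IsTame F) {X : C} {x y : (F.obj X).left} (h : x ⤳ y) :
    hF.sp x ⤳ hF.sp y :=
  hF.specializes_sp (hF.isSpecialPoint_sp x) ((hF.sp_specializes x).trans h)

/-- For the harder direction, the preimage of the hull of `φ x` is covered by finitely many special
subvarieties; the one through `x` contains the hull of `x`. -/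
theorem map_sp (hF : IsTame F) {X Y : C} (φ : X ⟶ Y) (x : (F.obj X).left) :
    (F.map φ).left (hF.sp x) = hF.sp ((F.map φ).left x) := by
  refine (Specializes.antisymm (hF.specializes_sp (hF.isSpecialPoint_map φ (hF.isSpecialPoint_sp x))
    ((hF.sp_specializes x).map (F.map φ).left.continuous)) ?_).eq
  obtain ⟨E, χ, hχ⟩ := hF.isSpecialPoint_sp ((F.map φ).left x)
  obtain ⟨e, he⟩ := (hχ _).mpr (hF.sp_specializes ((F.map φ).left x))
  obtain ⟨n, A, p, q, hpq, hcov⟩ := hF.exists_fiberProduct φ χ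
  obtain ⟨i, c, hc, -⟩ := hcov x e he.symm
  obtain ⟨g, hg⟩ := hF.exists_generic (A i)
  have h : (F.map (p i)).left g ⤳ hF.sp x :=
    hF.specializes_sp (hF.isSpecialPoint_map _ (isSpecialPoint_generic hg))
      (hc ▸ (hg c).map (F.map (p i)).left.continuous)
  obtain ⟨c', hc'⟩ := h.mem_closed (hF.isClosed_range (p i)) ⟨g, rfl⟩
  rw [← hc', hpq]
  exact (hχ _).mp ⟨_, rfl⟩

/-- The dimension of the fibres of a distinguished morphism. -/
theorem exists_fiberDim (hF : IsTame F) {X Y : C} (φ : X ⟶ Y) :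
    ∃ e : ℕ, (∀ x, pdim F x ≤ pdim F ((F.map φ).left x) + e) ∧
      ∀ y ∈ Set.range (F.map φ).left, ∃ x, (F.map φ).left x = y ∧ pdim F x = pdim F y + e := by
  obtain ⟨W, Z, φ₁, φ₂, φ₃, hφ, hs, h₁, -, h₃, -, e, he, he'⟩ := hF.exists_factorization φ
  have h (w) : (F.map φ).left ((F.map φ₁).left w) = (F.map φ₃).left ((F.map φ₂).left w) := by
    rw [← map_comp_apply, hφ, map_comp_apply]
  refine ⟨e, fun x => ?_, ?_⟩
  · obtain ⟨w, rfl⟩ := hs x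
    rw [h, h₃, h₁]
    exact he w
  · rintro y ⟨x, rfl⟩
    obtain ⟨w, rfl⟩ := hs x
    obtain ⟨w', hw, hw'⟩ := he' _ ⟨w, rfl⟩
    exact ⟨(F.map φ₁).left w', by rw [h, h, hw], by rw [h, h₁, h₃, hw']⟩

theorem pdim_generic (hF : IsTame F) {X Y : C} (φ : X ⟶ Y) {e : ℕ}
    (h₁ : ∀ x, pdim F x ≤ pdim F ((F.map φ).left x) + e)
    (h₂ : ∀ y ∈ Set.range (F.map φ).left, ∃ x, (F.map φ).left x = y ∧ pdim F x = pdim F y + e)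
    {g : (F.obj X).left} (hg : ∀ x, g ⤳ x) : pdim F g = pdim F ((F.map φ).left g) + e := by
  obtain ⟨x, hx, hx'⟩ := h₂ _ ⟨g, rfl⟩
  exact (h₁ g).antisymm (hx' ▸ hF.pdim_le (hg x))

/-- This is constancy of the fibre dimension of `φ` on the special subvariety `a`: no relative
dimension exceeds the generic one, and the generic one is reached over every point of the image. It
follows by comparing the constants `e₁`, `e₂` for `χ` and `χ ≫ φ` at the generic point of `E`. -/
theorem pdim_add_le (hF : IsTame F) {X Y : C} (φ : X ⟶ Y) {a : (F.obj X).left}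
    (ha : IsSpecialPoint F a) :
    (∀ x, a ⤳ x → pdim F x + pdim F ((F.map φ).left a) ≤ pdim F ((F.map φ).left x) + pdim F a) ∧
    ∀ y, (F.map φ).left a ⤳ y → ∃ x, a ⤳ x ∧ (F.map φ).left x = y ∧
      pdim F y + pdim F a ≤ pdim F x + pdim F ((F.map φ).left a) := by
  obtain ⟨E, χ, hχ⟩ := ha
  obtain ⟨e₁, h₁, h₁'⟩ := hF.exists_fiberDim χ
  obtain ⟨e₂, h₂, h₂'⟩ := hF.exists_fiberDim (χ ≫ φ)
  obtain ⟨g, hg⟩ := hF.exists_generic E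
  have hga : (F.map χ).left g = a := by
    obtain ⟨c, hc⟩ := (hχ a).mpr specializes_rfl
    refine (Specializes.antisymm ?_ ((hχ _).mp ⟨g, rfl⟩)).eq
    exact hc ▸ (hg c).map (F.map χ).left.continuous
  have k₁ := hF.pdim_generic χ h₁ h₁' hg
  have k₂ := hF.pdim_generic (χ ≫ φ) h₂ h₂' hg
  rw [map_comp_apply] at k₂
  rw [hga] at k₁ k₂
  constructor
  · intro x hx
    obtain ⟨c, rfl, hc'⟩ := h₁' _ ((hχ x).mpr hx)
    have := h₂ c
    rw [map_comp_apply] at this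
    omega
  · intro y hy
    obtain ⟨c, hc⟩ : y ∈ Set.range (F.map (χ ≫ φ)).left :=
      hy.mem_closed (hF.isClosed_range _) ⟨g, by rw [map_comp_apply, hga]⟩
    obtain ⟨c', hc', hd⟩ := h₂' y ⟨c, hc⟩
    refine ⟨(F.map χ).left c', (hχ _).mp ⟨c', rfl⟩, ?_, ?_⟩
    · rw [← map_comp_apply, hc']
    · have := h₁ c'
      omega

/-- The section `s` identifies `X` with `X × {z}`, and the set becomes a slice of the closed image
of `(φ, ψ)` in the product. -/
theorem isClosed_imageOfFiber (hF : IsTame F) {X Y Z : C} (φ : Z ⟶ X) (ψ : Z ⟶ Y)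
    {z : (F.obj Y).left} (hz : pdim F z = 0) : IsClosed (imageOfFiber F φ ψ z) := by
  obtain ⟨P, p, q, hl, hs⟩ := hF.exists_product X Y
  obtain ⟨s, hs, hp, hq, hsp, -⟩ := hs z hz
  obtain ⟨χ, rfl, rfl⟩ := hl Z φ ψ
  have h : imageOfFiber F (χ ≫ p) (χ ≫ q) z = s ⁻¹' Set.range (F.map χ).left := by
    ext x
    constructor
    · rintro ⟨c, hc, rfl⟩
      rw [Set.mem_preimage, Set.mem_singleton_iff, map_comp_apply] at hc
      refine ⟨c, ?_⟩
      rw [map_comp_apply]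
      exact hsp _ hc
    · rintro ⟨c, hc⟩
      refine ⟨c, ?_, ?_⟩
      · rw [Set.mem_preimage, Set.mem_singleton_iff, map_comp_apply, hc, hq]
      · rw [map_comp_apply, hc, hp]
  rw [h]
  exact (hF.isClosed_range χ).preimage hs

/-- Factoring `ψ` through a morphism with irreducible fibres cuts out of `ψ⁻¹(z)` an irreducible
piece whose image contains `x`. All fibres of `ψ` have the same dimension, whence the last clause
when `φ` is quasi-finite. -/
theorem exists_isWeaklySpecialPoint (hF : IsTame F) {X Y Z : C} (φ : Z ⟶ X) (ψ : Z ⟶ Y)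
    {z : (F.obj Y).left} (hz : pdim F z = 0) {x : (F.obj X).left}
    (hx : x ∈ imageOfFiber F φ ψ z) :
    ∃ a, IsWeaklySpecialPoint F a ∧ a ⤳ x ∧ a ∈ imageOfFiber F φ ψ z ∧
      (HasFiniteFibers (F.map φ) →
        ∀ c, pdim F c ≤ pdim F a + pdim F ((F.map ψ).left c)) := by
  obtain ⟨c, hc, rfl⟩ := hx
  obtain ⟨W, Z', φ₁, φ₂, φ₃, hφ, hs, h₁, -, h₃, hirr, e, he, he'⟩ := hF.exists_factorization ψ
  have h (w) : (F.map ψ).left ((F.map φ₁).left w) = (F.map φ₃).left ((F.map φ₂).left w) := by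
    rw [← map_comp_apply, hφ, map_comp_apply]
  obtain ⟨w, rfl⟩ := hs c
  have hw : (F.map φ₃).left ((F.map φ₂).left w) = z := (h w).symm.trans hc
  have hz' : pdim F ((F.map φ₂).left w) = 0 := by rw [← h₃, hw, hz]
  have hI := (hirr _ ⟨w, rfl⟩ hz').image (F.map (φ₁ ≫ φ)).left
    (F.map (φ₁ ≫ φ)).left.continuous.continuousOn
  have ha : ∀ x, x ∈ imageOfFiber F (φ₁ ≫ φ) φ₂ ((F.map φ₂).left w) ↔ hI.genericPoint ⤳ x := by
    intro x
    rw [specializes_iff_mem_closure,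
      hI.closure_genericPoint (hF.isClosed_imageOfFiber (φ₁ ≫ φ) φ₂ hz')]
    rfl
  obtain ⟨w', hw', haw⟩ := (ha _).mpr specializes_rfl
  refine ⟨hI.genericPoint, ⟨_, _, φ₁ ≫ φ, φ₂, _, hz', ha⟩,
    (ha _).mp ⟨w, rfl, map_comp_apply _ _ _⟩, ⟨(F.map φ₁).left w', ?_, ?_⟩, fun hφ c => ?_⟩
  · rw [Set.mem_preimage, h, hw', hw]
    rfl
  · rw [← map_comp_apply, haw]
  · obtain ⟨v, hv, hv'⟩ := he' _ ⟨w, rfl⟩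
    have h₄ := hF.pdim_le ((ha _).mp ⟨v, hv, rfl⟩)
    obtain ⟨y, rfl⟩ := hs c
    rw [map_comp_apply, hF.pdim_map_eq φ hφ, h₁, hv', hz'] at h₄
    have := he y
    rw [h, h₃, h₁]
    omega

theorem isWeaklySpecialPoint_of_isSpecialPoint (hF : IsTame F) {X : C} {a : (F.obj X).left}
    (ha : IsSpecialPoint F a) : IsWeaklySpecialPoint F a := by
  obtain ⟨E, χ, hχ⟩ := ha
  obtain ⟨T, t, ht, ht', hT⟩ := hF.exists_point
  obtain ⟨f⟩ := hT E
  refine ⟨T, E, χ, f, t, ht, fun x => Iff.trans ⟨?_, ?_⟩ (hχ x)⟩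
  · rintro ⟨c, -, rfl⟩
    exact ⟨c, rfl⟩
  · rintro ⟨c, rfl⟩
    exact ⟨c, ht' _, rfl⟩

/-- On a piece of the fibre product of `φ₁` and `φ₂`, the conditions over `z₁` and `z₂` together
describe a fibre of the morphism to `Y₁ × Y₂` over the point `s z₁ = (z₁, z₂)`; so two weakly
special subvarieties through `x` contain a common one. -/
theorem exists_weaklySpecialHull (hF : IsTame F) {X : C} (x : (F.obj X).left) :
    ∃ a, (IsWeaklySpecialPoint F a ∧ a ⤳ x) ∧
      ∀ b, IsWeaklySpecialPoint F b → b ⤳ x → b ⤳ a := by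
  refine hF.exists_isLeast _ x ⟨hF.sp x, hF.isWeaklySpecialPoint_of_isSpecialPoint
    (hF.isSpecialPoint_sp x), hF.sp_specializes x⟩ ?_
  rintro a b ⟨Y₁, Z₁, φ₁, ψ₁, z₁, hz₁, ha⟩ ⟨Y₂, Z₂, φ₂, ψ₂, z₂, hz₂, hb⟩ hax hbx
  obtain ⟨c₁, hc₁, h₁⟩ := (ha x).mpr hax
  obtain ⟨c₂, hc₂, h₂⟩ := (hb x).mpr hbx
  obtain ⟨n, A, f, g, hfg, hcov⟩ := hF.exists_fiberProduct φ₁ φ₂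
  obtain ⟨i, c, rfl, rfl⟩ := hcov c₁ c₂ (h₁.trans h₂.symm)
  obtain ⟨P, p, q, hl, hs⟩ := hF.exists_product Y₁ Y₂
  obtain ⟨s, hs, hp, hq, hsp, hsd⟩ := hs z₂ hz₂
  obtain ⟨ω, hω₁, hω₂⟩ := hl (A i) (f i ≫ ψ₁) (g i ≫ ψ₂)
  have e₁ (c) : (F.map p).left ((F.map ω).left c) = (F.map ψ₁).left ((F.map (f i)).left c) := by
    rw [← map_comp_apply, hω₁, map_comp_apply]
  have e₂ (c) : (F.map q).left ((F.map ω).left c) = (F.map ψ₂).left ((F.map (g i)).left c) := by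
    rw [← map_comp_apply, hω₂, map_comp_apply]
  have hx : x ∈ imageOfFiber F (f i ≫ φ₁) ω (s z₁) := by
    refine ⟨c, ?_, by rw [map_comp_apply, h₁]⟩
    rw [Set.mem_preimage, Set.mem_singleton_iff, hsp _ ((e₂ c).trans hc₂), e₁]
    exact congrArg s hc₁
  obtain ⟨a', ha', ha'x, ⟨c', hc', hac⟩, -⟩ :=
    hF.exists_isWeaklySpecialPoint _ _ ((hsd z₁).trans hz₁) hx
  rw [map_comp_apply] at hac
  replace hc' : (F.map ω).left c' = s z₁ := hc'
  refine ⟨a', ha', ha'x, (ha _).mp ⟨_, ?_, hac⟩, (hb _).mp ⟨_, ?_, (hfg i c').symm.trans hac⟩⟩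
  · rw [Set.mem_preimage, ← e₁, hc', hp]
    rfl
  · rw [Set.mem_preimage, ← e₂, hc', hq]
    rfl

/-- The generic point of the smallest weakly special subvariety containing a point. -/
noncomputable def ws (hF : IsTame F) {X : C} (x : (F.obj X).left) : (F.obj X).left :=
  (hF.exists_weaklySpecialHull x).choose

theorem isWeaklySpecialPoint_ws (hF : IsTame F) {X : C} (x : (F.obj X).left) :
    IsWeaklySpecialPoint F (hF.ws x) :=
  (hF.exists_weaklySpecialHull x).choose_spec.1.1

theorem ws_specializes (hF : IsTame F) {X : C} (x : (F.obj X).left) : hF.ws x ⤳ x :=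
  (hF.exists_weaklySpecialHull x).choose_spec.1.2

theorem specializes_ws (hF : IsTame F) {X : C} {x b : (F.obj X).left}
    (hb : IsWeaklySpecialPoint F b) (h : b ⤳ x) : b ⤳ hF.ws x :=
  (hF.exists_weaklySpecialHull x).choose_spec.2 b hb h

theorem ws_mem_imageOfFiber (hF : IsTame F) {X Y Z : C} (φ : Z ⟶ X) (ψ : Z ⟶ Y)
    {z : (F.obj Y).left} (hz : pdim F z = 0) {x : (F.obj X).left}
    (hx : x ∈ imageOfFiber F φ ψ z) : hF.ws x ∈ imageOfFiber F φ ψ z := by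
  obtain ⟨a, ha, hax, ha', -⟩ := hF.exists_isWeaklySpecialPoint φ ψ hz hx
  exact (hF.specializes_ws ha hax).mem_closed (hF.isClosed_imageOfFiber φ ψ hz) ha'

/-- A special subvariety meeting a fibre contains weakly special subvarieties of the fibre. -/
theorem exists_specializes_map_eq_ws (hF : IsTame F) {X Y Z : C} (φ : Z ⟶ X) (ψ : Z ⟶ Y)
    {a c : (F.obj Z).left} (ha : IsSpecialPoint F a) (hac : a ⤳ c)
    (hc : pdim F ((F.map ψ).left c) = 0) :
    ∃ c', a ⤳ c' ∧ (F.map ψ).left c' = (F.map ψ).left c ∧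
      (F.map φ).left c' = hF.ws ((F.map φ).left c) := by
  obtain ⟨E, χ, hχ⟩ := ha
  obtain ⟨e, rfl⟩ := (hχ c).mpr hac
  obtain ⟨e', he', h⟩ := hF.ws_mem_imageOfFiber (χ ≫ φ) (χ ≫ ψ) hc
    (x := (F.map φ).left ((F.map χ).left e))
    ⟨e, by rw [Set.mem_preimage, map_comp_apply]; rfl, map_comp_apply _ _ _⟩
  rw [Set.mem_preimage, map_comp_apply] at he'
  rw [map_comp_apply] at h
  exact ⟨_, (hχ _).mp ⟨e', rfl⟩, he', h⟩

/-- The defect condition. -/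
theorem pdim_sp_add_pdim_ws_le (hF : IsTame F) {X : C} {u t : (F.obj X).left} (hut : u ⤳ t) :
    pdim F (hF.sp u) + pdim F (hF.ws t) ≤ pdim F (hF.sp t) + pdim F (hF.ws u) := by
  obtain ⟨Y, Z, φ, ψ, z, hz, hu⟩ := hF.isWeaklySpecialPoint_ws u
  obtain ⟨P, p, q, hl, hs⟩ := hF.exists_product X Y
  obtain ⟨s, hs, hp, hq, hsp, hsd⟩ := hs z hz
  obtain ⟨χ, rfl, rfl⟩ := hl Z φ ψ
  -- The argument takes place in the special hull `D` of `u × {z}` inside `X × Y`.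
  have hD := hF.isSpecialPoint_sp (s u)
  have hpD : (F.map p).left (hF.sp (s u)) = hF.sp u := by rw [hF.map_sp, hp]
  have hqD (x) : (F.map q).left (hF.sp (s x)) = hF.sp z := by rw [hF.map_sp, hq]
  have hpt : (F.map p).left (hF.sp (s t)) = hF.sp t := by rw [hF.map_sp, hp]
  -- `D` lies in the image of `(φ, ψ)`, so its slice at `z` lies in the weakly special hull of `u`.
  have hle {x} (hx : hF.sp (s u) ⤳ s x) : hF.ws u ⤳ x := by
    obtain ⟨c, hc, hcu⟩ := (hu u).mpr (hF.ws_specializes u)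
    obtain ⟨g, hg⟩ := hF.exists_generic Z
    rw [Set.mem_preimage, Set.mem_singleton_iff, map_comp_apply] at hc
    rw [map_comp_apply] at hcu
    have h₁ : (F.map χ).left c = s u := by rw [hsp _ hc, hcu]
    have h₂ : (F.map χ).left g ⤳ hF.sp (s u) :=
      hF.specializes_sp (hF.isSpecialPoint_map _ (isSpecialPoint_generic hg))
        (h₁ ▸ (hg c).map (F.map χ).left.continuous)
    obtain ⟨c', hc'⟩ := (h₂.trans hx).mem_closed (hF.isClosed_range χ) ⟨g, rfl⟩
    refine (hu x).mp ⟨c', ?_, ?_⟩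
    · rw [Set.mem_preimage, map_comp_apply, hc', hq]
      rfl
    · rw [map_comp_apply, hc', hp]
  -- Constant fibre dimension of `q` on `D`, read off at a maximal point over `z`.
  have h₁ : pdim F (hF.sp (s u)) ≤ pdim F (hF.ws u) + pdim F (hF.sp z) := by
    obtain ⟨x, hx, hxz, hd⟩ := (hF.pdim_add_le q hD).2 z (hqD u ▸ hF.sp_specializes z)
    have h := hF.pdim_le (hle (hsp x hxz ▸ hx))
    have h' := hsd ((F.map p).left x)
    rw [← hsp x hxz] at h'
    rw [hqD] at hd
    omega
  -- The same for `p` on `D`, at the subvariety `sp (s t)`; the claim is the sum of the three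
  -- inequalities.
  have h₂ := (hF.pdim_add_le p hD).1 _ (hF.sp_specializes_sp (hut.map hs))
  -- The slice of `sp (s t)` at `z` contains the weakly special hull of `t`.
  have h₃ : pdim F (hF.ws t) + pdim F (hF.sp z) ≤ pdim F (hF.sp (s t)) := by
    obtain ⟨c', hc', hqc, hpc⟩ := hF.exists_specializes_map_eq_ws p q
      (hF.isSpecialPoint_sp (s t)) (hF.sp_specializes (s t)) (by rw [hq, hz])
    have h := (hF.pdim_add_le q (hF.isSpecialPoint_sp (s t))).1 c' hc'
    rw [hq] at hqc
    have h' := hsd ((F.map p).left c')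
    rw [← hsp c' hqc, hpc, hp] at h'
    rw [hqD, hqc] at h
    omega
  rw [hpD, hpt] at h₂
  omega

end IsTame

end Hulls


/-! ### Subvarieties and optimality in terms of generic points. -/

section Points

variable {C : Type v} [Category.{w} C] {K : Type u} [Field K] {F : C ⥤ SchemesOver K}

/-- The subvariety with a given generic point. -/
def cl (F : C ⥤ SchemesOver K) {X : C} (x : (F.obj X).left) : Subvariety F X :=
  ⟨closure {x}, isIrreducible_singleton.closure, isClosed_closure⟩

theorem coe_cl {X : C} (x : (F.obj X).left) : (cl F x : Set (F.obj X).left) = closure {x} := rfl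

theorem cl_le_iff {X : C} {x : (F.obj X).left} {V : Subvariety F X} : cl F x ≤ V ↔ x ∈ V := by
  rw [← SetLike.coe_subset_coe, coe_cl, V.isClosed.closure_subset_iff, Set.singleton_subset_iff]
  rfl

theorem cl_le_cl_iff {X : C} {x y : (F.obj X).left} : cl F x ≤ cl F y ↔ y ⤳ x := by
  rw [cl_le_iff, specializes_iff_mem_closure]
  rfl

theorem cl_injective {X : C} : Function.Injective (cl F (X := X)) := fun _ _ h =>
  (Specializes.antisymm (cl_le_cl_iff.mp h.ge) (cl_le_cl_iff.mp h.le)).eq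

theorem cl_surjective {X : C} : Function.Surjective (cl F (X := X)) := fun V => by
  refine ⟨V.isIrreducible.genericPoint, ?_⟩
  rw [← SetLike.coe_set_eq]
  exact V.isIrreducible.closure_genericPoint V.isClosed

theorem isSpecial_cl_iff {X : C} {a : (F.obj X).left} :
    IsSpecial F (cl F a) ↔ IsSpecialPoint F a := by
  refine exists_congr fun Y => exists_congr fun φ => ?_
  rw [Set.ext_iff]
  refine forall_congr' fun x => ?_
  rw [coe_cl, ← specializes_iff_mem_closure]
  exact Iff.comm

namespace IsTame

/-- The irreducible piece of `φ(ψ⁻¹(z))` through the generic point of a component is the whole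
component, by maximality. -/
theorem isWeaklySpecialPoint_of_isComponentOf (hF : IsTame F) {X Y Z : C} (φ : Z ⟶ X)
    (ψ : Z ⟶ Y) {z : (F.obj Y).left} (hz : pdim F z = 0) {a : (F.obj X).left}
    (ha : IsComponentOf (closure {a}) (imageOfFiber F φ ψ z)) :
    IsWeaklySpecialPoint F a ∧ (HasFiniteFibers (F.map φ) →
        ∀ c, pdim F c ≤ pdim F a + pdim F ((F.map ψ).left c)) := by
  obtain ⟨b, hb, hba, hb', h⟩ :=
    hF.exists_isWeaklySpecialPoint φ ψ hz (ha.prop.2 (subset_closure rfl))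
  have h₁ := ha.2 (y := closure {b}) ⟨isIrreducible_singleton.closure,
    closure_minimal (Set.singleton_subset_iff.mpr hb') (hF.isClosed_imageOfFiber φ ψ hz)⟩
    (closure_minimal (Set.singleton_subset_iff.mpr hba.mem_closure) isClosed_closure)
  have h₂ : b = a := (Specializes.antisymm hba (specializes_iff_mem_closure.mpr
    (h₁ (subset_closure rfl)))).eq
  exact h₂ ▸ ⟨hb, h⟩

theorem isWeaklySpecial_cl_iff (hF : IsTame F) {X : C} {a : (F.obj X).left} :
    IsWeaklySpecial F (cl F a) ↔ IsWeaklySpecialPoint F a := by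
  constructor
  · rintro ⟨Y, Z, φ, ψ, z, hz, ha⟩
    exact (hF.isWeaklySpecialPoint_of_isComponentOf φ ψ ((hF.isRationalPoint_iff z).mp hz) ha).1
  · rintro ⟨Y, Z, φ, ψ, z, hz, ha⟩
    have h : imageOfFiber F φ ψ z = closure {a} := Set.ext fun x => by
      rw [ha, specializes_iff_mem_closure]
    refine ⟨Y, Z, φ, ψ, z, (hF.isRationalPoint_iff z).mpr hz, ?_⟩
    rw [h]
    exact ⟨⟨isIrreducible_singleton.closure, subset_rfl⟩, fun s hs _ => hs.2⟩

theorem specialHull_cl (hF : IsTame F) {X : C} (x : (F.obj X).left) :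
    specialHull F (cl F x) = closure {hF.sp x} := by
  refine specialHull_eq_of_isLeast F (S := cl F (hF.sp x)) ⟨⟨?_, ?_⟩, ?_⟩
  · exact isSpecial_cl_iff.mpr (hF.isSpecialPoint_sp x)
  · exact cl_le_cl_iff.mpr (hF.sp_specializes x)
  · rintro V ⟨hV, hxV⟩
    obtain ⟨b, rfl⟩ := cl_surjective V
    exact cl_le_cl_iff.mpr (hF.specializes_sp (isSpecial_cl_iff.mp hV) (cl_le_cl_iff.mp hxV))

theorem weaklySpecialHull_cl (hF : IsTame F) {X : C} (x : (F.obj X).left) :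
    weaklySpecialHull F (cl F x) = closure {hF.ws x} := by
  refine weaklySpecialHull_eq_of_isLeast F (S := cl F (hF.ws x)) ⟨⟨?_, ?_⟩, ?_⟩
  · exact hF.isWeaklySpecial_cl_iff.mpr (hF.isWeaklySpecialPoint_ws x)
  · exact cl_le_cl_iff.mpr (hF.ws_specializes x)
  · rintro V ⟨hV, hxV⟩
    obtain ⟨b, rfl⟩ := cl_surjective V
    exact cl_le_cl_iff.mpr
      (hF.specializes_ws (hF.isWeaklySpecial_cl_iff.mp hV) (cl_le_cl_iff.mp hxV))

/-- The defect of the subvariety with a given generic point. -/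
noncomputable def δ (hF : IsTame F) {X : C} (x : (F.obj X).left) : ℤ :=
  pdim F (hF.sp x) - pdim F x

/-- The weak defect of the subvariety with a given generic point. -/
noncomputable def wδ (hF : IsTame F) {X : C} (x : (F.obj X).left) : ℤ :=
  pdim F (hF.ws x) - pdim F x

theorem dim_cl (hF : IsTame F) {X : C} (x : (F.obj X).left) :
    dim (cl F x : Set (F.obj X).left) = pdim F x :=
  hF.dim_closure x

theorem defect_cl (hF : IsTame F) {X : C} (x : (F.obj X).left) : defect F (cl F x) = hF.δ x := by
  rw [defect, hF.specialHull_cl, hF.dim_closure, hF.dim_cl, δ]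

theorem weakDefect_cl (hF : IsTame F) {X : C} (x : (F.obj X).left) :
    weakDefect F (cl F x) = hF.wδ x := by
  rw [weakDefect, hF.weaklySpecialHull_cl, hF.dim_closure, hF.dim_cl, wδ]

theorem δ_nonneg (hF : IsTame F) {X : C} (x : (F.obj X).left) : 0 ≤ hF.δ x := by
  have := hF.pdim_le (hF.sp_specializes x)
  rw [δ]
  omega

/-- The generic point of an optimal subvariety. -/
def IsOptimalPoint (hF : IsTame F) {X : C} (v w : (F.obj X).left) : Prop :=
  v ⤳ w ∧ ∀ u, v ⤳ u → u ⤳ w → u ≠ w → hF.δ w < hF.δ u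

/-- The set of generic points of optimal subvarieties of bounded defect. -/
def optimalPoints (hF : IsTame F) (d : ℤ) {X : C} (v : (F.obj X).left) : Set (F.obj X).left :=
  {w | hF.IsOptimalPoint v w ∧ hF.δ w ≤ d}

theorem isOptimal_cl_iff (hF : IsTame F) {X : C} {v w : (F.obj X).left} :
    IsOptimal F (cl F v) (cl F w) ↔ hF.IsOptimalPoint v w := by
  refine and_congr cl_le_cl_iff ⟨fun h u hvu huw hne => ?_, fun h U hU hUV => ?_⟩
  · rw [← hF.defect_cl, ← hF.defect_cl]
    exact h _ ((cl_le_cl_iff.mpr huw).lt_of_ne fun e => hne (cl_injective e).symm)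
      (cl_le_cl_iff.mpr hvu)
  · obtain ⟨u, rfl⟩ := cl_surjective U
    rw [hF.defect_cl, hF.defect_cl]
    exact h u (cl_le_cl_iff.mp hUV) (cl_le_cl_iff.mp hU.le) fun e => hU.ne (e ▸ rfl)

/-- By the defect condition, the weak defect grows at least as much as the defect when a subvariety
is enlarged. -/
theorem isWeaklyOptimal_cl (hF : IsTame F) {X : C} {v w : (F.obj X).left}
    (h : hF.IsOptimalPoint v w) : IsWeaklyOptimal F (cl F v) (cl F w) := by
  refine ⟨cl_le_cl_iff.mpr h.1, fun U hU hUV => ?_⟩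
  obtain ⟨u, rfl⟩ := cl_surjective U
  have h₁ := h.2 u (cl_le_cl_iff.mp hUV) (cl_le_cl_iff.mp hU.le) fun e => hU.ne (e ▸ rfl)
  have h₂ := hF.pdim_sp_add_pdim_ws_le (cl_le_cl_iff.mp hU.le)
  rw [hF.weakDefect_cl, hF.weakDefect_cl, wδ, wδ]
  rw [δ, δ] at h₁
  omega

theorem finitelyManyOptimal_cl_iff (hF : IsTame F) {d : ℤ} {X : C} {v : (F.obj X).left} :
    FinitelyManyOptimal F d (cl F v) ↔ (hF.optimalPoints d v).Finite := by
  have h : {W | IsOptimal F (cl F v) W ∧ defect F W ≤ d} = cl F '' hF.optimalPoints d v := by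
    ext W
    obtain ⟨w, rfl⟩ := cl_surjective W
    rw [cl_injective.mem_set_image, Set.mem_ofPred_eq, hF.isOptimal_cl_iff, hF.defect_cl]
    rfl
  rw [FinitelyManyOptimal, h, Set.finite_image_iff cl_injective.injOn]

theorem zp_iff (hF : IsTame F) {X : C} {m d : ℤ} :
    ZP F X m d ↔ ∀ v : (F.obj X).left, pdim F v ≤ m → (hF.optimalPoints d v).Finite := by
  rw [ZP, cl_surjective.forall]
  refine forall_congr' fun v => ?_
  rw [hF.dim_cl, hF.finitelyManyOptimal_cl_iff]

/-- Every subvariety is contained in an optimal one of at most the same defect. -/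
theorem exists_isOptimalPoint (hF : IsTame F) {X : C} {v u : (F.obj X).left} (h : v ⤳ u) :
    ∃ t, hF.IsOptimalPoint v t ∧ t ⤳ u ∧ hF.δ t ≤ hF.δ u := by
  induction hn : pdim F v - pdim F u using Nat.strong_induction_on generalizing u with
  | _ n ih =>
    by_cases hu : hF.IsOptimalPoint v u
    · exact ⟨u, hu, specializes_rfl, le_rfl⟩
    · obtain ⟨u', hvu', hu', hne, hδ⟩ : ∃ u', v ⤳ u' ∧ u' ⤳ u ∧ u' ≠ u ∧ hF.δ u' ≤ hF.δ u := by
        by_contra! h'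
        exact hu ⟨h, h'⟩
      have h₁ := hF.pdim_lt hu' hne
      have h₂ := hF.pdim_le hvu'
      obtain ⟨t, ht, htu, htδ⟩ := ih _ (by omega) hvu' rfl
      exact ⟨t, ht, htu.trans hu', htδ.trans hδ⟩

end IsTame

end Points

/-- A set in a Noetherian space is finite if every irreducible closed subset in which it is dense
has a proper closed subset outside of which there are only finitely many points of the set. -/
theorem finite_of_forall_exists_isClosed {T : Type*} [TopologicalSpace T] [NoetherianSpace T]
    [QuasiSober T] {G : Set T}
    (h : ∀ ξ : T, closure (G ∩ closure {ξ}) = closure {ξ} → ∃ D : Set T, IsClosed D ∧ ξ ∉ D ∧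
      ((G ∩ closure {ξ}) \ D).Finite) : G.Finite := by
  have key : ∀ A : Closeds T, (G ∩ A).Finite := by
    intro A
    induction A using WellFoundedLT.induction with
    | _ A ih =>
      by_cases hA : IsIrreducible (A : Set T)
      · have hξ := hA.closure_genericPoint A.isClosed
        by_cases hd : closure (G ∩ A) = A
        · rw [← hξ] at hd
          obtain ⟨D, hD, hξD, hfin⟩ := h _ hd
          rw [hξ] at hfin
          have hlt : A ⊓ ⟨D, hD⟩ < A := inf_lt_left.mpr fun hle =>
            hξD (hle (hξ.subset (subset_closure (Set.mem_singleton _))))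
          refine ((ih _ hlt).union hfin).subset fun x hx => ?_
          by_cases hxD : x ∈ D
          · exact Or.inl ⟨hx.1, hx.2, hxD⟩
          · exact Or.inr ⟨hx, hxD⟩
        · have hle : Closeds.closure (G ∩ A) ≤ A :=
            closure_minimal Set.inter_subset_right A.isClosed
          refine (ih _ (hle.lt_of_ne fun e => hd (congrArg SetLike.coe e))).subset fun x hx => ?_
          exact ⟨hx.1, subset_closure hx⟩
      -- A set that is not irreducible is covered by finitely many closed sets none of which
      -- contains it.
      · rw [isIrreducible_iff_sUnion_isClosed] at hA
        push Not at hA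
        obtain ⟨s, hs, hAs, hnot⟩ := hA
        refine (Set.Finite.biUnion s.finite_toSet (t := fun B => G ∩ (A ∩ B)) fun B hB => ?_).subset
          fun x hx => ?_
        · refine ih (A ⊓ ⟨B, hs B hB⟩) (inf_lt_left.mpr fun hle => hnot B hB hle)
        · obtain ⟨B, hB, hxB⟩ := hAs hx.2
          exact Set.mem_biUnion hB ⟨hx.1, hx.2, hxB⟩
  simpa using key ⊤

/-! ### From weak finiteness to finiteness of positive-dimensional optimal subvarieties. -/

section WeakFiniteness

variable {C : Type v} [Category.{w} C] {K : Type u} [Field K] {F : C ⥤ SchemesOver K}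

namespace IsTame

/-- Finiteness of the optimal subvarieties that come from a fixed pair of morphisms. -/
theorem finite_of_imageOfFiber (hF : IsTame F) {X Y Z : C} {φ : Y ⟶ X} {ψ : Y ⟶ Z}
    (hφ : HasFiniteFibers (F.map φ)) {m d : ℤ}
    (hZ : ∀ ζ : (F.obj Z).left, pdim F ζ ≤ m → (hF.optimalPoints d ζ).Finite)
    {v : (F.obj X).left} (hv : pdim F v ≤ m + 1) :
    {t | hF.IsOptimalPoint v t ∧ 1 ≤ pdim F t ∧ hF.δ t ≤ d ∧ ∃ z : (F.obj Z).left, pdim F z = 0 ∧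
      IsComponentOf (closure {hF.ws t}) (imageOfFiber F φ ψ z)}.Finite := by
  set G := {t | hF.IsOptimalPoint v t ∧ 1 ≤ pdim F t ∧ hF.δ t ≤ d ∧
    ∃ z : (F.obj Z).left, pdim F z = 0 ∧
      IsComponentOf (closure {hF.ws t}) (imageOfFiber F φ ψ z)} with hG
  have hd := hF.pdim_map_eq φ hφ
  have key (t) (ht : t ∈ G) : ∃ c, (F.map φ).left c = t ∧ pdim F ((F.map ψ).left c) = 0 ∧
      pdim F (hF.sp ((F.map ψ).left c)) + pdim F (hF.ws t) ≤ pdim F (hF.sp t) ∧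
      ∀ c', pdim F c' ≤ pdim F (hF.ws t) + pdim F ((F.map ψ).left c') := by
    obtain ⟨-, -, -, z, hz, hcomp⟩ := ht
    obtain ⟨c, hc, hct⟩ : t ∈ imageOfFiber F φ ψ z :=
      hcomp.prop.2 (hF.ws_specializes t).mem_closure
    replace hc : (F.map ψ).left c = z := hc
    refine ⟨c, hct, hc ▸ hz, ?_, (hF.isWeaklySpecialPoint_of_isComponentOf φ ψ hz hcomp).2 hφ⟩
    -- Since `φ` is quasi-finite, `sp c` has the dimension of `sp t`. Its fibre over `ψ c` has a
    -- point mapping to `ws t`, so constancy of the fibre dimension bounds `sp (ψ c)`.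
    obtain ⟨c', hc', h₁, h₂⟩ := hF.exists_specializes_map_eq_ws φ ψ (hF.isSpecialPoint_sp c)
      (hF.sp_specializes c) (hc ▸ hz)
    have h₃ := (hF.pdim_add_le ψ (hF.isSpecialPoint_sp c)).1 c' hc'
    rw [h₁, hc, hz, ← hd c', h₂, hct, hF.map_sp, ← hd (hF.sp c), hF.map_sp, hct, hc] at h₃
    rw [hc]
    omega
  have : Nonempty (F.obj Y).left := ⟨(hF.exists_generic Y).choose⟩
  choose! g hg using key
  have := hF.noetherianSpace Y
  suffices h : (g '' G).Finite from
    h.of_finite_image fun a ha b hb hab => by rw [← (hg a ha).1, hab, (hg b hb).1]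
  -- Noetherian induction on `Y`: it suffices to treat a subvariety with generic point `ξ` in which
  -- the chosen lifts `g t` are dense.
  refine finite_of_forall_exists_isClosed fun ξ hξ => ?_
  have hle : ∀ A : Set (F.obj Y).left, IsClosed A → g '' G ∩ closure {ξ} ⊆ A → ξ ∈ A :=
    fun A hA h => closure_minimal h hA (hξ.symm.subset (subset_closure (Set.mem_singleton ξ)))
  obtain ⟨O, hO, hξO, hOle⟩ := hF.exists_isOpen ψ ξ
  have hvξ : v ⤳ (F.map φ).left ξ := by
    rw [specializes_iff_mem_closure]
    refine hle _ (isClosed_closure.preimage (F.map φ).left.continuous) ?_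
    rintro _ ⟨⟨t, ht, rfl⟩, -⟩
    rw [Set.mem_preimage, (hg t ht).1]
    exact ht.1.1.mem_closure
  -- Near `ξ` the relative dimension of `ψ` is at least that at a lift `g t`, which is `pdim t ≥ 1`;
  -- here positive dimension pays for the drop from `m + 1` to `m`.
  have hζ : pdim F ((F.map ψ).left ξ) ≤ m := by
    obtain ⟨_, ⟨⟨t, ht, rfl⟩, htξ⟩, htO⟩ : ∃ c, c ∈ g '' G ∩ closure {ξ} ∧ c ∈ O := by
      by_contra! h
      exact hle Oᶜ hO.isClosed_compl h hξO
    have h₁ := hOle _ htO (specializes_iff_mem_closure.mpr htξ)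
    have h₂ := hF.pdim_le hvξ
    have h₃ := ht.2.1
    rw [(hg t ht).2.1, ← hd (g t), (hg t ht).1] at h₁
    rw [hd] at h₂
    omega
  -- The exceptional set to be removed besides `Oᶜ`: preimages of the finitely many optimal
  -- subvarieties properly contained in the closure of `ψ ξ`.
  set U := hF.optimalPoints d ((F.map ψ).left ξ) \ {(F.map ψ).left ξ} with hU
  refine ⟨Oᶜ ∪ ⋃ u ∈ U, (F.map ψ).left ⁻¹' closure {u}, ?_, ?_, ?_⟩
  · exact hO.isClosed_compl.union (((hZ _ hζ).subset Set.sdiff_subset).isClosed_biUnion fun u _ =>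
      isClosed_closure.preimage (F.map ψ).left.continuous)
  · rintro (h | h)
    · exact h hξO
    · obtain ⟨u, hu, huξ⟩ := Set.mem_iUnion₂.mp h
      exact hu.2 (Specializes.antisymm (specializes_iff_mem_closure.mpr huξ) hu.1.1.1).eq
  · refine (Set.finite_singleton (g ((F.map φ).left ξ))).subset ?_
    rintro _ ⟨⟨⟨t, ht, rfl⟩, htξ⟩, hnot⟩
    rw [Set.mem_union, not_or, Set.mem_compl_iff, not_not] at hnot
    obtain ⟨h₁, h₂, h₃, h₄⟩ := hg t ht
    have hξt := specializes_iff_mem_closure.mpr htξ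
    have hO' := hOle _ hnot.1 hξt
    have hφt : (F.map φ).left ξ ⤳ t := h₁ ▸ hξt.map (F.map φ).left.continuous
    obtain ⟨u, hu, huz, huδ⟩ :=
      hF.exists_isOptimalPoint (hξt.map (F.map ψ).left.continuous)
    have hws := hF.pdim_le (hF.ws_specializes t)
    have htd : hF.δ t ≤ d := ht.2.2.1
    have hδz : hF.δ ((F.map ψ).left (g t)) = pdim F (hF.sp ((F.map ψ).left (g t))) := by
      rw [δ, h₂, Nat.cast_zero, sub_zero]
    have hud : hF.δ u ≤ d := by
      rw [δ] at htd
      omega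
    -- An optimal subvariety through `ψ (g t)` has defect at most that of the point, hence at most
    -- `d`; off the exceptional set it must be everything.
    have huξ : u = (F.map ψ).left ξ := by
      by_contra hne
      exact hnot.2 (Set.mem_iUnion₂.mpr ⟨u, ⟨⟨hu, hud⟩, hne⟩, huz.mem_closure⟩)
    -- The fibres of `ψ` have dimension at most `pdim (ws t)`, which bounds the hull of `φ ξ`. With
    -- `hO'` and `huδ` this shows that enlarging `t` to `φ ξ` does not increase the defect, so
    -- optimality forces `t = φ ξ`.
    have h₅ := h₄ (hF.sp ξ)
    rw [hF.map_sp, ← hd, hF.map_sp] at h₅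
    rw [h₂, ← hd (g t), h₁, ← hd ξ] at hO'
    rw [hδz, huξ, δ] at huδ
    have hδ : hF.δ ((F.map φ).left ξ) ≤ hF.δ t := by
      rw [δ, δ]
      omega
    have : (F.map φ).left ξ = t := by
      by_contra hne
      exact (ht.1.2 _ hvξ hφt hne).not_ge hδ
    rw [Set.mem_singleton_iff, this]

theorem finite_optimalPoints_of_weakFinitenessWithin (hF : IsTame F) {S : Set C} {m d : ℤ}
    (hS : ∀ Z ∈ S, ZP F Z m d) {X : C} {v : (F.obj X).left} (hv : pdim F v ≤ m + 1)
    (h : WeakFinitenessWithin F S (cl F v)) :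
    {t | hF.IsOptimalPoint v t ∧ 1 ≤ pdim F t ∧ hF.δ t ≤ d}.Finite := by
  obtain ⟨Φ, hΦ, hΦS, h⟩ := h
  classical
  refine (hΦ.biUnion (t := fun p => if hp : p ∈ Φ ∧ HasFiniteFibers (F.map p.φ) then
    {t | hF.IsOptimalPoint v t ∧ 1 ≤ pdim F t ∧ hF.δ t ≤ d ∧
      ∃ z : (F.obj p.Z).left, pdim F z = 0 ∧
      IsComponentOf (closure {hF.ws t}) (imageOfFiber F p.φ p.ψ z)} else ∅) fun p hp => ?_).subset
    fun t ht => ?_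
  · split_ifs with hp'
    · exact hF.finite_of_imageOfFiber hp'.2 (hF.zp_iff.mp (hS _ (hΦS p hp).2)) hv
    · exact Set.finite_empty
  · obtain ⟨p, hp, z, hz, hfin, hcomp⟩ := h (cl F t) (hF.isWeaklyOptimal_cl ht.1)
    rw [hF.weaklySpecialHull_cl] at hcomp
    refine Set.mem_biUnion hp ?_
    rw [dif_pos ⟨hp, hfin⟩]
    exact ⟨ht.1, ht.2.1, ht.2.2, z, (hF.isRationalPoint_iff z).mp hz, hcomp⟩

end IsTame

end WeakFiniteness


/-! ### Hulls and optimality under extension of the ground field. -/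

section Comparison

/-- The closure of `x` is realized as the scheme-theoretic image of its residue field, an
irreducible scheme of finite type over `K`, and such schemes stay irreducible over `L`. -/
theorem isIrreducible_preimage_closure {K L : Type u} [Field K] [IsAlgClosed K] [Field L]
    [Algebra K L] {X X' : Scheme.{u}} {f : X ⟶ Spec (.of K)} [LocallyOfFiniteType f]
    [QuasiCompact f] {g : X' ⟶ X} {p : X' ⟶ Spec (.of L)}
    (h : IsPullback g p f (Spec.map (CommRingCat.ofHom (algebraMap K L)))) (x : X) :
    IsIrreducible (g ⁻¹' closure {x}) := by
  let j := X.fromSpecResidueField x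
  have hy : Set.range j = {x} := X.range_fromSpecResidueField x
  let y : j.image := j.toImage (IsLocalRing.closedPoint (X.residueField x))
  have hιy : j.imageι y = x := by
    have : (j.toImage ≫ j.imageι) (IsLocalRing.closedPoint (X.residueField x)) ∈ Set.range j := by
      rw [Scheme.Hom.toImage_imageι]
      exact ⟨_, rfl⟩
    rwa [hy] at this
  have hdense (c) : y ⤳ c := by
    rw [specializes_iff_mem_closure]
    have hr : Set.range j.toImage = {y} := by
      ext a
      constructor
      · rintro ⟨b, rfl⟩
        exact congrArg j.toImage (Subsingleton.elim b _)
      · rintro rfl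
        exact ⟨_, rfl⟩
    have hd : DenseRange j.toImage := IsDominant.denseRange
    rw [DenseRange, hr] at hd
    exact hd c
  have hrange : Set.range j.imageι = closure {x} := by
    refine Set.Subset.antisymm ?_ ?_
    · rintro _ ⟨c, rfl⟩
      have hc := (hdense c).map j.imageι.continuous
      rw [hιy] at hc
      exact hc.mem_closure
    · exact closure_minimal (Set.singleton_subset_iff.mpr ⟨y, hιy⟩)
        j.imageι.isClosedEmbedding.isClosed_range
  have hQ := IsPullback.of_hasPullback j.imageι g
  have hne : Nonempty ↥(pullback j.imageι g) := by
    obtain ⟨x', hx', -⟩ := Scheme.exists_preimage_of_isPullback h x (IsLocalRing.closedPoint L)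
      (Subsingleton.elim _ _)
    obtain ⟨q, -⟩ := Scheme.Pullback.exists_preimage_pullback y x' (hιy.trans hx'.symm)
    exact ⟨q⟩
  have : IrreducibleSpace ↥(pullback j.imageι g) := by
    refine irreducibleSpace_of_isPullback (j.imageι ≫ f) (𝟙 _) (fun z _ _ => ?_)
      (hQ.flip.paste_horiz h.flip).flip
    have e : (j.imageι ≫ f) ⁻¹' {z} = Set.univ :=
      Set.eq_univ_of_forall fun _ => Subsingleton.elim _ _
    have e' : closure {y} = Set.univ := Set.eq_univ_of_forall fun c => (hdense c).mem_closure
    rw [e, ← e']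
    exact isIrreducible_singleton.closure
  rw [← hrange, ← Scheme.Pullback.range_snd, ← Set.image_univ]
  exact (IrreducibleSpace.isIrreducible_univ _).image _
    (pullback.snd j.imageι g).continuous.continuousOn

variable {C : Type v} [Category.{w} C] {K L : Type u} [Field K] [Field L] [Algebra K L]
  {F : C ⥤ SchemesOver K} {F' : C ⥤ SchemesOver L}

/-- All distinguished varieties are of finite type. -/
def IsFiniteType (F : C ⥤ SchemesOver K) : Prop :=
  ∀ X, LocallyOfFiniteType (F.obj X).hom ∧ QuasiCompact (F.obj X).hom

namespace BaseChangeData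

theorem isFiniteType (β : BaseChangeData F F') (h : IsFiniteType F) : IsFiniteType F' := by
  intro X
  have := (h X).1
  have := (h X).2
  exact ⟨MorphismProperty.of_isPullback (β.isPullback X) inferInstance,
    MorphismProperty.of_isPullback (β.isPullback X) inferInstance⟩

theorem isOpenMap_π (β : BaseChangeData F F') (X : C) : IsOpenMap (β.π X) := by
  have : UniversallyOpen (β.π X) :=
    MorphismProperty.of_isPullback (β.isPullback X).flip inferInstance
  exact (β.π X).isOpenMap

theorem surjective_π (β : BaseChangeData F F') (X : C) : Function.Surjective (β.π X) := by
  intro x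
  obtain ⟨x', hx', -⟩ := Scheme.exists_preimage_of_isPullback (β.isPullback X) x
    (IsLocalRing.closedPoint L) (Subsingleton.elim _ _)
  exact ⟨x', hx'⟩

theorem range_map (β : BaseChangeData F F') {X Y : C} (f : X ⟶ Y) :
    Set.range (F'.map f).left = β.π Y ⁻¹' Set.range (F.map f).left := by
  rw [← Set.image_univ, ← Set.image_univ]
  exact Scheme.image_preimage_eq_of_isPullback (β.isPullback_map f) Set.univ

theorem pdim_le_pdim_π (β : BaseChangeData F F') (h : IsFiniteType F) {X : C}
    (x : (F'.obj X).left) : pdim F' x ≤ pdim F (β.π X x) := by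
  have := (h X).1
  have := (β.isFiniteType h X).1
  have h' := residueTrdeg_snd_le (β.isPullback X) x
  rw [← coe_pdim, ← coe_pdim] at h'
  exact_mod_cast h'

variable [IsAlgClosed K]

theorem exists_lift (β : BaseChangeData F F') (h : IsFiniteType F) {X : C} (y : (F.obj X).left) :
    ∃ x : (F'.obj X).left, ∀ x', x ⤳ x' ↔ y ⤳ β.π X x' := by
  have := (h X).1
  have := (h X).2
  have hI := isIrreducible_preimage_closure (β.isPullback X) y
  refine ⟨hI.genericPoint, fun x' => ?_⟩
  rw [specializes_iff_mem_closure, hI.closure_genericPoint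
    (isClosed_closure.preimage (β.π X).continuous), specializes_iff_mem_closure]
  rfl

/-- The generic point of the base change of the subvariety with generic point `y`. -/
noncomputable def lift (β : BaseChangeData F F') (h : IsFiniteType F) {X : C}
    (y : (F.obj X).left) : (F'.obj X).left :=
  (β.exists_lift h y).choose

variable (β : BaseChangeData F F') (h : IsFiniteType F)

theorem lift_specializes_iff {X : C} {y : (F.obj X).left} {x : (F'.obj X).left} :
    β.lift h y ⤳ x ↔ y ⤳ β.π X x :=
  (β.exists_lift h y).choose_spec x

theorem π_lift {X : C} (y : (F.obj X).left) : β.π X (β.lift h y) = y := by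
  obtain ⟨x, hx⟩ := β.surjective_π X y
  have h₁ : β.lift h y ⤳ x := (β.lift_specializes_iff h).mpr (hx ▸ specializes_rfl)
  have h₂ := h₁.map (β.π X).continuous
  rw [hx] at h₂
  exact (h₂.antisymm ((β.lift_specializes_iff h).mp specializes_rfl)).eq

theorem lift_specializes_lift_iff {X : C} {y z : (F.obj X).left} :
    β.lift h y ⤳ β.lift h z ↔ y ⤳ z := by
  rw [lift_specializes_iff, π_lift]

theorem pdim_lift (hF' : IsTame F') {X : C} (y : (F.obj X).left) :
    pdim F' (β.lift h y) = pdim F y := by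
  have := (h X).1
  have := (β.isFiniteType h X).1
  obtain ⟨t, ht⟩ : ∃ t, (F.obj X).hom y =
      Spec.map (CommRingCat.ofHom (algebraMap K L)) t :=
    ⟨IsLocalRing.closedPoint L, Subsingleton.elim _ _⟩
  obtain ⟨p, hp, -, hp'⟩ := exists_residueTrdeg_le_residueTrdeg_snd (β.isPullback X) ht
  rw [← coe_pdim, ← coe_pdim] at hp'
  refine le_antisymm ?_ (le_trans (by exact_mod_cast hp') (hF'.pdim_le (x := β.lift h y)
    ((β.lift_specializes_iff h).mpr (specializes_of_eq hp.symm))))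
  exact (β.pdim_le_pdim_π h _).trans_eq (by rw [π_lift])

theorem eq_lift_of_pdim_eq (hF' : IsTame F') {X : C} {x : (F'.obj X).left}
    (hx : pdim F (β.π X x) ≤ pdim F' x) : x = β.lift h (β.π X x) :=
  (hF'.eq_of_specializes ((β.lift_specializes_iff h).mpr specializes_rfl)
    (by rwa [β.pdim_lift h hF'])).symm

theorem isSpecialPoint_lift {X : C} {b : (F.obj X).left} (hb : IsSpecialPoint F b) :
    IsSpecialPoint F' (β.lift h b) := by
  obtain ⟨Y, φ, hφ⟩ := hb
  refine ⟨Y, φ, fun x => ?_⟩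
  rw [β.range_map, Set.mem_preimage, hφ, lift_specializes_iff]

/-- Images of distinguished morphisms commute with base change, so extending the field creates no
new special subvarieties. -/
theorem exists_eq_lift (hF : IsTame F) {X : C} {a : (F'.obj X).left} (ha : IsSpecialPoint F' a) :
    ∃ b, IsSpecialPoint F b ∧ a = β.lift h b := by
  obtain ⟨Y, φ, hφ⟩ := ha
  obtain ⟨g, hg⟩ := hF.exists_generic Y
  refine ⟨(F.map φ).left g, hF.isSpecialPoint_map φ (IsTame.isSpecialPoint_generic hg), ?_⟩
  have key (x) : a ⤳ x ↔ β.lift h ((F.map φ).left g) ⤳ x := by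
    rw [← hφ, β.range_map, Set.mem_preimage, lift_specializes_iff]
    constructor
    · rintro ⟨c, hc⟩
      exact hc ▸ (hg c).map (F.map φ).left.continuous
    · exact fun h => h.mem_closed (hF.isClosed_range φ) ⟨g, rfl⟩
  exact (Specializes.antisymm ((key _).mpr specializes_rfl) ((key _).mp specializes_rfl)).eq

theorem sp_eq_lift (hF : IsTame F) (hF' : IsTame F') {X : C} (x : (F'.obj X).left) :
    hF'.sp x = β.lift h (hF.sp (β.π X x)) := by
  obtain ⟨b, hb, hxb⟩ := β.exists_eq_lift h hF (hF'.isSpecialPoint_sp x)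
  have h₁ : b ⤳ β.π X x := (β.lift_specializes_iff h).mp (hxb ▸ hF'.sp_specializes x)
  refine (Specializes.antisymm ?_ ?_).eq
  · rw [hxb, lift_specializes_lift_iff]
    exact hF.specializes_sp hb h₁
  · exact hF'.specializes_sp (β.isSpecialPoint_lift h (hF.isSpecialPoint_sp _))
      ((β.lift_specializes_iff h).mpr (hF.sp_specializes _))

theorem pdim_sp (h : IsFiniteType F) (hF : IsTame F) (hF' : IsTame F') {X : C}
    (x : (F'.obj X).left) : pdim F' (hF'.sp x) = pdim F (hF.sp (β.π X x)) := by
  rw [β.sp_eq_lift h hF hF', β.pdim_lift h hF']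

theorem δ_lift (hF : IsTame F) (hF' : IsTame F') {X : C} (y : (F.obj X).left) :
    hF'.δ (β.lift h y) = hF.δ y := by
  rw [IsTame.δ, IsTame.δ, β.pdim_sp h hF hF', π_lift, β.pdim_lift h hF']

/-- Both sides are the dimension of the special hull, which base change preserves. Dimension gained
by the image is exactly defect lost. -/
theorem δ_π_le (h : IsFiniteType F) (hF : IsTame F) (hF' : IsTame F') {X : C}
    (x : (F'.obj X).left) :
    hF.δ (β.π X x) + pdim F (β.π X x) = hF'.δ x + pdim F' x := by
  rw [IsTame.δ, IsTame.δ, β.pdim_sp h hF hF', sub_add_cancel, sub_add_cancel]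

/-- Replacing `w` by the base change of its image stays inside `lift v` and does not increase the
defect, so optimality forbids a proper enlargement. -/
theorem eq_lift_of_isOptimalPoint (hF : IsTame F) (hF' : IsTame F') {X : C} {v : (F.obj X).left}
    {w : (F'.obj X).left} (hw : hF'.IsOptimalPoint (β.lift h v) w) : w = β.lift h (β.π X w) := by
  by_contra hne
  have h₁ := hw.2 (β.lift h (β.π X w))
    ((β.lift_specializes_lift_iff h).mpr ((β.lift_specializes_iff h).mp hw.1))
    ((β.lift_specializes_iff h).mpr specializes_rfl) (fun e => hne e.symm)
  have h₂ := β.δ_π_le h hF hF' w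
  have h₃ := β.pdim_le_pdim_π h w
  rw [β.δ_lift h hF hF'] at h₁
  omega

theorem finite_optimalPoints_lift (hF : IsTame F) (hF' : IsTame F') {X : C} {v : (F.obj X).left}
    {d : ℤ} (hv : (hF.optimalPoints d v).Finite) : (hF'.optimalPoints d (β.lift h v)).Finite := by
  refine (hv.image (β.lift h)).subset ?_
  rintro w ⟨hw, hwd⟩
  have e := β.eq_lift_of_isOptimalPoint h hF hF' hw
  refine ⟨β.π X w, ⟨⟨(β.lift_specializes_iff h).mp hw.1, fun u hvu huw hne => ?_⟩, ?_⟩, e.symm⟩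
  · rw [← β.δ_lift h hF hF', ← β.δ_lift h hF hF', ← e]
    refine hw.2 _ ((β.lift_specializes_lift_iff h).mpr hvu)
      ((β.lift_specializes_iff h).mpr huw) fun e' => hne ?_
    rw [← e', π_lift]
  · rwa [← β.δ_lift h hF hF', ← e]

end BaseChangeData

end Comparison


/-! ### The main finiteness step. -/

section Core

variable {C : Type v} [Category.{w} C] {K L : Type u} [Field K] [Field L] [Algebra K L]
  {F : C ⥤ SchemesOver K} {F' : C ⥤ SchemesOver L}

namespace IsTame

/-- Optimal subvarieties inside a proper closed subset are handled in lower dimension. -/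
theorem finite_optimalPoints_inter (hF : IsTame F) {X : C} {m d : ℤ} (hX : ZP F X (m - 1) d)
    {v : (F.obj X).left} (hv : pdim F v ≤ m) {E : Set (F.obj X).left} (hE : IsClosed E)
    (hEv : E ⊆ closure {v}) (hvE : v ∉ E) : (hF.optimalPoints d v ∩ E).Finite := by
  have := hF.noetherianSpace X
  obtain ⟨s, hs, hscl, hsirr, hsE⟩ := NoetherianSpace.exists_finite_set_isClosed_irreducible hE
  classical
  refine (Set.Finite.biUnion hs (t := fun A => if hA : A ∈ s then
    hF.optimalPoints d (hsirr A hA).genericPoint else ∅) fun A hA => ?_).subset ?_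
  · rw [dif_pos hA]
    have hg := (hsirr A hA).isGenericPoint_genericPoint (hscl A hA)
    have hvg : v ⤳ (hsirr A hA).genericPoint := specializes_iff_mem_closure.mpr
      (hEv (hsE ▸ Set.mem_sUnion_of_mem hg.mem hA))
    have hlt := hF.pdim_lt hvg fun e => hvE (e ▸ hsE ▸ Set.mem_sUnion_of_mem hg.mem hA)
    exact hF.zp_iff.mp hX _ (by omega)
  · rintro w ⟨⟨hw, hwd⟩, hwE⟩
    rw [hsE] at hwE
    obtain ⟨A, hA, hwA⟩ := hwE
    refine Set.mem_biUnion hA ?_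
    rw [dif_pos hA]
    have hg := (hsirr A hA).isGenericPoint_genericPoint (hscl A hA)
    have hvg : v ⤳ (hsirr A hA).genericPoint := specializes_iff_mem_closure.mpr
      (hEv (hsE ▸ Set.mem_sUnion_of_mem hg.mem hA))
    exact ⟨⟨hg.specializes hwA, fun u hu => hw.2 u (hvg.trans hu)⟩, hwd⟩

end IsTame

namespace BaseChangeData

/-- The main finiteness step: `v` is the generic point of a subvariety that is one dimension smaller
than its image over the smaller field. -/
theorem finite_optimalPoints [IsAlgClosed K] (β : BaseChangeData F F') (h : IsFiniteType F)
    (hF : IsTame F) (hF' : IsTame F') {X : C} {m d : ℤ} (hX : ZP F' X (m - 1) d)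
    {v : (F'.obj X).left} (hv : pdim F' v ≤ m) (hπ : pdim F (β.π X v) = pdim F' v + 1)
    (hfin : {t | hF.IsOptimalPoint (β.π X v) t ∧ 1 ≤ pdim F t ∧ hF.δ t ≤ d - 1}.Finite) :
    (hF'.optimalPoints d v).Finite := by
  set T := {t | hF.IsOptimalPoint (β.π X v) t ∧ 1 ≤ pdim F t ∧ hF.δ t ≤ d - 1} with hT
  -- The union of the fibres of `π` that lie entirely in the closure of `v`. It is closed as `π` is
  -- open, and misses `v` because the generic point of the fibre closure has dimension one more than
  -- `v`.
  set N := β.π X ⁻¹' (β.π X '' (closure {v})ᶜ)ᶜ with hN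
  have hNc : IsClosed N := IsClosed.preimage (β.π X).continuous
    (β.isOpenMap_π X _ isClosed_closure.isOpen_compl).isClosed_compl
  have hNv : N ⊆ closure {v} := fun x hx => by
    by_contra hxv
    exact hx ⟨x, hxv, rfl⟩
  have hvN : v ∉ N := fun hv => by
    have h₁ : β.lift h (β.π X v) ∈ closure {v} := by
      by_contra hxv
      exact hv ⟨_, hxv, β.π_lift h _⟩
    have h₂ := hF'.pdim_le (specializes_iff_mem_closure.mpr h₁)
    rw [β.pdim_lift h hF'] at h₂
    omega
  set E := N ∪ ⋃ t ∈ T \ {β.π X v}, (closure {v} ∩ β.π X ⁻¹' closure {t}) with hE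
  have hEfin : (hF'.optimalPoints d v ∩ E).Finite := by
    refine hF'.finite_optimalPoints_inter hX hv ?_ ?_ ?_
    · exact hNc.union ((hfin.subset Set.sdiff_subset).isClosed_biUnion fun t _ =>
        isClosed_closure.inter (isClosed_closure.preimage (β.π X).continuous))
    · exact Set.union_subset hNv (Set.iUnion₂_subset fun t _ => Set.inter_subset_left)
    · rintro (hv | hv)
      · exact hvN hv
      · obtain ⟨t, ht, -, htv⟩ := Set.mem_iUnion₂.mp hv
        exact ht.2 (Specializes.antisymm (specializes_iff_mem_closure.mpr htv) ht.1.1.1).eq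
  refine (hEfin.union (Set.finite_singleton v)).subset fun w hw => ?_
  by_cases hwv : w = v
  · exact Or.inr hwv
  refine Or.inl ⟨hw, ?_⟩
  rcases le_or_gt (pdim F (β.π X w)) (pdim F' w) with hle | hlt
  -- If the image of `w` gains no dimension, `w` is a base change, so the whole fibre of `π` through
  -- `w` lies in its closure.
  · refine Or.inl ?_
    rintro ⟨x, hx, hxw⟩
    refine hx (specializes_iff_mem_closure.mp (hw.1.1.trans ?_))
    rw [β.eq_lift_of_pdim_eq h hF' hle, lift_specializes_iff]
    exact specializes_of_eq hxw.symm
  · have h₁ := β.δ_π_le h hF hF' w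
    have h₂ := β.δ_π_le h hF hF' v
    have h₃ := hw.2
    obtain ⟨t, ht, htw, htδ⟩ := hF.exists_isOptimalPoint (hw.1.1.map (β.π X).continuous)
    have h₄ := hF.pdim_le htw
    -- Otherwise `δ v = δ (π v) + 1 ≤ δ (π w) + 1 ≤ δ w`, against optimality of `w ≠ v`. The strict
    -- gain of dimension at `w` also gives `pdim t ≥ 1` and `δ t ≤ d - 1`.
    have htv : t ≠ β.π X v := by
      rintro rfl
      have := hw.1.2 v specializes_rfl hw.1.1 (Ne.symm hwv)
      omega
    exact Or.inr (Set.mem_iUnion₂.mpr ⟨t, ⟨⟨ht, by omega, by omega⟩, htv⟩,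
      specializes_iff_mem_closure.mp hw.1.1, htw.mem_closure⟩)

end BaseChangeData

end Core


/-! ### Adjoining one element to an intermediate field. -/

section TranscendenceDegree

open IntermediateField.algebraAdjoinAdjoin Algebra

theorem trdeg_eq_of_isAlgebraic (R : Type u) (S : Type u) {A : Type u} [CommRing R] [Nontrivial R]
    [CommRing S] [CommRing A] [Algebra R S] [NoZeroDivisors A] [Algebra R A] [Algebra S A]
    [FaithfulSMul R S] [FaithfulSMul S A] [IsScalarTower R S A] [Algebra.IsAlgebraic S A] :
    trdeg R A = trdeg R S := by
  have := FaithfulSMul.algebraMap_injective S A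
  have h := trdeg_add_eq R S (A := A)
  have : Nontrivial S := (FaithfulSMul.algebraMap_injective R S).nontrivial
  have : Nontrivial A := (FaithfulSMul.algebraMap_injective S A).nontrivial
  rw [trdeg_eq_zero (R := S), add_zero] at h
  exact h.symm

theorem trdeg_adjoin_simple_le {M L : Type u} [Field M] [Field L] [Algebra M L] (a : L) :
    trdeg M (IntermediateField.adjoin M {a}) ≤ 1 := by
  rw [trdeg_eq_of_isAlgebraic M (Algebra.adjoin M {a}), ← Polynomial.trdeg_of_isDomain (R := M)]
  refine trdeg_le_of_surjective ((Polynomial.aeval a).codRestrict _ fun p => ?_) ?_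
  · exact adjoin_singleton_eq_range_aeval M a ▸ ⟨p, rfl⟩
  · rintro ⟨x, hx⟩
    have hx' := hx
    rw [adjoin_singleton_eq_range_aeval] at hx'
    obtain ⟨p, rfl⟩ := hx'
    exact ⟨p, rfl⟩

theorem trdeg_algebraicClosure_adjoin_simple_le {M L : Type u} [Field M] [Field L] [Algebra M L]
    (a : L) : trdeg M (algebraicClosure (IntermediateField.adjoin M {a}) L) ≤ 1 := by
  have : FaithfulSMul (IntermediateField.adjoin M {a})
      (algebraicClosure (IntermediateField.adjoin M {a}) L) :=
    (faithfulSMul_iff_algebraMap_injective _ _).mpr fun x y h =>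
      Subtype.ext (congrArg (fun z : algebraicClosure (IntermediateField.adjoin M {a}) L => (z : L)) h)
  rw [trdeg_eq_of_isAlgebraic M (IntermediateField.adjoin M {a})]
  exact trdeg_adjoin_simple_le a

end TranscendenceDegree

theorem fieldTrdeg_evaluation_top (E : Type u) [Field E] (y : Spec (.of E)) :
    fieldTrdeg (F := E) ((Scheme.ΓSpecIso (.of E)).inv ≫
      (Spec (.of E)).evaluation ⊤ y (Opens.mem_top y)).hom = 0 := by
  have h : (Scheme.ΓSpecIso (.of E)).inv ≫ (Spec (.of E)).evaluation ⊤ y (Opens.mem_top y) = _ :=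
    (Scheme.Spec.algebraMap_residueFieldIso_inv (.of E) y).symm
  have hm : (y.asIdeal : Ideal E).IsMaximal := by
    have hp : (y.asIdeal : Ideal E).IsPrime := y.isPrime
    rw [(Ideal.eq_bot_or_top (y.asIdeal : Ideal E)).resolve_right hp.ne_top]
    exact Ideal.bot_isMaximal
  refine fieldTrdeg_eq_zero_of_surjective ?_
  rw [h]
  exact (ConcreteCategory.bijective_of_isIso
    (Scheme.Spec.residueFieldIso (.of E) y).inv).surjective.comp
      (Ideal.algebraMap_residueField_surjective (R := E) y.asIdeal)

theorem residueTrdeg_SpecMap {K L : Type u} [Field K] [Field L] (f : K →+* L)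
    (x : Spec (.of L)) : residueTrdeg (Spec.map (CommRingCat.ofHom f)) x = fieldTrdeg f := by
  let α (E : Type u) [Field E] (y : Spec (.of E)) : E →+* (Spec (.of E)).residueField y :=
    ((Scheme.ΓSpecIso (.of E)).inv ≫
      (Spec (.of E)).evaluation ⊤ y (Opens.mem_top y)).hom
  set g := Spec.map (CommRingCat.ofHom f) with hg
  have key : ((Scheme.ΓSpecIso (.of K)).inv ≫
      (Spec (.of K)).evaluation ⊤ (g x) (Opens.mem_top _)) ≫ g.residueFieldMap x =
      CommRingCat.ofHom f ≫ (Scheme.ΓSpecIso (.of L)).inv ≫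
        (Spec (.of L)).evaluation ⊤ x (Opens.mem_top x) := by
    have h₁ := Scheme.ΓSpecIso_inv_naturality (CommRingCat.ofHom f)
    have h₂ := Scheme.evaluation_naturality g (V := ⊤) x (Opens.mem_top _)
    rw [Category.assoc, h₂, ← Category.assoc, ← Category.assoc, h₁]
    rfl
  have key' : (g.residueFieldMap x).hom.comp (α K (g x)) = (α L x).comp f :=
    congrArg CommRingCat.Hom.hom key
  have h := congrArg fieldTrdeg key'
  rw [fieldTrdeg_comp, fieldTrdeg_comp, fieldTrdeg_evaluation_top, fieldTrdeg_evaluation_top,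
    zero_add, add_zero] at h
  exact h

/-- An intermediate field that is algebraically closed and of finite transcendence degree. -/
structure IntermediateClosedField (K L : Type u) [Field K] [Field L] [Algebra K L] where
  carrier : Type u
  [field : Field carrier]
  [isAlgClosed : IsAlgClosed carrier]
  [algebra : Algebra K carrier]
  [algebra' : Algebra carrier L]
  [isScalarTower : IsScalarTower K carrier L]
  trdeg_lt : Algebra.trdeg K carrier < Cardinal.aleph0

attribute [instance] IntermediateClosedField.field IntermediateClosedField.isAlgClosed
  IntermediateClosedField.algebra IntermediateClosedField.algebra'
  IntermediateClosedField.isScalarTower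

/-- The new field is the algebraic closure of `E(a)` in `L`. -/
theorem IntermediateClosedField.exists_adjoin {K L : Type u} [Field K] [Field L] [Algebra K L]
    [IsAlgClosed L] (E : IntermediateClosedField K L) (a : L) :
    ∃ (E' : IntermediateClosedField K L) (_ : Algebra E.carrier E'.carrier)
      (_ : IsScalarTower K E.carrier E'.carrier) (_ : IsScalarTower E.carrier E'.carrier L),
      Algebra.trdeg E.carrier E'.carrier ≤ 1 ∧ a ∈ Set.range (algebraMap E'.carrier L) := by
  let M := algebraicClosure (IntermediateField.adjoin E.carrier {a}) L
  let : Algebra K M := ((algebraMap E.carrier M).comp (algebraMap K E.carrier)).toAlgebra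
  have : IsScalarTower K E.carrier M := .of_algebraMap_eq fun _ => rfl
  have : IsScalarTower K M L := .of_algebraMap_eq fun x => by
    rw [IsScalarTower.algebraMap_apply K E.carrier L]
    rfl
  have h₁ : Algebra.trdeg E.carrier M ≤ 1 := trdeg_algebraicClosure_adjoin_simple_le a
  have h₂ : Algebra.trdeg K M < Cardinal.aleph0 := by
    rw [← trdeg_add_eq K E.carrier]
    exact Cardinal.add_lt_aleph0 E.trdeg_lt (h₁.trans_lt Cardinal.one_lt_aleph0)
  have : IsAlgClosed M := IsAlgClosure.isAlgClosed (IntermediateField.adjoin E.carrier {a})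
  refine ⟨{ carrier := M, trdeg_lt := h₂ }, inferInstanceAs (Algebra E.carrier M),
    inferInstanceAs (IsScalarTower K E.carrier M),
    (IsScalarTower.of_algebraMap_eq fun _ => rfl : IsScalarTower E.carrier M L), h₁, ?_⟩
  exact ⟨algebraMap (IntermediateField.adjoin E.carrier {a}) M
    ⟨a, IntermediateField.mem_adjoin_simple_self _ a⟩, rfl⟩

/-! ### Towers of base changes. -/

section Tower

variable {C : Type v} [Category.{w} C] {K M L : Type u} [Field K] [Field M] [Field L]
  [Algebra K M] [Algebra M L] [Algebra K L] [IsScalarTower K M L]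

/-- The comparison between base changes to two extension fields. -/
noncomputable def BaseChangeData.tower (M L : Type u) [Field M] [Field L] [Algebra K M]
    [Algebra M L] [Algebra K L] [IsScalarTower K M L] (F : C ⥤ SchemesOver K) :
    BaseChangeData (UnlikelyIntersections.baseChange F M)
      (UnlikelyIntersections.baseChange F L) := by
  have e : Spec.map (CommRingCat.ofHom (algebraMap M L)) ≫
      Spec.map (CommRingCat.ofHom (algebraMap K M)) =
      Spec.map (CommRingCat.ofHom (algebraMap K L)) := by
    rw [← Spec.map_comp, ← CommRingCat.ofHom_comp, ← IsScalarTower.algebraMap_eq]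
  have h (X : C) := (BaseChangeData.baseChange F L).isPullback X
  rw [← e] at h
  have hw (X : C) := (h X).w
  exact
  { π X := ((BaseChangeData.baseChange F M).isPullback X).lift
      ((BaseChangeData.baseChange F L).π X) (((UnlikelyIntersections.baseChange F L).obj X).hom ≫
        Spec.map (CommRingCat.ofHom (algebraMap M L))) (by rw [hw, Category.assoc])
    isPullback X := by
      refine IsPullback.of_right ?_ (IsPullback.lift_snd _ _ _ _)
        ((BaseChangeData.baseChange F M).isPullback X)
      rw [IsPullback.lift_fst]
      exact h X
    naturality {X Y} f := by
      refine ((BaseChangeData.baseChange F M).isPullback Y).hom_ext ?_ ?_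
      · rw [Category.assoc, IsPullback.lift_fst, BaseChangeData.naturality, Category.assoc,
          BaseChangeData.naturality, ← Category.assoc, IsPullback.lift_fst]
      · rw [Category.assoc, IsPullback.lift_snd, Category.assoc, Over.w, IsPullback.lift_snd,
          ← Category.assoc, Over.w] }

theorem BaseChangeData.tower_π_comp (F : C ⥤ SchemesOver K) (X : C) :
    (tower M L F).π X ≫ (BaseChangeData.baseChange F M).π X =
      (BaseChangeData.baseChange F L).π X :=
  IsPullback.lift_fst _ _ _ _

theorem BaseChangeData.tower_π_comp_tower_π {M' : Type u} [Field M'] [Algebra K M']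
    [Algebra M M'] [Algebra M' L] [IsScalarTower K M' L] [IsScalarTower K M M']
    [IsScalarTower M M' L] (F : C ⥤ SchemesOver K) (X : C) :
    (tower M' L F).π X ≫ (tower M M' F).π X = (tower M L F).π X := by
  refine ((BaseChangeData.baseChange F M).isPullback X).hom_ext ?_ ?_
  · rw [Category.assoc, tower_π_comp, tower_π_comp, tower_π_comp]
  · rw [Category.assoc, (isPullback _ X).w, ← Category.assoc, (isPullback _ X).w, Category.assoc,
      (isPullback _ X).w, ← Spec.map_comp, ← CommRingCat.ofHom_comp, ← IsScalarTower.algebraMap_eq]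

/-- The residue field at `x` has transcendence degree at most `pdim x + n` over `K`, and contains
that of the image. -/
theorem BaseChangeData.pdim_π_le {F : C ⥤ SchemesOver K} {F' : C ⥤ SchemesOver L}
    (β : BaseChangeData F F') (h : IsFiniteType F) {n : ℕ} (hn : Algebra.trdeg K L ≤ n) {X : C}
    (x : (F'.obj X).left) : pdim F (β.π X x) ≤ pdim F' x + n := by
  have := (h X).1
  have := (β.isFiniteType h X).1
  have h₁ := residueTrdeg_comp (β.π X) (F.obj X).hom x
  rw [(β.isPullback X).w, residueTrdeg_comp, residueTrdeg_SpecMap, fieldTrdeg_algebraMap,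
    ← coe_pdim, ← coe_pdim] at h₁
  have h₂ : Cardinal.toENat (Algebra.trdeg K L) ≤ n := by
    rw [← Cardinal.toENat_nat]
    exact OrderHomClass.mono _ hn
  have h₃ : (pdim F (β.π X x) : ℕ∞) ≤ pdim F' x + n :=
    le_add_self.trans (h₁.symm.le.trans (by gcongr))
  exact_mod_cast h₃

end Tower


/-! ### Fields of definition. -/

section Spreading

theorem exists_ringHom_comp_eq {R M L : Type*} [Ring R] [Field M] [Ring L] [Nontrivial L]
    (i : M →+* L) (j : R →+* L) (h : ∀ r, j r ∈ i.range) : ∃ ρ : R →+* M, i.comp ρ = j := by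
  let e := RingEquiv.ofBijective i.rangeRestrict
    ⟨fun x y hxy => i.injective (congrArg Subtype.val hxy), i.rangeRestrict_surjective⟩
  refine ⟨e.symm.toRingHom.comp (j.codRestrict i.range h), RingHom.ext fun r => ?_⟩
  exact congrArg Subtype.val (e.apply_symm_apply (j.codRestrict i.range h r))

/-- If the subfield `M` of `L` contains `R`, opens defined over `R` are pulled back from the base
change to `M`. -/
theorem exists_subalgebraComparison_eq {W Z : Scheme.{u}} (φ : W ⟶ Z) {V : Z.Opens}
    (hV : IsAffineOpen V) {L : Type u} [Field L] [Algebra Γ(Z, V) L] {Q : Scheme.{u}} {g : Q ⟶ W}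
    {p : Q ⟶ Spec (.of L)}
    (hQ : IsPullback g p φ (Spec.map (CommRingCat.ofHom (algebraMap Γ(Z, V) L)) ≫ hV.fromSpec))
    (R : Subalgebra Γ(Z, V) L) {M : Type u} [Field M] (i : M →+* L) (hR : ∀ r ∈ R, r ∈ i.range)
    (j : Γ(Z, V) →+* M) (hj : i.comp j = algebraMap Γ(Z, V) L) {Q' : Scheme.{u}} {g' : Q' ⟶ W}
    {p' : Q' ⟶ Spec (.of M)} {π : Q ⟶ Q'} (hg : π ≫ g' = g)
    (hp : π ≫ p' = p ≫ Spec.map (CommRingCat.ofHom i))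
    (hQ' : g' ≫ φ = p' ≫ Spec.map (CommRingCat.ofHom j) ≫ hV.fromSpec) :
    ∃ c : Q' ⟶ pullback φ (subalgebraPoint hV R), subalgebraComparison φ hV hQ R = π ≫ c := by
  obtain ⟨ρ, hρ⟩ := exists_ringHom_comp_eq i (algebraMap R L) fun r => hR r r.2
  have hρj : ρ.comp (algebraMap Γ(Z, V) R) = j := by
    refine RingHom.ext fun x => i.injective ?_
    rw [← RingHom.comp_apply, ← RingHom.comp_assoc, hρ, ← RingHom.comp_apply, hj]
    rfl
  refine ⟨pullback.lift g' (p' ≫ Spec.map (CommRingCat.ofHom ρ)) ?_, ?_⟩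
  · rw [hQ', subalgebraPoint, Category.assoc, ← Spec.map_comp_assoc, ← CommRingCat.ofHom_comp, hρj]
  · refine pullback.hom_ext ?_ ?_
    · rw [Category.assoc, pullback.lift_fst, hg]
      exact pullback.lift_fst _ _ _
    · rw [Category.assoc, pullback.lift_snd, ← Category.assoc, hp, Category.assoc, ← Spec.map_comp,
        ← CommRingCat.ofHom_comp, hρ]
      exact pullback.lift_snd _ _ _

variable {C : Type v} [Category.{w} C] {K L : Type u} [Field K] [Field L] [Algebra K L]

/-- A subvariety over `L` is defined over every intermediate field that contains a suitable
finite set. -/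
theorem exists_finset_specializes (F : C ⥤ SchemesOver K) (h : IsFiniteType F)
    {X : C} (v : ((baseChange F L).obj X).left) :
    ∃ s : Finset L, ∀ E : IntermediateClosedField K L,
      (s : Set L) ⊆ Set.range (algebraMap E.carrier L) → ∀ x,
      (BaseChangeData.tower E.carrier L F).π X x = (BaseChangeData.tower E.carrier L F).π X v →
        v ⤳ x := by
  have := (h X).1
  let γ := (Scheme.ΓSpecIso (.of K))
  have hV := isAffineOpen_top (Spec (.of K))
  let : Algebra Γ(Spec (.of K), ⊤) L := ((algebraMap K L).comp γ.hom.hom).toAlgebra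
  have hfrom (E : Type u) [Field E] (f : K →+* E) :
      Spec.map (CommRingCat.ofHom (f.comp γ.hom.hom)) ≫ hV.fromSpec =
        Spec.map (CommRingCat.ofHom f) := by
    rw [IsAffineOpen.fromSpec_top, Scheme.isoSpec_Spec_inv, ← Spec.map_comp]
    congr 1
    exact γ.inv_hom_id_assoc (CommRingCat.ofHom f)
  have hQ : IsPullback ((BaseChangeData.baseChange F L).π X) ((baseChange F L).obj X).hom
      (F.obj X).hom (Spec.map (CommRingCat.ofHom (algebraMap Γ(Spec (.of K), ⊤) L)) ≫
        hV.fromSpec) := by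
    rw [show algebraMap Γ(Spec (.of K), ⊤) L = (algebraMap K L).comp γ.hom.hom from rfl, hfrom]
    exact (BaseChangeData.baseChange F L).isPullback X
  have hO : IsOpen (closure {v})ᶜ := isClosed_closure.isOpen_compl
  have hex (q : ((closure {v})ᶜ : Set ((baseChange F L).obj X).left)) :=
    exists_subalgebra_forall_exists_opens (F.obj X).hom hV hQ hO q.2
  choose R hR D hD hDO hqD using fun q => (hex q).imp fun R hR =>
    (⟨hR.1, hR.2 R le_rfl⟩ : _ ∧ _)
  have hN : NoetherianSpace ((baseChange F L).obj X).left := by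
    have := ((BaseChangeData.baseChange F L).isFiniteType h X).1
    have := ((BaseChangeData.baseChange F L).isFiniteType h X).2
    exact noetherianSpace_obj X
  -- By compactness, finitely many opens over finitely generated subalgebras cover the complement of
  -- the closure of `v`; their generators form `s`.
  obtain ⟨t, ht⟩ := (NoetherianSpace.isCompact (closure {v})ᶜ).elim_finite_subcover
    (fun q => subalgebraComparison (F.obj X).hom hV hQ (R q) ⁻¹' D q)
    (fun q => (hD q).preimage (subalgebraComparison (F.obj X).hom hV hQ (R q)).continuous)
    fun q hq => Set.mem_iUnion.mpr ⟨⟨q, hq⟩, hqD ⟨q, hq⟩⟩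
  choose s hs using hR
  classical
  refine ⟨t.biUnion s, fun E hE x hx => ?_⟩
  by_contra hvx
  obtain ⟨q, hq, hxq⟩ := Set.mem_iUnion₂.mp (ht fun hx => hvx (specializes_iff_mem_closure.mpr hx))
  have hle : R q ≤ { (algebraMap E.carrier L).range with
      algebraMap_mem' := fun r => ⟨algebraMap K E.carrier (γ.hom.hom r), by
        rw [← IsScalarTower.algebraMap_apply]
        rfl⟩ } := by
    rw [← hs q, Algebra.adjoin_le_iff]
    exact fun y hy => hE (Finset.mem_coe.mpr (Finset.mem_biUnion.mpr ⟨q, hq, hy⟩))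
  have hj : (algebraMap E.carrier L).comp ((algebraMap K E.carrier).comp γ.hom.hom) =
      algebraMap Γ(Spec (.of K), ⊤) L := by
    rw [← RingHom.comp_assoc, ← IsScalarTower.algebraMap_eq]
    rfl
  have hQ' := ((BaseChangeData.baseChange F E.carrier).isPullback X).w
  rw [← hfrom] at hQ'
  obtain ⟨c, hc⟩ := exists_subalgebraComparison_eq (F.obj X).hom hV hQ (R q)
    (algebraMap E.carrier L) (fun r hr => hle hr) _ hj
    (BaseChangeData.tower_π_comp F X) ((BaseChangeData.tower E.carrier L F).isPullback X).w hQ'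
  -- Membership in such an open depends only on the image in `X_E`, which `x` and `v` share; so `v`
  -- would lie in the complement of its own closure.
  refine hDO q (?_ : v ∈ _) (subset_closure rfl)
  rw [hc, Set.mem_preimage, Scheme.Hom.comp_apply] at hxq ⊢
  rwa [← hx]

end Spreading


/-! ### Trivial cases and monotonicity of `ZP`. -/

section ZP

variable {C : Type v} [Category.{w} C] {K : Type u} [Field K] {F : C ⥤ SchemesOver K}

theorem IsDistinguished.isFiniteType (hF : IsDistinguished F) : IsFiniteType F := fun X =>
  ⟨(hF.isVariety X).locallyOfFiniteType, (hF.isVariety X).quasiCompact⟩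

theorem IsDistinguished.isFiniteType_baseChange (hF : IsDistinguished F) (M : Type u) [Field M]
    [Algebra K M] : IsFiniteType (baseChange F M) :=
  (BaseChangeData.baseChange F M).isFiniteType hF.isFiniteType

theorem IsTame.zp_of_neg (hF : IsTame F) (X : C) {m d : ℤ} (h : m < 0 ∨ d < 0) : ZP F X m d := by
  rw [hF.zp_iff]
  intro v hv
  rcases h with h | h
  · omega
  · refine Set.finite_empty.subset fun w hw => ?_
    have := hF.δ_nonneg w
    have := hw.2
    omega

theorem ZP.mono {X : C} {m m' d d' : ℤ} (h : ZP F X m d) (hm : m' ≤ m) (hd : d' ≤ d) :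
    ZP F X m' d' := fun V hV =>
  (h V (hV.trans hm)).subset fun _ hW => ⟨hW.1, hW.2.trans hd⟩

end ZP

/-! ### Choice of the intermediate field and the induction. -/

section Descent

variable {C : Type v} [Category.{w} C] {K L : Type u} [Field K] [Field L]
  [IsAlgClosed L] [Algebra K L] {F : C ⥤ SchemesOver K}

theorem IsDistinguished.isTame [IsAlgClosed K] (hF : IsDistinguished F) : IsTame F :=
  (BaseChangeData.refl F).isTame hF

theorem IsDistinguished.isTame_baseChange [IsAlgClosed K] (hF : IsDistinguished F) (M : Type u)
    [Field M] [IsAlgClosed M] [Algebra K M] : IsTame (baseChange F M) :=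
  (BaseChangeData.baseChange F M).isTame hF

/-- Each adjunction of an element of `s` lowers the dimension of the image by at most one, so it
cannot jump past `pdim v + 1`. -/
theorem exists_pdim_eq_or_subset (hF : IsDistinguished F) {X : C}
    (v : ((baseChange F L).obj X).left) (s : Finset L) (E : IntermediateClosedField K L)
    (hE : pdim (baseChange F L) v <
      pdim (baseChange F E.carrier) ((BaseChangeData.tower E.carrier L F).π X v)) :
    (∃ E' : IntermediateClosedField K L,
      pdim (baseChange F E'.carrier) ((BaseChangeData.tower E'.carrier L F).π X v) =
        pdim (baseChange F L) v + 1) ∨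
    ∃ E' : IntermediateClosedField K L, (s : Set L) ⊆ Set.range (algebraMap E'.carrier L) ∧
      pdim (baseChange F L) v <
        pdim (baseChange F E'.carrier) ((BaseChangeData.tower E'.carrier L F).π X v) := by
  classical
  induction s using Finset.induction_on with
  | empty => exact Or.inr ⟨E, by simp, hE⟩
  | insert a s _ ih =>
    obtain h | ⟨E₁, hs, h₁⟩ := ih
    · exact Or.inl h
    by_cases heq : pdim (baseChange F E₁.carrier)
        ((BaseChangeData.tower E₁.carrier L F).π X v) = pdim (baseChange F L) v + 1
    · exact Or.inl ⟨E₁, heq⟩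
    obtain ⟨E₂, i₁, i₂, i₃, ht, ha⟩ := E₁.exists_adjoin a
    refine Or.inr ⟨E₂, ?_, ?_⟩
    · rw [Finset.coe_insert, Set.insert_subset_iff]
      refine ⟨ha, hs.trans ?_⟩
      rintro _ ⟨x, rfl⟩
      exact ⟨algebraMap E₁.carrier E₂.carrier x, (IsScalarTower.algebraMap_apply _ _ _ _).symm⟩
    · have h₂ := (BaseChangeData.tower E₁.carrier E₂.carrier F).pdim_π_le
        (hF.isFiniteType_baseChange _) (n := 1) (by simpa using ht)
        ((BaseChangeData.tower E₂.carrier L F).π X v)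
      rw [← Scheme.Hom.comp_apply, BaseChangeData.tower_π_comp_tower_π] at h₂
      omega

variable [IsAlgClosed K]

/-- Over a field of definition of `v` the image has the dimension of `v`, while over `K` it is
larger; in between the value `pdim v + 1` occurs. -/
theorem exists_pdim_eq (hF : IsDistinguished F) {X : C} (v : ((baseChange F L).obj X).left)
    (hv : pdim (baseChange F L) v < pdim F ((BaseChangeData.baseChange F L).π X v)) :
    ∃ E : IntermediateClosedField K L,
      pdim (baseChange F E.carrier) ((BaseChangeData.tower E.carrier L F).π X v) =
        pdim (baseChange F L) v + 1 := by
  obtain ⟨s, hs⟩ := exists_finset_specializes F hF.isFiniteType v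
  let E : IntermediateClosedField K L :=
    { carrier := K
      trdeg_lt := by
        rw [trdeg_eq_zero]
        exact Cardinal.aleph0_pos }
  have h₀ := (BaseChangeData.baseChange F K).pdim_π_le hF.isFiniteType (n := 0)
    (by rw [trdeg_eq_zero, Nat.cast_zero]) ((BaseChangeData.tower K L F).π X v)
  rw [← Scheme.Hom.comp_apply, BaseChangeData.tower_π_comp, add_zero] at h₀
  obtain h | ⟨E', hE', h'⟩ := exists_pdim_eq_or_subset hF v s E (hv.trans_le h₀)
  · exact h
  have hE'' := hF.isFiniteType_baseChange E'.carrier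
  have h₁ := (hF.isTame_baseChange L).pdim_le (hs E' hE' _
    ((BaseChangeData.tower E'.carrier L F).π_lift hE'' _))
  rw [(BaseChangeData.tower E'.carrier L F).pdim_lift hE'' (hF.isTame_baseChange L)] at h₁
  omega

/-- The main step, for subvarieties that are not defined over the ground field. -/
theorem finite_optimalPoints_of_pdim_lt (hF : IsDistinguished F) {S : Set C}
    (hS : ∀ X' ∈ S, ∀ (K' : Type u) [Field K'] [IsAlgClosed K'] [Algebra K K'],
      Algebra.trdeg K K' < Cardinal.aleph0 → ∀ V : Subvariety (baseChange F K') X',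
        WeakFinitenessWithin (baseChange F K') S V)
    {X : C} (hX : X ∈ S) {m d : ℤ} (h₁ : ZP (baseChange F L) X (m - 1) d)
    (h₂ : ∀ E : IntermediateClosedField K L, ∀ X' ∈ S, ZP (baseChange F E.carrier) X' m (d - 1))
    {v : ((baseChange F L).obj X).left} (hvm : pdim (baseChange F L) v ≤ m)
    (hv : pdim (baseChange F L) v < pdim F ((BaseChangeData.baseChange F L).π X v)) :
    ((hF.isTame_baseChange L).optimalPoints d v).Finite := by
  obtain ⟨E, hE⟩ := exists_pdim_eq hF v hv
  refine (BaseChangeData.tower E.carrier L F).finite_optimalPoints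
    (hF.isFiniteType_baseChange E.carrier) (hF.isTame_baseChange E.carrier)
    (hF.isTame_baseChange L) h₁ hvm hE ?_
  exact (hF.isTame_baseChange E.carrier).finite_optimalPoints_of_weakFinitenessWithin (h₂ E)
    (by omega) (hS X hX E.carrier E.trdeg_lt _)

theorem eq_lift_or_pdim_lt (hF : IsDistinguished F) {X : C}
    (v : ((baseChange F L).obj X).left) :
    (pdim F ((BaseChangeData.baseChange F L).π X v) = pdim (baseChange F L) v ∧
      v = (BaseChangeData.baseChange F L).lift hF.isFiniteType
        ((BaseChangeData.baseChange F L).π X v)) ∨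
    pdim (baseChange F L) v < pdim F ((BaseChangeData.baseChange F L).π X v) := by
  rcases ((BaseChangeData.baseChange F L).pdim_le_pdim_π hF.isFiniteType v).eq_or_lt with h | h
  · exact Or.inl ⟨h.symm, (BaseChangeData.baseChange F L).eq_lift_of_pdim_eq _
      (hF.isTame_baseChange L) h.symm.le⟩
  · exact Or.inr h

theorem zp_baseChange (hF : IsDistinguished F) {S : Set C}
    (hS : ∀ X' ∈ S, ∀ (K' : Type u) [Field K'] [IsAlgClosed K'] [Algebra K K'],
      Algebra.trdeg K K' < Cardinal.aleph0 → ∀ V : Subvariety (baseChange F K') X',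
        WeakFinitenessWithin (baseChange F K') S V) {m d : ℤ} (h : ∀ X ∈ S, ZP F X m d)
    (L : Type u) [Field L] [IsAlgClosed L] [Algebra K L] (X : C) (hX : X ∈ S) :
    ZP (baseChange F L) X m d := by
  -- Induction on a bound for `m + d`, over all `L` at once because `ZP` with `d - 1` is needed over
  -- intermediate fields. At the bottom `m` or `d` is negative.
  obtain ⟨n, hn⟩ : ∃ n : ℕ, m + d < n := ⟨(m + d + 1).toNat, by omega⟩
  induction n generalizing m d L X with
  | zero => exact (hF.isTame_baseChange L).zp_of_neg X (by omega)
  | succ n ih =>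
    rw [(hF.isTame_baseChange L).zp_iff]
    intro v hv
    rcases eq_lift_or_pdim_lt hF v with ⟨hd, hl⟩ | hlt
    · rw [hl]
      exact (BaseChangeData.baseChange F L).finite_optimalPoints_lift hF.isFiniteType hF.isTame
        (hF.isTame_baseChange L) (hF.isTame.zp_iff.mp (h X hX) _ (by omega))
    · exact finite_optimalPoints_of_pdim_lt hF hS hX
        (ih (fun X' hX' => (h X' hX').mono (by omega) le_rfl) L X hX (by omega))
        (fun E X' hX' => ih (fun X' hX' => (h X' hX').mono le_rfl (by omega)) E.carrier X' hX'
          (by omega)) hv hlt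

end Descent

end UnlikelyIntersections

/-! ### The theorem. -/

open UnlikelyIntersections
theorem mainTheorem1 {K L : Type u} [Field K] [IsAlgClosed K] [CharZero K]
    [Field L] [IsAlgClosed L] [Algebra K L]
    {C : Type v} [Category.{w} C]
    (F : C ⥤ SchemesOver K)
    (hF : IsVeryDistinguished F)
    (m d : ℕ) (X : C) (S : Set C) (hX : X ∈ S)
    (hS : ∀ X' ∈ S, ∀ (K' : Type u) [Field K'] [IsAlgClosed K'] [Algebra K K'],
      Algebra.trdeg K K' < Cardinal.aleph0 →
      ∀ V : Subvariety (baseChange F K') X',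
        WeakFinitenessWithin
          (baseChange F K') S V) :
    ((∀ X' ∈ S, ZP F X' m d) →
      ZP (baseChange F L) X m d) ∧
    ((∀ X' ∈ S, ZP F X' ((m : ℤ) - 1) d) →
      (∀ X' ∈ S, ZP F X' m ((d : ℤ) - 1)) →
      ∀ V : Subvariety (baseChange F L) X,
        dim
          (V : Set ((baseChange F L).obj X).left) ≤ m →
        ¬ IsBaseChangeOfSubvariety V →
        FinitelyManyOptimal
          (baseChange F L) d V) := by
  have hF' := hF.isDistinguished
  refine ⟨fun h => zp_baseChange hF' hS h L X hX, fun h₁ h₂ V hV hVb => ?_⟩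
  obtain ⟨v, rfl⟩ := cl_surjective V
  rw [(hF'.isTame_baseChange L).dim_cl] at hV
  rw [(hF'.isTame_baseChange L).finitelyManyOptimal_cl_iff]
  refine finite_optimalPoints_of_pdim_lt hF' hS hX (zp_baseChange hF' hS h₁ L X hX)
    (fun E X' hX' => zp_baseChange hF' hS h₂ E.carrier X' hX') hV
    ((eq_lift_or_pdim_lt hF' v).resolve_left fun h => hVb ?_)
  -- If the image over `K` had the same dimension, `V` would be the base change of the closure of
  -- that image.
  refine ⟨cl F ((BaseChangeData.baseChange F L).π X v), Set.ext fun x => ?_⟩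
  have hx := (BaseChangeData.baseChange F L).lift_specializes_iff hF'.isFiniteType
    (y := (BaseChangeData.baseChange F L).π X v) (x := x)
  rw [← h.2, specializes_iff_mem_closure, specializes_iff_mem_closure] at hx
  exact hx
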